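/- Let $\mathbb X$ be a Polish space, let $\tilde N$ be a (simple) Poisson point process on $\mathbb X$ with locally finite mean measure $\omega$, and let $\Phi$ be an a.s. finite point process whose law is absolutely continuous with respect to the law of $\tilde N$, with density $f_\Phi$ (a Gibbs point process): $\mathbf P_\Phi(d\nu)=f_\Phi(\nu)\,\mathbf P_{\tilde N}(d\nu)$. Let $H$ be a probability measure on $(0,\infty)$ and $\psi(u)=\int e^{-us}H(ds)$. For a finite point process $P$ and a mark law $G$, let $\mathrm{RM}(P,G)$ be the law of $A\mapsto\int_{A\times\mathbb R_+}s\,\Psi(dx\,ds)=\sum_jS_j\delta_{X_j}(A)$, where $\Psi=\sum_j\delta_{(X_j,S_j)}$ arises by attaching to the points $X_j$ of a process with law $P$ i.i.d. marks $S_j$ with law $G$, independent of the points. For distinct points $y_1^*,\dots,y_k^*$ ($k\ge1$) and $u>0$, let $\Phi'=\sum_j\delta_{X_j'}$ be the point process with density $$f_{\Phi'}(\nu)=\frac{\exp\{\int_{\mathbb X}\log\psi(u)\,\nu(dx)\}\,f_\Phi(\nu+\sum_{j=1}^k\delta_{y_j^*})}{\mathsf E\big[\exp\{\int_{\mathbb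 X}\log\psi(u)\,\tilde N(dx)\}\,f_\Phi(\tilde N+\sum_{j=1}^k\delta_{y_j^*})\big]}$$ with respect to $\tilde N$ (the numerator equals $\psi(u)^{\nu(\mathbb X)}f_\Phi(\nu+\sum_j\delta_{y^*_j})$ for finite $\nu$), let $H'(ds)=e^{-su}H(ds)/\psi(u)$, and let $\tilde\eta=\sum_jS_j'\delta_{X_j'}$ have law $\mathrm{RM}(\mathbf P_{\Phi'},H')$. (a) Let $\Phi^!_{\mathbf y}$, $\mathbf y\in\mathbb X^k$, be a version of the $k$-th reduced Palm distributions of $\Phi$ on tuples of distinct points: the laws of $\Phi^!_{\mathbf y}+\sum_j\delta_{y_j}$ disintegrate the Campbell measure $\mathsf E[1_L(\Phi)\Phi^k(B)]$ with respect to the moment measure $M_{\Phi^k}(B)=\mathsf E[\Phi^k(B)]$. Then for $M_{\Phi^k}$-almost every $\mathbf y^*$ with distinct entries and every $u>0$: the denominator of $f_{\Phi'}$ is positive and finite; the laws of $\tilde\mu^!_{\mathbf y^*}\sim\mathrm{RM}(\mathbf P_{\Phi^!_{\mathbf y^*}},H)$ and of $\tilde\eta$ exist; and a random finite measure $\tilde\mu'$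 on $\mathbb X$ satisfies $$\mathsf E\,e^{-\int g\,d\tilde\mu'}=\frac{\mathsf E\exp\{-\int(g(z)+u)\,\tilde\mu^!_{\mathbf y^*}(dz)\}}{\mathsf E\exp\{-\int u\,\tilde\mu^!_{\mathbf y^*}(dz)\}}\quad\text{for all bounded measurable } g\ge0$$ if and only if $\tilde\mu'$ has the same law as $\tilde\eta$. (b) Let $n\ge1$, let $\tilde\mu\sim\mathrm{RM}(\mathbf P_\Phi,H)$ and $T=\tilde\mu(\mathbb X)$. Given $\tilde\mu$ with $T>0$, let $Y_1,\dots,Y_n$ be i.i.d. from $\tilde\mu/T$ and, independently of them, let $U_n$ have the Gamma law with shape $n$ and rate $T$ (no sample is generated if $T=0$). Then, for almost every $(\mathbf y,u)$ with respect to the law of $(\mathbf Y,U_n)$, with $y_1^*,\dots,y_k^*$ the distinct values in $\mathbf y$ and $n_1,\dots,n_k$ their multiplicities, the denominator of $f_{\Phi'}$ is positive and finite and the conditional law of $\tilde\mu$ given $\mathbf Y=\mathbf y$, $U_n=u$ is the law of $\sum_{j=1}^kS_j^*\delta_{y_j^*}+\tilde\eta$, where $S_1^*,\dots,S_k^*,\tilde\eta$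 are independent and $S_j^*$ has law proportional to $e^{-us}s^{n_j}H(ds)$. -/

import Mathlib

open MeasureTheory ProbabilityTheory
open scoped ENNReal NNReal

namespace NRM

noncomputable section

/- Random measures on `E` are described by their laws: measures on the space `Measure E`, whose
`σ`-algebra is the one generated by the evaluations `ν ↦ ν A`, for `A` measurable. -/

/-! ### Point processes -/

/-- The configuration `∑ⱼ δ_{xⱼ}` of a finite tuple of points. -/
def pointSum {E : Type*} [MeasurableSpace E] {k : ℕ} (x : Fin k → E) : Measure E :=
  ∑ j, Measure.dirac (x j)

/-- `ν` is a simple point measure: a locally finite sum of unit masses at the points of a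
countable set. -/
def IsSimplePointMeasure {E : Type*} [TopologicalSpace E] [MeasurableSpace E]
    (ν : Measure E) : Prop :=
  IsLocallyFiniteMeasure ν ∧
    ∃ s : Set E, s.Countable ∧ ν = Measure.sum (fun x : s => Measure.dirac (x : E))

/-- `P` is the law of a (simple) point process on `E`. -/
structure IsPointProcess {E : Type*} [TopologicalSpace E] [MeasurableSpace E]
    (P : Measure (Measure E)) : Prop where
  isProbabilityMeasure : IsProbabilityMeasure P
  ae_isSimple : ∀ᵐ ν ∂P, IsSimplePointMeasure ν

/-- `P` is the law of a Poisson point process on `E` with mean measure `ω`: the numbers of points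
in disjoint sets are independent, and Poisson with parameters the `ω`-measures of the sets. -/
structure IsPoissonProcess {E : Type*} [TopologicalSpace E] [MeasurableSpace E]
    (ω : Measure E) (P : Measure (Measure E)) : Prop where
  isPointProcess : IsPointProcess P
  counts_law : ∀ A : Set E, MeasurableSet A → ω A ≠ ∞ →
    P.map (fun ν : Measure E => ν A) =
      (poissonMeasure (ω A).toNNReal).map (fun n : ℕ => (n : ℝ≥0∞))
  counts_indep : ∀ (m : ℕ) (A : Fin m → Set E), (∀ i, MeasurableSet (A i)) →
    (∀ i, ω (A i) ≠ ∞) → Pairwise (fun i j => Disjoint (A i) (A j)) →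
    iIndepFun (fun (i : Fin m) (ν : Measure E) => ν (A i)) P

/-- `P` is the law of a Gibbs point process with density `f` with respect to the law `PN`:
`P(dν) = f(ν) PN(dν)`. -/
structure IsGibbs {E : Type*} [TopologicalSpace E] [MeasurableSpace E]
    (PN : Measure (Measure E)) (f : Measure E → ℝ≥0) (P : Measure (Measure E)) : Prop where
  measurable_density : Measurable f
  isPointProcess : IsPointProcess P
  eq_withDensity : P = PN.withDensity (fun ν => (f ν : ℝ≥0∞))

/-! ### Marked point processes and the random measures built from them -/

/-- The configuration `∑_{j < m} δ_{xⱼ}`. -/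
def config {E : Type*} [MeasurableSpace E] (m : ℕ) (x : ℕ → E) : Measure E :=
  ∑ j ∈ Finset.range m, Measure.dirac (x j)

/-- `PΨ` is the law of the point process on `E × ℝ₊` obtained by attaching i.i.d. marks with law
`H` to the points of the finite point process with law `P`. Here `ρ` is the joint law of the number
`M` of points and of a sequence `(Xⱼ)` whose first `M` terms enumerate the points, and the mark
sequence `(Sⱼ)` is i.i.d. from `H` and independent of `(M, (Xⱼ))`. -/
def IsMarking {E : Type*} [MeasurableSpace E] (P : Measure (Measure E)) (H : Measure ℝ≥0)
    (PΨ : Measure (Measure (E × ℝ≥0))) : Prop :=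
  ∃ ρ : Measure (ℕ × (ℕ → E)), IsProbabilityMeasure ρ ∧
    ρ.map (fun q => config q.1 q.2) = P ∧
    PΨ = (ρ.prod (Measure.infinitePi (fun _ : ℕ => H))).map
      (fun q => config q.1.1 (fun j => (q.1.2 j, q.2 j)))

/-- The measure `A ↦ ∫_{A × ℝ₊} s ψ(dx ds)`. -/
def jumpMeasure {E : Type*} [MeasurableSpace E] (ψ : Measure (E × ℝ≥0)) : Measure E :=
  (ψ.withDensity (fun p => (p.2 : ℝ≥0∞))).map Prod.fst

/-- `Q` is the law `RM(P, H)` of the random measure `A ↦ ∫_{A × ℝ₊} s Ψ(dx ds) = ∑ⱼ Sⱼ δ_{Xⱼ}(A)`,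
with `Ψ` obtained by attaching i.i.d. marks with law `H` to the point process with law `P`. -/
def IsRM {E : Type*} [MeasurableSpace E] (P : Measure (Measure E)) (H : Measure ℝ≥0)
    (Q : Measure (Measure E)) : Prop :=
  ∃ PΨ : Measure (Measure (E × ℝ≥0)), IsMarking P H PΨ ∧ Q = PΨ.map jumpMeasure

/-- The Laplace functional `E[exp(-∫ g dμ)]` of a random finite measure with law `Q`. -/
def laplaceFunctional {E : Type*} [MeasurableSpace E] (Q : Measure (Measure E)) (g : E → ℝ) : ℝ :=
  ∫ μ, Real.exp (-∫ x, g x ∂μ) ∂Q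

/-! ### Palm distributions -/

/-- The `k`-th Campbell measure of `B × L`, that is `E[1_L(Φ) Φᵏ(B)]`. -/
def campbell {E : Type*} [MeasurableSpace E] (P : Measure (Measure E)) (k : ℕ)
    (B : Set (Fin k → E)) (L : Set (Measure E)) : ℝ≥0∞ :=
  ∫⁻ ν in L, Measure.pi (fun _ : Fin k => ν) B ∂P

/-- The `k`-th moment measure `B ↦ E[Φᵏ(B)]`. -/
def momentMeasure {E : Type*} [MeasurableSpace E] (P : Measure (Measure E)) (k : ℕ) :
    Measure (Fin k → E) :=
  P.bind (fun ν => Measure.pi (fun _ : Fin k => ν))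

/-- `R` is a `k`-th reduced Palm kernel, on tuples of distinct points: if `Φ!_y` has law `R y`, then
the laws of `Φ_y = Φ!_y + ∑ⱼ δ_{yⱼ}` disintegrate the `k`-th Campbell measure with respect to
the `k`-th moment measure. -/
def IsReducedPalm {E : Type*} [MeasurableSpace E] (P : Measure (Measure E)) (k : ℕ)
    (R : Kernel (Fin k → E) (Measure E)) : Prop :=
  IsMarkovKernel R ∧
    ∀ (B : Set (Fin k → E)) (L : Set (Measure E)), MeasurableSet B → MeasurableSet L →
      (∀ y ∈ B, Function.Injective y) →
      campbell P k B L = ∫⁻ y in B, R y {ν | ν + pointSum y ∈ L} ∂(momentMeasure P k)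

/-! ### The posterior quantities -/

/-- The Laplace transform `ψ(u) = ∫ exp(-u s) H(ds)`. -/
def psi (H : Measure ℝ≥0) (u : ℝ) : ℝ := ∫ s, Real.exp (-(u * (s : ℝ))) ∂H

/-- The exponentially tilted law `H'(ds) = exp(-u s) H(ds) / ∫ exp(-u t) H(dt)`. -/
def tiltedMark (H : Measure ℝ≥0) (u : ℝ) : Measure ℝ≥0 :=
  H.tilted (fun s => -(u * (s : ℝ)))

/-- The unnormalised density `exp(∫ log ψ(u) ν(dx)) f(ν + ξ)`, where `ξ` is the
configuration of the observed distinct values. -/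
def postWeight {E : Type*} [MeasurableSpace E] (f : Measure E → ℝ≥0) (H : Measure ℝ≥0)
    (u : ℝ) (ξ : Measure E) (ν : Measure E) : ℝ≥0 :=
  (Real.exp (∫ _x, Real.log (psi H u) ∂ν)).toNNReal * f (ν + ξ)

/-- The normalising constant `E[exp(∫ log ψ(u) N(dx)) f(N + ξ)]`, with `N` of law `PN`. -/
def postConst {E : Type*} [MeasurableSpace E] (PN : Measure (Measure E)) (f : Measure E → ℝ≥0)
    (H : Measure ℝ≥0) (u : ℝ) (ξ : Measure E) : ℝ≥0∞ :=
  ∫⁻ ν, (postWeight f H u ξ ν : ℝ≥0∞) ∂PN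

/-- The density of `Φ'` with respect to the Poisson process. -/
def postDensity {E : Type*} [MeasurableSpace E] (PN : Measure (Measure E)) (f : Measure E → ℝ≥0)
    (H : Measure ℝ≥0) (u : ℝ) (ξ : Measure E) (ν : Measure E) : ℝ≥0 :=
  postWeight f H u ξ ν / (postConst PN f H u ξ).toNNReal

/-- `Q` is the law of the random measure `η̃` built from the Gibbs point process `Φ'`, whose density
with respect to the Poisson process is `postDensity`, and from i.i.d. marks with the
exponentially tilted law. The normalising constant is positive and finite. -/
def IsPostRM {E : Type*} [TopologicalSpace E] [MeasurableSpace E] (PN : Measure (Measure E))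
    (f : Measure E → ℝ≥0) (H : Measure ℝ≥0) (u : ℝ) (ξ : Measure E)
    (Q : Measure (Measure E)) : Prop :=
  postConst PN f H u ξ ≠ 0 ∧ postConst PN f H u ξ ≠ ∞ ∧
    ∃ P' : Measure (Measure E), IsGibbs PN (postDensity PN f H u ξ) P' ∧
      IsRM P' (tiltedMark H u) Q

/-! ### The sampling model and the posterior distribution -/

/-- `J` is the joint law of `((Y₁, …, Yₙ), U)` and `μ̃`: `μ̃` has law `Pμ`; given `μ̃`, the `Yᵢ` are
i.i.d. from `μ̃ / T`, with `T = μ̃(E)`, and `U` is independent of them with law Gamma(`n`, `T`) (shape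
`n`, rate `T`). No sample is generated when `T = 0`: the mass of `J` is `P(T > 0)`. -/
def IsModelLaw {E : Type*} [MeasurableSpace E] (n : ℕ) (Pμ : Measure (Measure E))
    (J : Measure (((Fin n → E) × ℝ) × Measure E)) : Prop :=
  ∀ (C : Fin n → Set E) (B : Set ℝ) (L : Set (Measure E)), (∀ i, MeasurableSet (C i)) →
    MeasurableSet B → MeasurableSet L →
    J ((Set.univ.pi C ×ˢ B) ×ˢ L) =
      ∫⁻ μ in L, (∏ i, (μ (C i) / μ Set.univ)) *
        gammaMeasure (n : ℝ) (μ Set.univ).toReal B ∂Pμ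

open Classical in
/-- The distinct values `y*` of a sample. -/
def distinctValues {E : Type*} {n : ℕ} (y : Fin n → E) : Finset E := Finset.univ.image y

open Classical in
/-- The number of occurrences of `x` in a sample. -/
def multiplicity {E : Type*} {n : ℕ} (y : Fin n → E) (x : E) : ℕ :=
  (Finset.univ.filter (fun i => y i = x)).card

/-- The configuration `∑_{x ∈ y*} δₓ` of the distinct values of a sample. -/
def distinctConfig {E : Type*} [MeasurableSpace E] {n : ℕ} (y : Fin n → E) : Measure E :=
  ∑ x ∈ distinctValues y, Measure.dirac x

/-- The law on `ℝ₊` proportional to `exp(-u s) sᵐ H(ds)`. -/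
def jumpLaw (H : Measure ℝ≥0) (u : ℝ) (m : ℕ) : Measure ℝ≥0 :=
  (∫⁻ s, ENNReal.ofReal (Real.exp (-(u * (s : ℝ))) * (s : ℝ) ^ m) ∂H)⁻¹ •
    H.withDensity (fun s => ENNReal.ofReal (Real.exp (-(u * (s : ℝ))) * (s : ℝ) ^ m))

/-- The law of `∑_{x ∈ y*} S*ₓ δₓ + μ̃'`, where `μ̃'` has law `Q`, the `S*ₓ` are independent with
laws `jumpLaw H u nₓ`, with `nₓ` the number of occurrences of `x` in the sample `y`, and are
independent of `μ̃'`. -/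
def posteriorLaw {E : Type*} [MeasurableSpace E] {n : ℕ} (H : Measure ℝ≥0) (y : Fin n → E) (u : ℝ)
    (Q : Measure (Measure E)) : Measure (Measure E) :=
  ((Measure.pi (fun x : {x // x ∈ distinctValues y} => jumpLaw H u (multiplicity y x))).prod Q).map
    (fun p =>
      (∑ x : {x // x ∈ distinctValues y}, (p.1 x : ℝ≥0∞) • Measure.dirac (x : E)) + p.2)

end

end NRM

namespace NRM

noncomputable section

open Filter Topology

/-! ### The exponential `x ↦ exp (-x)` on `[0, ∞]` -/

/-- The function `x ↦ exp (-x)` on `[0, ∞]`, with value `0` at `∞`. -/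
def expNeg (x : ℝ≥0∞) : ℝ≥0∞ := if x = ∞ then 0 else ENNReal.ofReal (Real.exp (-x.toReal))

@[fun_prop]
lemma measurable_expNeg : Measurable expNeg :=
  Measurable.ite (measurableSet_singleton _) measurable_const (by fun_prop)

@[simp] lemma expNeg_top : expNeg ∞ = 0 := by simp [expNeg]

@[simp] lemma expNeg_zero : expNeg 0 = 1 := by simp [expNeg]

lemma expNeg_of_ne_top {x : ℝ≥0∞} (h : x ≠ ∞) :
    expNeg x = ENNReal.ofReal (Real.exp (-x.toReal)) := by simp [expNeg, h]

lemma expNeg_ofReal {x : ℝ} (h : 0 ≤ x) :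
    expNeg (ENNReal.ofReal x) = ENNReal.ofReal (Real.exp (-x)) := by
  rw [expNeg_of_ne_top ENNReal.ofReal_ne_top, ENNReal.toReal_ofReal h]

lemma expNeg_coe (x : ℝ≥0) : expNeg x = ENNReal.ofReal (Real.exp (-(x : ℝ))) := by
  rw [expNeg_of_ne_top ENNReal.coe_ne_top, ENNReal.coe_toReal]

lemma expNeg_add (x y : ℝ≥0∞) : expNeg (x + y) = expNeg x * expNeg y := by
  by_cases hx : x = ∞
  · simp [hx]
  by_cases hy : y = ∞
  · simp [hy]
  rw [expNeg_of_ne_top hx, expNeg_of_ne_top hy, expNeg_of_ne_top (by simp [hx, hy]),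
    ENNReal.toReal_add hx hy, neg_add, Real.exp_add, ENNReal.ofReal_mul (Real.exp_nonneg _)]

lemma expNeg_sum {ι : Type*} (s : Finset ι) (x : ι → ℝ≥0∞) :
    expNeg (∑ i ∈ s, x i) = ∏ i ∈ s, expNeg (x i) := by
  classical
  induction s using Finset.induction_on with
  | empty => simp
  | insert a s ha ih => rw [Finset.sum_insert ha, Finset.prod_insert ha, expNeg_add, ih]

lemma expNeg_le_one (x : ℝ≥0∞) : expNeg x ≤ 1 := by
  unfold expNeg
  split_ifs
  · simp
  · simp

lemma expNeg_ne_top (x : ℝ≥0∞) : expNeg x ≠ ∞ :=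
  ((expNeg_le_one x).trans_lt ENNReal.one_lt_top).ne

lemma expNeg_pos {x : ℝ≥0∞} (h : x ≠ ∞) : 0 < expNeg x := by
  rw [expNeg_of_ne_top h]; simp [Real.exp_pos]

lemma toReal_expNeg {x : ℝ≥0∞} (h : x ≠ ∞) : (expNeg x).toReal = Real.exp (-x.toReal) := by
  rw [expNeg_of_ne_top h, ENNReal.toReal_ofReal (Real.exp_nonneg _)]

/-! ### Laplace functionals -/

section Laplace

variable {E : Type*} [MeasurableSpace E]

/-- The Laplace functional `E[exp(-∫ h dμ)]`, with values in `[0, ∞]`. -/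
def lap (Q : Measure (Measure E)) (h : E → ℝ≥0) : ℝ≥0∞ :=
  ∫⁻ μ, expNeg (∫⁻ x, h x ∂μ) ∂Q

lemma measurable_expNeg_lintegral {h : E → ℝ≥0} (hh : Measurable h) :
    Measurable fun μ : Measure E => expNeg (∫⁻ x, h x ∂μ) :=
  measurable_expNeg.comp (Measure.measurable_lintegral hh.coe_nnreal_ennreal)

lemma lap_le (Q : Measure (Measure E)) (h : E → ℝ≥0) : lap Q h ≤ Q Set.univ :=
  (lintegral_mono fun _ => expNeg_le_one _).trans (by simp)

lemma lap_ne_top (Q : Measure (Measure E)) [IsFiniteMeasure Q] (h : E → ℝ≥0) : lap Q h ≠ ∞ :=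
  ((lap_le Q h).trans_lt (measure_lt_top _ _)).ne

open Classical in
/-- The measure `ν` if it is finite, and `0` otherwise. -/
def trunc (ν : Measure E) : Measure E := if ν Set.univ = ∞ then 0 else ν

instance (ν : Measure E) : IsFiniteMeasure (trunc ν) := by
  unfold trunc
  split_ifs with h
  · infer_instance
  · exact ⟨lt_top_iff_ne_top.2 h⟩

lemma trunc_eq (ν : Measure E) [IsFiniteMeasure ν] : trunc ν = ν := by
  simp [trunc, measure_ne_top]

lemma measurableSet_isFiniteMeasure : MeasurableSet {ν : Measure E | IsFiniteMeasure ν} := by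
  have : {ν : Measure E | IsFiniteMeasure ν} = {ν | ν Set.univ < ∞} := by
    ext ν; exact ⟨fun h => h.1, fun h => ⟨h⟩⟩
  rw [this]
  exact measurableSet_lt (Measure.measurable_coe MeasurableSet.univ) measurable_const

lemma measurable_trunc : Measurable (trunc : Measure E → Measure E) := by
  refine Measurable.ite ?_ measurable_const measurable_id
  exact (Measure.measurable_coe MeasurableSet.univ) (measurableSet_singleton _)

lemma exists_seq_generating [MeasurableSpace.CountablyGenerated E] :
    ∃ A : ℕ → Set E, IsPiSystem (Set.range A) ∧
      ‹MeasurableSpace E› = MeasurableSpace.generateFrom (Set.range A) ∧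
      Set.univ ∈ Set.range A := by
  set S := generateSetAlgebra (MeasurableSpace.countableGeneratingSet E)
  have hS : IsSetAlgebra S := isSetAlgebra_generateSetAlgebra
  have hc : S.Countable :=
    countable_generateSetAlgebra (MeasurableSpace.countable_countableGeneratingSet)
  obtain ⟨A, hA⟩ := hc.exists_eq_range ⟨Set.univ, hS.univ_mem⟩
  refine ⟨A, ?_, ?_, hA ▸ hS.univ_mem⟩
  · rw [← hA]; exact fun s hs t ht _ => hS.inter_mem hs ht
  · rw [← hA, generateFrom_generateSetAlgebra_eq,
      MeasurableSpace.generateFrom_countableGeneratingSet]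

/-- A countable `π`-system generating the `σ`-algebra. -/
def genSeq (E : Type*) [MeasurableSpace E] [MeasurableSpace.CountablyGenerated E] : ℕ → Set E :=
  (exists_seq_generating (E := E)).choose

variable [MeasurableSpace.CountablyGenerated E]

lemma measurableSet_genSeq (i : ℕ) : MeasurableSet (genSeq E i) := by
  have h := (exists_seq_generating (E := E)).choose_spec.2.1
  have h' : MeasurableSpace.generateFrom (Set.range (genSeq E)) ≤ ‹MeasurableSpace E› := h.ge
  exact h' _ (MeasurableSpace.measurableSet_generateFrom ⟨i, rfl⟩)

/-- The combination `∑ᵢ tᵢ 1_{Aᵢ}` of the indicators of the sets of the generating sequence. -/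
def testFun (t : ℕ →₀ ℕ) (x : E) : ℝ≥0 :=
  ∑ i ∈ t.support, (t i : ℝ≥0) * (genSeq E i).indicator 1 x

lemma measurable_testFun (t : ℕ →₀ ℕ) : Measurable (testFun (E := E) t) := by
  unfold testFun
  refine Finset.measurable_fun_sum _ fun i _ => ?_
  exact (measurable_one.indicator (measurableSet_genSeq i)).const_mul _

lemma lintegral_testFun (t : ℕ →₀ ℕ) (ν : Measure E) :
    ∫⁻ x, testFun t x ∂ν = ∑ i ∈ t.support, (t i : ℝ≥0∞) * ν (genSeq E i) := by
  have : ∀ x : E, (testFun t x : ℝ≥0∞) =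
      ∑ i ∈ t.support, (t i : ℝ≥0∞) * (genSeq E i).indicator 1 x := by
    intro x
    simp only [testFun, ENNReal.ofNNReal_finsetSum, ENNReal.coe_mul, ENNReal.coe_natCast]
    refine Finset.sum_congr rfl fun i _ => ?_
    by_cases h : x ∈ genSeq E i <;> simp [h]
  simp_rw [this]
  rw [lintegral_finsetSum _ fun i _ =>
    (measurable_one.indicator (measurableSet_genSeq i)).const_mul _]
  refine Finset.sum_congr rfl fun i _ => ?_
  rw [lintegral_const_mul _ (measurable_one.indicator (measurableSet_genSeq i)),
    lintegral_indicator_one (measurableSet_genSeq i)]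

open Classical in
/-- The sequence of the numbers `exp (-ν Aᵢ)`, or the sequence `0` if `ν` is infinite. -/
def encode (ν : Measure E) (i : ℕ) : unitInterval :=
  if ν Set.univ = ∞ then 0 else
    ⟨Real.exp (-(ν (genSeq E i)).toReal), (Real.exp_nonneg _), by simp⟩

lemma measurable_encode : Measurable (encode : Measure E → ℕ → unitInterval) := by
  refine measurable_pi_lambda _ fun i => ?_
  refine Measurable.ite ?_ measurable_const ?_
  · exact (Measure.measurable_coe MeasurableSet.univ) (measurableSet_singleton _)
  · exact ((Measure.measurable_coe (measurableSet_genSeq i)).ennreal_toReal.neg.exp).subtype_mk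

lemma measurable_trunc_comap_encode :
    Measurable[MeasurableSpace.comap encode inferInstance] (trunc : Measure E → Measure E) := by
  obtain ⟨h1, h2, h3⟩ := (exists_seq_generating (E := E)).choose_spec
  have key : ∀ i, Measurable[MeasurableSpace.comap encode inferInstance]
      (fun ν : Measure E => trunc ν (genSeq E i)) := by
    intro i
    have : (fun ν : Measure E => trunc ν (genSeq E i)) =
        (fun e : ℕ → unitInterval => ENNReal.ofReal (-Real.log (e i))) ∘ encode := by
      ext ν
      by_cases h : ν Set.univ = ∞
      · simp [trunc, encode, h]
      · have h' : ν (genSeq E i) ≠ ∞ := fun h' => h (top_le_iff.1 (h' ▸ measure_mono (by simp)))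
        simp [trunc, encode, h, h']
    rw [this]
    refine Measurable.comp ?_ (comap_measurable (encode (E := E)))
    exact ((measurable_subtype_coe.comp (measurable_pi_apply i)).log.neg).ennreal_ofReal
  refine @Measurable.measure_of_isPiSystem (Measure E) E
    (MeasurableSpace.comap encode inferInstance) _ _ _ _ h2 h1 ?_ ?_
  · rintro _ ⟨i, rfl⟩; exact key i
  · obtain ⟨i, hi⟩ := h3
    rw [← hi]; exact key i

lemma exists_trunc_preimage_eq {L : Set (Measure E)} (hL : MeasurableSet L) :
    ∃ L' : Set (ℕ → unitInterval), MeasurableSet L' ∧ encode ⁻¹' L' = trunc ⁻¹' L :=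
  measurable_trunc_comap_encode hL

lemma exists_forall_measure_eq_map_encode {L : Set (Measure E)} (hL : MeasurableSet L) :
    ∃ L' : Set (ℕ → unitInterval), MeasurableSet L' ∧ ∀ Q : Measure (Measure E),
      (∀ᵐ ν ∂Q, IsFiniteMeasure ν) → Q L = Q.map encode L' := by
  obtain ⟨L', hL', h⟩ := exists_trunc_preimage_eq hL
  refine ⟨L', hL', fun Q hQ => ?_⟩
  rw [Measure.map_apply measurable_encode hL', h]
  refine measure_congr ?_
  filter_upwards [hQ] with ν hν
  change (L ν) = L (trunc ν)
  rw [trunc_eq]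

/-- The coordinate functions on `[0, 1]^ℕ`. -/
def coordFun (i : ℕ) : C(ℕ → unitInterval, ℝ) := ⟨fun e => e i, by fun_prop⟩

/-- Stone-Weierstrass on `[0, 1]^ℕ` as an induction principle. -/
lemma induction_monomials (p : C(ℕ → unitInterval, ℝ) → Prop)
    (hmon : ∀ t : ℕ →₀ ℕ, p (t.prod fun i c => coordFun i ^ c))
    (hadd : ∀ φ χ, p φ → p χ → p (φ + χ)) (hsmul : ∀ (c : ℝ) φ, p φ → p (c • φ))
    (hlim : ∀ (φ : ℕ → C(ℕ → unitInterval, ℝ)) (χ), (∀ n, p (φ n)) → Tendsto φ atTop (𝓝 χ) → p χ)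
    (φ : C(ℕ → unitInterval, ℝ)) : p φ := by
  have hA : (Algebra.adjoin ℝ (Set.range coordFun)).SeparatesPoints := by
    intro x y hxy
    obtain ⟨i, hi⟩ := Function.ne_iff.1 hxy
    refine ⟨coordFun i, ⟨coordFun i, Algebra.subset_adjoin ⟨i, rfl⟩, rfl⟩, ?_⟩
    simpa [coordFun, Subtype.ext_iff] using hi
  have hmem : ∀ χ ∈ Algebra.adjoin ℝ (Set.range coordFun), p χ := by
    intro χ hχ
    rw [← Subalgebra.mem_toSubmodule, Algebra.adjoin_eq_span] at hχ
    induction hχ using Submodule.span_induction with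
    | mem x hx =>
      obtain ⟨t, rfl⟩ := Submonoid.exists_finsupp_of_mem_closure_range _ _ hx
      exact hmon t
    | zero => simpa using hsmul 0 _ (hmon 0)
    | add x y _ _ hx hy => exact hadd _ _ hx hy
    | smul a x _ hx => exact hsmul _ _ hx
  have hcl := ContinuousMap.continuousMap_mem_subalgebra_closure_of_separatesPoints _ hA φ
  rw [← SetLike.mem_coe, Subalgebra.topologicalClosure_coe] at hcl
  obtain ⟨x, hx, hlx⟩ := mem_closure_iff_seq_limit.1 hcl
  exact hlim x φ (fun n => hmem _ (hx n)) hlx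

lemma integral_monomial_map_encode (Q : Measure (Measure E)) [IsFiniteMeasure Q]
    (hQ : ∀ᵐ ν ∂Q, IsFiniteMeasure ν) (t : ℕ →₀ ℕ) :
    ∫ e, (t.prod fun i c => coordFun i ^ c) e ∂(Q.map encode) = (lap Q (testFun t)).toReal := by
  rw [integral_map measurable_encode.aemeasurable
    (ContinuousMap.continuous _).aestronglyMeasurable, lap, ← integral_toReal
    (measurable_expNeg_lintegral (measurable_testFun t)).aemeasurable
    (Eventually.of_forall fun _ => (expNeg_ne_top _).lt_top)]
  refine integral_congr_ae ?_
  filter_upwards [hQ] with ν hν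
  rw [lintegral_testFun, expNeg_sum, ENNReal.toReal_prod]
  simp only [Finsupp.prod, ContinuousMap.coe_prod, ContinuousMap.coe_pow, Finset.prod_apply,
    Pi.pow_apply]
  refine Finset.prod_congr rfl fun i _ => ?_
  rw [toReal_expNeg (ENNReal.mul_ne_top (by simp) (measure_ne_top _ _))]
  simp [coordFun, encode, measure_ne_top, ENNReal.toReal_mul, ← Real.exp_nat_mul]

lemma tendsto_integral_of_tendsto_continuousMap {X : Type*} [TopologicalSpace X] [CompactSpace X]
    [MeasurableSpace X] [BorelSpace X] {φ : ℕ → C(X, ℝ)} {χ : C(X, ℝ)}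
    (h : Tendsto φ atTop (𝓝 χ)) (Q : Measure X) [IsFiniteMeasure Q] :
    Tendsto (fun n => ∫ x, φ n x ∂Q) atTop (𝓝 (∫ x, χ x ∂Q)) := by
  have hint : ∀ φ : C(X, ℝ), Integrable φ Q := fun φ =>
    Integrable.of_bound φ.continuous.aestronglyMeasurable ‖φ‖
      (Eventually.of_forall fun x => φ.norm_coe_le_norm x)
  rw [tendsto_iff_norm_sub_tendsto_zero] at h ⊢
  have h2 := h.mul_const (Q.real Set.univ)
  rw [zero_mul] at h2
  refine squeeze_zero (fun _ => norm_nonneg _) (fun n => ?_) h2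
  rw [← integral_sub (hint _) (hint _)]
  exact norm_integral_le_of_norm_le_const (Eventually.of_forall fun x =>
    ContinuousMap.norm_coe_le_norm (φ n - χ) x)

lemma integrable_continuousMap {X : Type*} [TopologicalSpace X] [CompactSpace X]
    [MeasurableSpace X] [BorelSpace X] (φ : C(X, ℝ)) (Q : Measure X) [IsFiniteMeasure Q] :
    Integrable φ Q :=
  Integrable.of_bound φ.continuous.aestronglyMeasurable ‖φ‖
    (Eventually.of_forall fun x => φ.norm_coe_le_norm x)

/-- The law of a random finite measure is determined by its Laplace functional. -/
theorem ext_of_lap_eq {Q₁ Q₂ : Measure (Measure E)} [IsFiniteMeasure Q₁] [IsFiniteMeasure Q₂]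
    (h₁ : ∀ᵐ ν ∂Q₁, IsFiniteMeasure ν) (h₂ : ∀ᵐ ν ∂Q₂, IsFiniteMeasure ν)
    (h : ∀ t : ℕ →₀ ℕ, lap Q₁ (testFun t) = lap Q₂ (testFun t)) : Q₁ = Q₂ := by
  have key : Q₁.map encode = Q₂.map encode := by
    refine ext_of_forall_integral_eq_of_IsFiniteMeasure fun φ => ?_
    refine induction_monomials
      (fun φ => ∫ e, φ e ∂(Q₁.map encode) = ∫ e, φ e ∂(Q₂.map encode)) ?_ ?_ ?_ ?_ φ.toContinuousMap
    · intro t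
      rw [integral_monomial_map_encode _ h₁, integral_monomial_map_encode _ h₂, h]
    · intro φ χ hφ hχ
      simp only [ContinuousMap.add_apply]
      rw [integral_add (integrable_continuousMap _ _) (integrable_continuousMap _ _),
        integral_add (integrable_continuousMap _ _) (integrable_continuousMap _ _), hφ, hχ]
    · intro c φ hφ
      simp only [ContinuousMap.smul_apply, integral_smul, hφ]
    · intro φ χ hφ hlim
      have := tendsto_integral_of_tendsto_continuousMap hlim (Q₁.map encode)
      simp_rw [hφ] at this
      exact tendsto_nhds_unique this (tendsto_integral_of_tendsto_continuousMap hlim _)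
  ext L hL
  obtain ⟨L', -, hL'⟩ := exists_forall_measure_eq_map_encode hL
  rw [hL' _ h₁, hL' _ h₂, key]

/-- A family of laws of random finite measures is measurable if its Laplace functionals are. -/
theorem measurable_of_measurable_lap {α : Type*} [MeasurableSpace α]
    {κ : α → Measure (Measure E)} [∀ a, IsProbabilityMeasure (κ a)]
    (hfin : ∀ a, ∀ᵐ ν ∂(κ a), IsFiniteMeasure ν)
    (h : ∀ t : ℕ →₀ ℕ, Measurable fun a => lap (κ a) (testFun t)) : Measurable κ := by
  have hint : ∀ φ : C(ℕ → unitInterval, ℝ), Measurable fun a => ∫ e, φ e ∂((κ a).map encode) := by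
    intro φ
    refine induction_monomials
      (fun φ => Measurable fun a => ∫ e, φ e ∂((κ a).map encode)) ?_ ?_ ?_ ?_ φ
    · intro t
      simp_rw [integral_monomial_map_encode _ (hfin _)]
      exact (h t).ennreal_toReal
    · intro φ χ hφ hχ
      simp only [ContinuousMap.add_apply]
      simp_rw [integral_add (integrable_continuousMap φ _) (integrable_continuousMap χ _)]
      exact hφ.add hχ
    · intro c φ hφ
      simp only [ContinuousMap.smul_apply, integral_smul]
      exact hφ.const_smul c
    · intro φ χ hφ hlim
      refine measurable_of_tendsto_metrizable hφ ?_
      rw [tendsto_pi_nhds]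
      exact fun a => tendsto_integral_of_tendsto_continuousMap hlim _
  have : ∀ a, IsProbabilityMeasure ((κ a).map encode) := fun a =>
    Measure.isProbabilityMeasure_map measurable_encode.aemeasurable
  have hmap : Measurable fun a => (κ a).map encode := by
    refine Measurable.measure_of_isPiSystem_of_isProbabilityMeasure
      (S := {s | IsClosed s}) ?_ isPiSystem_isClosed ?_
    · rw [← borel_eq_generateFrom_isClosed]
      exact BorelSpace.measurable_eq
    · intro F hF
      refine measurable_of_tendsto_metrizable (f := fun n a =>
        ∫⁻ e, (hF.apprSeq n e : ℝ≥0∞) ∂((κ a).map encode)) (fun n => ?_) ?_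
      · have : ∀ a, ∫⁻ e, (hF.apprSeq n e : ℝ≥0∞) ∂((κ a).map encode) =
            ENNReal.ofReal (∫ e, ((hF.apprSeq n e : ℝ≥0) : ℝ) ∂((κ a).map encode)) := by
          intro a
          rw [ofReal_integral_eq_lintegral_ofReal]
          · simp
          · exact integrable_continuousMap ⟨fun e => ((hF.apprSeq n e : ℝ≥0) : ℝ), by fun_prop⟩ _
          · exact Eventually.of_forall fun _ => NNReal.coe_nonneg _
        simp_rw [this]
        exact (hint ⟨fun e => ((hF.apprSeq n e : ℝ≥0) : ℝ), by fun_prop⟩).ennreal_ofReal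
      · rw [tendsto_pi_nhds]
        exact fun a => HasOuterApproxClosed.tendsto_lintegral_apprSeq hF _
  refine Measure.measurable_of_measurable_coe _ fun L hL => ?_
  obtain ⟨L', hLm, hL'⟩ := exists_forall_measure_eq_map_encode hL
  simp_rw [hL' _ (hfin _)]
  exact (Measure.measurable_coe hLm).comp hmap

end Laplace

/-! ### Measurability of configurations and kernels of finite measures -/

section Kernels

lemma isSFiniteKernel_of_isFiniteMeasure {α β : Type*} [MeasurableSpace α] [MeasurableSpace β]
    (κ : Kernel α β) (h : ∀ a, IsFiniteMeasure (κ a)) : IsSFiniteKernel κ := by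
  classical
  have hm : Measurable fun a => ⌊(κ a Set.univ).toNNReal⌋₊ :=
    Nat.measurable_floor.comp (κ.measurable_coe MeasurableSet.univ).ennreal_toNNReal
  have hs : ∀ n : ℕ, MeasurableSet {a | ⌊(κ a Set.univ).toNNReal⌋₊ = n} :=
    fun n => hm (measurableSet_singleton n)
  refine ⟨fun n => Kernel.piecewise (hs n) κ 0, fun n => ⟨⟨(n : ℝ≥0∞) + 1, by simp, ?_⟩⟩, ?_⟩
  · intro a
    rw [Kernel.piecewise_apply']
    split_ifs with h'
    · rw [← ENNReal.coe_toNNReal (measure_ne_top (κ a) Set.univ)]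
      have := (Nat.lt_floor_add_one (κ a Set.univ).toNNReal).le
      rw [show ⌊(κ a Set.univ).toNNReal⌋₊ = n from h'] at this
      exact_mod_cast this
    · simp
  · ext a s hs
    rw [Kernel.sum_apply' _ _ hs, tsum_eq_single ⌊(κ a Set.univ).toNNReal⌋₊]
    · simp [Kernel.piecewise_apply]
    · intro n hn
      simp [Kernel.piecewise_apply, hn.symm]

variable {E : Type*} [MeasurableSpace E]

instance : MeasurableAdd₂ (Measure E) := by infer_instance

/-- The kernel `ν ↦ trunc ν`. -/
def truncKernel : Kernel (Measure E) E := ⟨trunc, measurable_trunc⟩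

@[simp] lemma truncKernel_apply (ν : Measure E) : truncKernel ν = trunc ν := rfl

instance : IsSFiniteKernel (truncKernel (E := E)) :=
  isSFiniteKernel_of_isFiniteMeasure _ fun ν => by rw [truncKernel_apply]; infer_instance

lemma measurable_lintegral_trunc {α : Type*} [MeasurableSpace α] {F : α → E → Measure E → ℝ≥0∞}
    (hF : Measurable fun p : α × E × Measure E => F p.1 p.2.1 p.2.2) :
    Measurable fun p : α × Measure E => ∫⁻ x, F p.1 x p.2 ∂(trunc p.2) := by
  have : Measurable (Function.uncurry fun (p : α × Measure E) (x : E) => F p.1 x p.2) :=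
    hF.comp (by fun_prop : Measurable fun q : (α × Measure E) × E => (q.1.1, q.2, q.1.2))
  exact this.lintegral_kernel_prod_right (κ := Kernel.comap truncKernel Prod.snd measurable_snd)

lemma measurable_pi_trunc (n : ℕ) :
    Measurable fun ν : Measure E => Measure.pi fun _ : Fin n => trunc ν := by
  refine Measurable.measure_of_isPiSystem generateFrom_pi.symm isPiSystem_pi ?_ ?_
  · rintro _ ⟨s, hs, rfl⟩
    simp_rw [Measure.pi_pi]
    exact Finset.measurable_fun_prod _ fun i _ =>
      (Measure.measurable_coe (hs i (Set.mem_univ i))).comp measurable_trunc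
  · simp_rw [Measure.pi_univ]
    exact Finset.measurable_fun_prod _ fun i _ =>
      (Measure.measurable_coe MeasurableSet.univ).comp measurable_trunc

/-- The kernel `ν ↦ νⁿ`. -/
def powKernel (n : ℕ) : Kernel (Measure E) (Fin n → E) :=
  ⟨fun ν => Measure.pi fun _ : Fin n => trunc ν, measurable_pi_trunc n⟩

lemma powKernel_apply (n : ℕ) (ν : Measure E) :
    powKernel n ν = Measure.pi fun _ : Fin n => trunc ν := rfl

instance (n : ℕ) (ν : Measure E) : IsFiniteMeasure (powKernel n ν) := by
  rw [powKernel_apply]; infer_instance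

instance (n : ℕ) : IsSFiniteKernel (powKernel (E := E) n) :=
  isSFiniteKernel_of_isFiniteMeasure _ fun _ => inferInstance

lemma measurable_dirac_comp {α : Type*} [MeasurableSpace α] {g : α → E} (hg : Measurable g) :
    Measurable fun a => Measure.dirac (g a) :=
  Measure.measurable_dirac.comp hg

lemma measurable_finsetSum_measure {α ι : Type*} [MeasurableSpace α] (s : Finset ι)
    {g : ι → α → Measure E} (hg : ∀ i ∈ s, Measurable (g i)) :
    Measurable fun a => ∑ i ∈ s, g i a := by
  refine Measure.measurable_of_measurable_coe _ fun A hA => ?_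
  simp_rw [Measure.finsetSum_apply]
  exact Finset.measurable_fun_sum _ fun i hi => (Measure.measurable_coe hA).comp (hg i hi)

lemma measurable_pointSum (k : ℕ) : Measurable (pointSum : (Fin k → E) → Measure E) :=
  measurable_finsetSum_measure _ fun i _ => measurable_dirac_comp (measurable_pi_apply i)

lemma measurable_config : Measurable fun q : ℕ × (ℕ → E) => config q.1 q.2 :=
  measurable_from_prod_countable_right fun m =>
    measurable_finsetSum_measure (Finset.range m) (g := fun i (x : ℕ → E) => Measure.dirac (x i))
      fun i _ => measurable_dirac_comp (measurable_pi_apply i)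

instance (k : ℕ) (x : Fin k → E) : IsFiniteMeasure (pointSum x) := by
  unfold pointSum; infer_instance

instance (m : ℕ) (x : ℕ → E) : IsFiniteMeasure (config m x) := by
  unfold config; infer_instance

lemma lintegral_pointSum {k : ℕ} (x : Fin k → E) {h : E → ℝ≥0∞} (hh : Measurable h) :
    ∫⁻ z, h z ∂(pointSum x) = ∑ i, h (x i) := by
  rw [pointSum, lintegral_finsetSum_measure]
  exact Finset.sum_congr rfl fun i _ => lintegral_dirac' _ hh

lemma lintegral_config {m : ℕ} (x : ℕ → E) {h : E → ℝ≥0∞} (hh : Measurable h) :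
    ∫⁻ z, h z ∂(config m x) = ∑ i ∈ Finset.range m, h (x i) := by
  rw [config, lintegral_finsetSum_measure]
  exact Finset.sum_congr rfl fun i _ => lintegral_dirac' _ hh

lemma config_eq_pointSum (m : ℕ) (x : ℕ → E) : config m x = pointSum fun i : Fin m => x i := by
  rw [config, pointSum, Finset.sum_range]

lemma lintegral_pi_fin_prod {m : ℕ} (ω : Measure E) [SigmaFinite ω] (h : Fin m → E → ℝ≥0∞)
    (hh : ∀ i, Measurable (h i)) :
    ∫⁻ x, ∏ i, h i (x i) ∂(Measure.pi fun _ : Fin m => ω) = ∏ i, ∫⁻ z, h i z ∂ω := by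
  induction m with
  | zero => simp
  | succ m ih =>
    rw [← (measurePreserving_piFinSuccAbove (fun _ : Fin (m + 1) => ω) 0).symm
      |>.lintegral_comp_emb (MeasurableEquiv.measurableEmbedding _)]
    simp only [Fin.prod_univ_succ]
    rw [lintegral_prod _ (Measurable.aemeasurable (by
      refine Measurable.mul ?_ (Finset.measurable_fun_prod _ fun i _ => ?_)
      · exact (hh 0).comp ((measurable_pi_apply 0).comp (MeasurableEquiv.measurable _))
      · exact (hh _).comp ((measurable_pi_apply _).comp (MeasurableEquiv.measurable _))))]
    have : ∀ (z : E) (y : Fin m → E),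
        (h 0 ((MeasurableEquiv.piFinSuccAbove (fun _ => E) 0).symm (z, y) 0) *
        ∏ i : Fin m, h i.succ ((MeasurableEquiv.piFinSuccAbove (fun _ => E) 0).symm (z, y) i.succ))
          = h 0 z * ∏ i : Fin m, h i.succ (y i) := by
      intro z y; simp [MeasurableEquiv.piFinSuccAbove]
    simp only [this]
    have h2 : ∀ z, ∫⁻ y : Fin m → E, h 0 z * ∏ i : Fin m, h i.succ (y i)
        ∂(Measure.pi fun _ : Fin m => ω) = h 0 z * ∏ i : Fin m, ∫⁻ z, h i.succ z ∂ω := by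
      intro z
      have hm : Measurable fun y : Fin m → E => ∏ i : Fin m, h i.succ (y i) :=
        Finset.measurable_fun_prod _ fun i _ => (hh _).comp (measurable_pi_apply i)
      rw [lintegral_const_mul _ hm, ih _ fun i => hh _]
    simp only [h2]
    rw [lintegral_mul_const _ (hh 0)]

end Kernels

/-! ### The Poisson process -/

section Poisson

lemma lintegral_expNeg_poissonMeasure (r c : ℝ≥0) :
    ∫⁻ n : ℕ, expNeg (c * n) ∂(poissonMeasure r) = expNeg (r * (1 - expNeg c)) := by
  have h1 : HasSum (fun n : ℕ => Real.exp (-r) * r ^ n / n.factorial * Real.exp (-(c * n)))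
      (Real.exp (-(r * (1 - Real.exp (-c))))) := by
    have := (NormedSpace.expSeries_div_hasSum_exp ((r : ℝ) * Real.exp (-c))).mul_left
      (Real.exp (-r))
    rw [← Real.exp_eq_exp_ℝ, ← Real.exp_add] at this
    have hs : ∀ n : ℕ, Real.exp (-r) * r ^ n / n.factorial * Real.exp (-(c * n)) =
        Real.exp (-r) * ((r * Real.exp (-c)) ^ n / n.factorial) := by
      intro n
      rw [mul_pow, ← Real.exp_nat_mul, show (n : ℝ) * -c = -(c * n) by ring]
      ring
    simp_rw [hs]
    rwa [show (-(r * (1 - Real.exp (-c))) : ℝ) = -r + r * Real.exp (-c) by ring]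
  have h2 : ∀ n : ℕ, expNeg (c * n) = ENNReal.ofReal (Real.exp (-(c * n))) := by
    intro n
    rw [show (c : ℝ≥0∞) * n = ((c * n : ℝ≥0) : ℝ≥0∞) by push_cast; rfl, expNeg_coe]
    simp
  rw [poissonMeasure, lintegral_sum_measure]
  simp only [lintegral_smul_measure, lintegral_dirac, h2, smul_eq_mul]
  simp_rw [← ENNReal.ofReal_mul (show (0 : ℝ) ≤ Real.exp (-r) * r ^ _ / (Nat.factorial _) by
    positivity)]
  rw [← ENNReal.ofReal_tsum_of_nonneg (fun n => by positivity) h1.summable, h1.tsum_eq]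
  rw [expNeg_coe, ← ENNReal.ofReal_one, ← ENNReal.ofReal_sub _ (Real.exp_nonneg _),
    ← ENNReal.ofReal_coe_nnreal (p := r), ← ENNReal.ofReal_mul r.coe_nonneg, expNeg_ofReal]
  refine mul_nonneg r.coe_nonneg ?_
  simp

variable {E : Type*} [TopologicalSpace E] [MeasurableSpace E] {ω : Measure E}
  {PN : Measure (Measure E)}

lemma IsPoissonProcess.lintegral_expNeg (hN : IsPoissonProcess ω PN) {A : Set E}
    (hA : MeasurableSet A) (hω : ω A ≠ ∞) (c : ℝ≥0) :
    ∫⁻ ν, expNeg (c * ν A) ∂PN = expNeg (ω A * (1 - expNeg c)) := by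
  have hm : Measurable fun x : ℝ≥0∞ => expNeg (c * x) :=
    measurable_expNeg.comp (measurable_const_mul _)
  have := congrArg (fun μ => ∫⁻ x, expNeg (c * x) ∂μ) (hN.counts_law A hA hω)
  beta_reduce at this
  rw [lintegral_map hm (Measure.measurable_coe hA), lintegral_map hm (by fun_prop),
    lintegral_expNeg_poissonMeasure, ENNReal.coe_toNNReal hω] at this
  exact this

lemma IsPoissonProcess.ae_top_of_infinite [SigmaFinite ω] (hN : IsPoissonProcess ω PN)
    (hω : ω Set.univ = ∞) : ∀ᵐ ν ∂PN, ν Set.univ = ∞ := by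
  have hle : ∀ k, ∫⁻ ν, expNeg (ν Set.univ) ∂PN ≤
      expNeg (ω (spanningSets ω k) * (1 - expNeg 1)) := by
    intro k
    have := hN.lintegral_expNeg (measurableSet_spanningSets ω k)
      (measure_spanningSets_lt_top ω k).ne 1
    simp only [ENNReal.coe_one, one_mul] at this
    rw [← this]
    refine lintegral_mono fun ν => ?_
    by_cases h : ν Set.univ = ∞
    · simp [h]
    have hs : ν (spanningSets ω k) ≤ ν Set.univ := measure_mono (Set.subset_univ _)
    rw [expNeg_of_ne_top h, expNeg_of_ne_top (ne_top_of_le_ne_top h hs)]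
    exact ENNReal.ofReal_le_ofReal (Real.exp_le_exp.2 (neg_le_neg (ENNReal.toReal_mono h hs)))
  have hlim : Tendsto (fun k => ω (spanningSets ω k)) atTop (𝓝 ∞) := by
    have := tendsto_measure_iUnion_atTop (μ := ω) (monotone_spanningSets ω)
    rwa [iUnion_spanningSets, hω] at this
  have hc : (1 - expNeg 1 : ℝ≥0∞) ≠ 0 := by
    have : expNeg 1 < 1 := by
      have := expNeg_coe 1
      simp only [ENNReal.coe_one, NNReal.coe_one] at this
      rw [this, ENNReal.ofReal_lt_one]
      simp
    exact (tsub_pos_of_lt this).ne'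
  have hlim2 : Tendsto (fun k => expNeg (ω (spanningSets ω k) * (1 - expNeg 1))) atTop (𝓝 0) := by
    have h1 : Tendsto (fun k => (ω (spanningSets ω k) * (1 - expNeg 1)).toReal) atTop atTop := by
      rw [← ENNReal.tendsto_ofReal_nhds_top]
      have h2 := ENNReal.Tendsto.mul_const (b := 1 - expNeg 1) hlim (Or.inl ENNReal.top_ne_zero)
      rw [ENNReal.top_mul hc] at h2
      refine h2.congr fun k => ?_
      rw [ENNReal.ofReal_toReal]
      exact ENNReal.mul_ne_top (measure_spanningSets_lt_top ω k).ne (by simp)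
    have h3 := ENNReal.tendsto_ofReal (Real.tendsto_exp_neg_atTop_nhds_zero.comp h1)
    rw [ENNReal.ofReal_zero] at h3
    refine h3.congr fun k => ?_
    exact (expNeg_of_ne_top
      (ENNReal.mul_ne_top (measure_spanningSets_lt_top ω k).ne (by simp))).symm
  have h0 : ∫⁻ ν, expNeg (ν Set.univ) ∂PN = 0 := le_antisymm (ge_of_tendsto' hlim2 hle) zero_le
  rw [lintegral_eq_zero_iff (f := fun ν : Measure E => expNeg (ν Set.univ))
    (measurable_expNeg.comp (Measure.measurable_coe MeasurableSet.univ))] at h0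
  filter_upwards [h0] with ν hν
  by_contra h
  exact (expNeg_pos h).ne' hν

/-- A finite Gibbs point process has a reference Poisson process with finite mean measure. -/
lemma IsPoissonProcess.isFiniteMeasure_of_isGibbs [SigmaFinite ω] (hN : IsPoissonProcess ω PN)
    {f : Measure E → ℝ≥0} {P : Measure (Measure E)} (hP : IsGibbs PN f P)
    (hfin : ∀ᵐ ν ∂P, IsFiniteMeasure ν) : IsFiniteMeasure ω := by
  refine ⟨lt_top_iff_ne_top.2 fun hω => ?_⟩
  have hac : P ≪ PN := hP.eq_withDensity ▸ withDensity_absolutelyContinuous _ _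
  have := hP.isPointProcess.isProbabilityMeasure
  obtain ⟨ν, h1, h2⟩ := (hfin.and (hac.ae_le (hN.ae_top_of_infinite hω))).exists
  exact measure_ne_top ν _ h2

lemma IsSimplePointMeasure.measure_singleton_le_one [MeasurableSingletonClass E] {ν : Measure E}
    (h : IsSimplePointMeasure ν) (x : E) : ν {x} ≤ 1 := by
  classical
  obtain ⟨-, s, -, rfl⟩ := h
  rw [Measure.sum_apply _ (measurableSet_singleton x)]
  by_cases hx : x ∈ s
  · rw [tsum_eq_single ⟨x, hx⟩]
    · simp
    · intro y hy
      simp only [measurableSet_singleton, Measure.dirac_apply', Set.indicator_apply_eq_zero]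
      intro h
      exact absurd (Subtype.ext (Set.mem_singleton_iff.1 h)) hy
  · rw [ENNReal.tsum_eq_zero.2]
    · simp
    · intro y
      simp only [measurableSet_singleton, Measure.dirac_apply', Set.indicator_apply_eq_zero]
      intro h
      exact absurd (Set.mem_singleton_iff.1 h ▸ y.2) hx

lemma IsPoissonProcess.nullSingletonClass [MeasurableSingletonClass E] [IsFiniteMeasure ω]
    (hN : IsPoissonProcess ω PN) : NullSingletonClass ω := by
  refine ⟨fun x => ?_⟩
  by_contra hx
  have h1 := congrArg (fun μ => μ {2}) (hN.counts_law {x} (measurableSet_singleton x)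
    (measure_ne_top _ _))
  beta_reduce at h1
  rw [Measure.map_apply (Measure.measurable_coe (measurableSet_singleton x))
    (measurableSet_singleton _), Measure.map_apply (by fun_prop) (measurableSet_singleton _)] at h1
  have h2 : PN ((fun ν : Measure E => ν {x}) ⁻¹' {2}) = 0 := by
    refine measure_mono_null (fun ν hν => ?_) hN.isPointProcess.ae_isSimple
    intro h
    have := h.measure_singleton_le_one x
    rw [show ν {x} = 2 from hν] at this
    norm_num at this
  have h3 : (fun n : ℕ => (n : ℝ≥0∞)) ⁻¹' {2} = {2} := by
    ext n
    simp only [Set.mem_preimage, Set.mem_singleton_iff]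
    exact ⟨fun h => by exact_mod_cast h, fun h => by simp [h]⟩
  rw [h2, h3, poissonMeasure_singleton] at h1
  have h4 : 0 < (ω {x}).toNNReal := ENNReal.toNNReal_pos hx (measure_ne_top _ _)
  have : 0 < Real.exp (-((ω {x}).toNNReal : ℝ)) * ((ω {x}).toNNReal : ℝ) ^ 2 /
    (Nat.factorial 2) := by positivity
  exact absurd h1.symm (ENNReal.ofReal_pos.2 this).ne'

lemma IsPoissonProcess.lap_simpleFunc [IsFiniteMeasure ω] (hN : IsPoissonProcess ω PN)
    (h : SimpleFunc E ℝ≥0) : lap PN h = expNeg (∫⁻ x, (1 - expNeg (h x)) ∂ω) := by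
  have key : ∀ (μ : Measure E) (g : ℝ≥0 → ℝ≥0∞), ∫⁻ x, g (h x) ∂μ =
      ∑ i : Fin h.range.card, g (h.range.equivFin.symm i) *
        μ (h ⁻¹' {(h.range.equivFin.symm i : ℝ≥0)}) := by
    intro μ g
    have := SimpleFunc.lintegral_eq_lintegral (h.map g) μ
    simp only [SimpleFunc.coe_map, Function.comp_apply] at this
    rw [this, SimpleFunc.map_lintegral, ← Finset.sum_coe_sort]
    exact (Equiv.sum_comp h.range.equivFin.symm fun c : h.range =>
      g c * μ (h ⁻¹' {(c : ℝ≥0)})).symm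
  unfold lap
  simp_rw [key _ (fun c => (c : ℝ≥0∞)), expNeg_sum, key ω (fun c => 1 - expNeg c)]
  have hind := (hN.counts_indep h.range.card
    (fun i => h ⁻¹' {(h.range.equivFin.symm i : ℝ≥0)}) (fun i => h.measurableSet_preimage _)
    (fun i => measure_ne_top _ _) (by
      intro i j hij
      refine Set.disjoint_left.2 fun x hx hx' => hij ?_
      simp only [Set.mem_preimage, Set.mem_singleton_iff] at hx hx'
      exact h.range.equivFin.symm.injective (Subtype.ext (hx ▸ hx')))).comp
    (fun i x => expNeg ((h.range.equivFin.symm i : ℝ≥0) * x))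
    (fun i => measurable_expNeg.comp (measurable_const_mul _))
  have := lintegral_prod_eq_prod_lintegral_of_indepFun Finset.univ _ hind
    (fun i => (measurable_expNeg.comp (measurable_const_mul _)).comp
      (Measure.measurable_coe (h.measurableSet_preimage _)))
  simp only [Function.comp_apply] at this
  rw [this, expNeg_sum]
  refine Finset.prod_congr rfl fun i _ => ?_
  rw [hN.lintegral_expNeg (h.measurableSet_preimage _) (measure_ne_top _ _), mul_comm]

end Poisson

/-! ### The Poisson process as a mixture of tuples of independent points -/

section Janossy

variable {E : Type*} [MeasurableSpace E]

/-- The weight `exp (-λ) / m!`. -/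
def poissonWeight (ω : Measure E) (m : ℕ) : ℝ≥0∞ :=
  expNeg (ω Set.univ) * (m.factorial : ℝ≥0∞)⁻¹

lemma poissonWeight_succ (ω : Measure E) (m : ℕ) :
    poissonWeight ω (m + 1) * ((m + 1 : ℕ) : ℝ≥0∞) = poissonWeight ω m := by
  unfold poissonWeight
  rw [Nat.factorial_succ, Nat.cast_mul, ENNReal.mul_inv (by simp) (by simp), mul_assoc]
  congr 1
  rw [mul_right_comm, ENNReal.inv_mul_cancel (by simp) (by simp), one_mul]

/-- The law of the finite point process whose unordered points have Janossy densities
`exp (-λ) ωᵐ / m!`. -/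
def janossy (ω : Measure E) : Measure (Measure E) :=
  Measure.sum fun m : ℕ => poissonWeight ω m •
    (Measure.pi fun _ : Fin m => ω).map (pointSum : (Fin m → E) → Measure E)

lemma lintegral_janossy (ω : Measure E) {F : Measure E → ℝ≥0∞} (hF : Measurable F) :
    ∫⁻ ν, F ν ∂(janossy ω) = ∑' m, poissonWeight ω m *
      ∫⁻ x, F (pointSum x) ∂(Measure.pi fun _ : Fin m => ω) := by
  rw [janossy, lintegral_sum_measure]
  refine tsum_congr fun m => ?_
  rw [lintegral_smul_measure, lintegral_map hF (measurable_pointSum m), smul_eq_mul]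

lemma tsum_poissonWeight_mul_pow (ω : Measure E) [IsFiniteMeasure ω] {a : ℝ≥0∞}
    (ha : a ≤ ω Set.univ) : ∑' m, poissonWeight ω m * a ^ m = expNeg (ω Set.univ - a) := by
  have ha' : a ≠ ∞ := ne_top_of_le_ne_top (measure_ne_top _ _) ha
  set b := (ω Set.univ).toReal
  have hb : ω Set.univ = ENNReal.ofReal b := (ENNReal.ofReal_toReal (measure_ne_top _ _)).symm
  have haa : a = ENNReal.ofReal a.toReal := (ENNReal.ofReal_toReal ha').symm
  have hab : a.toReal ≤ b := ENNReal.toReal_mono (measure_ne_top _ _) ha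
  have h1 : HasSum (fun n : ℕ => Real.exp (-b) * (a.toReal ^ n / n.factorial))
      (Real.exp (-(b - a.toReal))) := by
    have := (NormedSpace.expSeries_div_hasSum_exp a.toReal).mul_left (Real.exp (-b))
    rw [← Real.exp_eq_exp_ℝ, ← Real.exp_add] at this
    rwa [show -(b - a.toReal) = -b + a.toReal by ring]
  have h2 : ∀ m, poissonWeight ω m * a ^ m =
      ENNReal.ofReal (Real.exp (-b) * (a.toReal ^ m / m.factorial)) := by
    intro m
    rw [poissonWeight, hb, expNeg_ofReal ENNReal.toReal_nonneg, mul_assoc,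
      ENNReal.ofReal_mul (Real.exp_nonneg _), div_eq_inv_mul,
      ENNReal.ofReal_mul (by positivity), ENNReal.ofReal_inv_of_pos (by positivity),
      ENNReal.ofReal_natCast, ENNReal.ofReal_pow ENNReal.toReal_nonneg, ← haa]
  simp_rw [h2]
  rw [← ENNReal.ofReal_tsum_of_nonneg (fun n => by positivity) h1.summable, h1.tsum_eq, hb]
  nth_rw 2 [haa]
  rw [← ENNReal.ofReal_sub _ ENNReal.toReal_nonneg, expNeg_ofReal (by linarith)]

lemma lap_janossy (ω : Measure E) [IsFiniteMeasure ω] {h : E → ℝ≥0} (hh : Measurable h) :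
    lap (janossy ω) h = expNeg (∫⁻ x, (1 - expNeg (h x)) ∂ω) := by
  have hm : Measurable fun x => expNeg (h x) := measurable_expNeg.comp hh.coe_nnreal_ennreal
  have hle : ∫⁻ x, expNeg (h x) ∂ω ≤ ω Set.univ :=
    (lintegral_mono fun _ => expNeg_le_one _).trans (by simp)
  rw [lap, lintegral_janossy _ (measurable_expNeg_lintegral hh)]
  simp_rw [lintegral_pointSum _ hh.coe_nnreal_ennreal, expNeg_sum]
  simp_rw [lintegral_pi_fin_prod ω (fun _ x => expNeg (h x)) fun _ => hm]
  simp only [Finset.prod_const, Finset.card_univ, Fintype.card_fin]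
  rw [tsum_poissonWeight_mul_pow ω hle, lintegral_sub hm
    (ne_top_of_le_ne_top (measure_ne_top _ _) hle) (Eventually.of_forall fun _ => expNeg_le_one _)]
  simp

instance (ω : Measure E) [IsFiniteMeasure ω] : IsProbabilityMeasure (janossy ω) := by
  have := lap_janossy ω (h := 0) measurable_const
  simp only [lap, Pi.zero_apply, ENNReal.coe_zero, lintegral_zero, expNeg_zero, lintegral_one,
    tsub_self] at this
  exact ⟨this⟩

lemma ae_janossy_of_forall_pointSum (ω : Measure E) {p : Measure E → Prop}
    (hp : MeasurableSet {ν | p ν}) (h : ∀ (m : ℕ) (x : Fin m → E), p (pointSum x)) :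
    ∀ᵐ ν ∂(janossy ω), p ν := by
  rw [janossy, Measure.ae_sum_iff]
  intro m
  refine Measure.ae_smul_measure ?_ _
  rw [ae_map_iff (measurable_pointSum m).aemeasurable hp]
  exact Eventually.of_forall fun x => h m x

lemma ae_janossy_isFiniteMeasure (ω : Measure E) : ∀ᵐ ν ∂(janossy ω), IsFiniteMeasure ν :=
  ae_janossy_of_forall_pointSum ω measurableSet_isFiniteMeasure fun _ _ => inferInstance

lemma exists_simpleFunc_eq_testFun [MeasurableSpace.CountablyGenerated E] (t : ℕ →₀ ℕ) :
    ∃ h : SimpleFunc E ℝ≥0, ⇑h = testFun t := by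
  classical
  refine ⟨⟨testFun t, fun c => measurable_testFun t (measurableSet_singleton c), ?_⟩, rfl⟩
  refine (t.support.powerset.finite_toSet.image fun S => ∑ i ∈ S, (t i : ℝ≥0)).subset ?_
  rintro _ ⟨x, rfl⟩
  refine ⟨t.support.filter fun i => x ∈ genSeq E i,
    Finset.mem_coe.2 (Finset.mem_powerset.2 (Finset.filter_subset _ _)), ?_⟩
  simp [testFun, Finset.sum_filter, Set.indicator_apply]

lemma IsPoissonProcess.ae_isFiniteMeasure [TopologicalSpace E] {ω : Measure E} [IsFiniteMeasure ω]
    {PN : Measure (Measure E)} (hN : IsPoissonProcess ω PN) : ∀ᵐ ν ∂PN, IsFiniteMeasure ν := by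
  have h : PN.map (fun ν => ν Set.univ) {∞} = 0 := by
    rw [hN.counts_law _ MeasurableSet.univ (measure_ne_top _ _),
      Measure.map_apply (by fun_prop) (measurableSet_singleton _)]
    simp [Set.preimage]
  rw [Measure.map_apply (Measure.measurable_coe MeasurableSet.univ) (measurableSet_singleton _)] at h
  refine measure_mono_null (fun ν hν => ?_) h
  by_contra h'
  exact hν ⟨lt_top_iff_ne_top.2 h'⟩

/-- Uniqueness in law of the Poisson process with a finite mean measure. -/
theorem IsPoissonProcess.eq_janossy [TopologicalSpace E] [MeasurableSpace.CountablyGenerated E]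
    {ω : Measure E} [IsFiniteMeasure ω] {PN : Measure (Measure E)} (hN : IsPoissonProcess ω PN) :
    PN = janossy ω := by
  have := hN.isPointProcess.isProbabilityMeasure
  refine ext_of_lap_eq hN.ae_isFiniteMeasure (ae_janossy_isFiniteMeasure ω) fun t => ?_
  obtain ⟨h, hh⟩ := exists_simpleFunc_eq_testFun (E := E) t
  rw [← hh, hN.lap_simpleFunc h, lap_janossy ω h.measurable]

/-- The law of the number and of an enumeration of the points of `janossy ω`. -/
lemma exists_map_config_eq_janossy [Nonempty E] (ω : Measure E) :
    ∃ ρ : Measure (ℕ × (ℕ → E)), ρ.map (fun q => config q.1 q.2) = janossy ω := by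
  obtain ⟨x₀⟩ := ‹Nonempty E›
  set e : ∀ m, (Fin m → E) → ℕ × (ℕ → E) := fun m x =>
    (m, fun j => if h : j < m then x ⟨j, h⟩ else x₀)
  have he : ∀ m, Measurable (e m) := by
    intro m
    refine measurable_const.prodMk (measurable_pi_lambda _ fun j => ?_)
    by_cases h : j < m
    · simpa [h] using measurable_pi_apply _
    · simp [h]
  refine ⟨Measure.sum fun m : ℕ => poissonWeight ω m • (Measure.pi fun _ : Fin m => ω).map (e m),
    ?_⟩
  rw [Measure.map_sum measurable_config.aemeasurable, janossy]
  congr 1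
  ext1 m
  rw [Measure.map_smul, Measure.map_map measurable_config (he m)]
  congr 2
  ext1 x
  simp [e, config_eq_pointSum]

lemma exists_isMarking_enumeration [Nonempty E] (ω : Measure E) {g : Measure E → ℝ≥0∞}
    (hg : Measurable g) [IsProbabilityMeasure ((janossy ω).withDensity g)] :
    ∃ ρ : Measure (ℕ × (ℕ → E)), IsProbabilityMeasure ρ ∧
      ρ.map (fun q => config q.1 q.2) = (janossy ω).withDensity g := by
  obtain ⟨ρ, hρ⟩ := exists_map_config_eq_janossy ω
  have h : (ρ.withDensity fun q => g (config q.1 q.2)).map (fun q => config q.1 q.2) =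
      (janossy ω).withDensity g := by
    ext L hL
    rw [Measure.map_apply measurable_config hL, withDensity_apply _ (measurable_config hL),
      withDensity_apply _ hL, ← hρ, setLIntegral_map hL hg measurable_config]
  refine ⟨_, ⟨?_⟩, h⟩
  have := congrArg (fun μ => μ Set.univ) h
  simpa [Measure.map_apply measurable_config MeasurableSet.univ] using this

/-- The Mecke formula. -/
theorem lintegral_janossy_mecke (ω : Measure E) [SigmaFinite ω] {F : E → Measure E → ℝ≥0∞}
    (hF : Measurable fun p : E × Measure E => F p.1 p.2) :
    ∫⁻ ν, ∫⁻ x, F x ν ∂(trunc ν) ∂(janossy ω) =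
      ∫⁻ x, ∫⁻ ν, F x (ν + Measure.dirac x) ∂(janossy ω) ∂ω := by
  have hm : Measurable fun ν : Measure E => ∫⁻ x, F x ν ∂(trunc ν) :=
    (measurable_lintegral_trunc (α := Unit) (F := fun _ x ν => F x ν) (hF.comp (by fun_prop))).comp
      (by fun_prop : Measurable fun ν : Measure E => ((), ν))
  have hadd : Measurable fun p : E × Measure E => F p.1 (p.2 + Measure.dirac p.1) :=
    hF.comp (measurable_fst.prodMk (measurable_snd.add (measurable_dirac_comp measurable_fst)))
  have hadd' : ∀ m, Measurable fun p : E × (Fin m → E) =>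
      F p.1 (pointSum p.2 + Measure.dirac p.1) := fun m =>
    hadd.comp (measurable_fst.prodMk ((measurable_pointSum m).comp measurable_snd))
  rw [lintegral_janossy _ hm]
  have hR : ∀ x, ∫⁻ ν, F x (ν + Measure.dirac x) ∂(janossy ω) = ∑' m, poissonWeight ω m *
      ∫⁻ y, F x (pointSum y + Measure.dirac x) ∂(Measure.pi fun _ : Fin m => ω) := fun x =>
    lintegral_janossy ω (hadd.comp (by fun_prop : Measurable fun ν : Measure E => (x, ν)))
  simp_rw [hR]
  rw [lintegral_tsum fun m => ((hadd' m).lintegral_prod_right'.const_mul _).aemeasurable]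
  simp_rw [lintegral_const_mul _ ((hadd' _).lintegral_prod_right')]
  have hL : ∀ (m : ℕ) (y : Fin m → E), ∫⁻ x, F x (pointSum y) ∂(trunc (pointSum y)) =
      ∑ i, F (y i) (pointSum y) := by
    intro m y
    rw [trunc_eq, lintegral_pointSum]
    exact hF.comp (by fun_prop : Measurable fun x : E => (x, pointSum y))
  have hFm : ∀ m (i : Fin m), Measurable fun y : Fin m → E => F (y i) (pointSum y) := fun m i =>
    hF.comp ((measurable_pi_apply i).prodMk (measurable_pointSum m))
  simp_rw [hL]
  rw [tsum_eq_zero_add' ENNReal.summable]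
  simp only [Finset.univ_eq_empty, Finset.sum_empty, lintegral_zero, mul_zero, zero_add]
  refine tsum_congr fun m => ?_
  rw [lintegral_finsetSum _ fun i _ => hFm _ i]
  have hi : ∀ i : Fin (m + 1), ∫⁻ y, F (y i) (pointSum y) ∂(Measure.pi fun _ : Fin (m + 1) => ω) =
      ∫⁻ x, ∫⁻ y, F x (pointSum y + Measure.dirac x) ∂(Measure.pi fun _ : Fin m => ω) ∂ω := by
    intro i
    rw [← lintegral_prod _ (hadd' m).aemeasurable,
      ← (measurePreserving_piFinSuccAbove (fun _ : Fin (m + 1) => ω) i).lintegral_comp (hadd' m)]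
    refine lintegral_congr fun y => ?_
    simp only [MeasurableEquiv.piFinSuccAbove, pointSum, Fin.sum_univ_succAbove _ i]
    simp [Fin.removeNth, Fin.insertNthEquiv, add_comm]
  simp_rw [hi]
  rw [Finset.sum_const, Finset.card_univ, Fintype.card_fin, nsmul_eq_mul, ← mul_assoc,
    poissonWeight_succ]

end Janossy

/-! ### Distinct values of a sample -/

section Distinct

variable {E : Type*}

/-- The index `i` is that of the first occurrence of the value `y i`. -/
def IsFirst {n : ℕ} (y : Fin n → E) (i : Fin n) : Prop := ∀ j < i, y j ≠ y i

open Classical in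
lemma image_filter_isFirst {n : ℕ} (y : Fin n → E) :
    (Finset.univ.filter (IsFirst y)).image y = distinctValues y := by
  ext z
  simp only [distinctValues, Finset.mem_image, Finset.mem_filter, Finset.mem_univ, true_and]
  refine ⟨fun ⟨i, _, hi⟩ => ⟨i, hi⟩, fun ⟨i, hi⟩ => ?_⟩
  obtain ⟨j, hj, hmin⟩ := WellFounded.has_min (wellFounded_lt (α := Fin n)) {j | y j = z} ⟨i, hi⟩
  exact ⟨j, fun k hk h => hmin k (h.trans hj) hk, hj⟩

lemma injOn_isFirst {n : ℕ} (y : Fin n → E) : Set.InjOn y {i | IsFirst y i} := by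
  intro i hi j hj hij
  rcases lt_trichotomy i j with h | h | h
  · exact absurd hij (hj i h)
  · exact h
  · exact absurd hij.symm (hi j h)

open Classical in
@[to_additive]
lemma prod_distinctValues {M : Type*} [CommMonoid M] {n : ℕ} (y : Fin n → E) (g : E → M) :
    ∏ z ∈ distinctValues y, g z = ∏ i, if IsFirst y i then g (y i) else 1 := by
  rw [← Finset.prod_filter, ← image_filter_isFirst, Finset.prod_image]
  simpa using injOn_isFirst y

lemma mem_distinctValues {n : ℕ} {y : Fin n → E} {z : E} : z ∈ distinctValues y ↔ ∃ i, y i = z := by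
  simp [distinctValues]

open Classical in
lemma distinctValues_cons {n : ℕ} (x : E) (y : Fin n → E) :
    distinctValues (Fin.cons x y : Fin (n + 1) → E) = insert x (distinctValues y) := by
  ext z
  simp [mem_distinctValues, Fin.exists_fin_succ, eq_comm]

lemma distinctConfig_of_injective [MeasurableSpace E] {n : ℕ} {y : Fin n → E}
    (h : Function.Injective y) : distinctConfig y = pointSum y := by
  classical
  rw [distinctConfig, distinctValues, pointSum, Finset.sum_image fun i _ j _ hij => h hij]

lemma distinctConfig_cons_of_mem [MeasurableSpace E] {n : ℕ} {x : E} {y : Fin n → E}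
    (h : x ∈ distinctValues y) :
    distinctConfig (Fin.cons x y : Fin (n + 1) → E) = distinctConfig y := by
  classical
  rw [distinctConfig, distinctValues_cons, Finset.insert_eq_of_mem h, distinctConfig]

lemma distinctConfig_cons_of_notMem [MeasurableSpace E] {n : ℕ} {x : E} {y : Fin n → E}
    (h : x ∉ distinctValues y) :
    distinctConfig (Fin.cons x y : Fin (n + 1) → E) = Measure.dirac x + distinctConfig y := by
  classical
  rw [distinctConfig, distinctValues_cons, Finset.sum_insert h, distinctConfig]

instance [MeasurableSpace E] {n : ℕ} (y : Fin n → E) : IsFiniteMeasure (distinctConfig y) := by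
  unfold distinctConfig; infer_instance

lemma lintegral_distinctConfig [MeasurableSpace E] {n : ℕ} (y : Fin n → E) {h : E → ℝ≥0∞}
    (hh : Measurable h) : ∫⁻ z, h z ∂(distinctConfig y) = ∑ z ∈ distinctValues y, h z := by
  rw [distinctConfig, lintegral_finsetSum_measure]
  exact Finset.sum_congr rfl fun i _ => lintegral_dirac' _ hh

lemma distinctConfig_univ_le [MeasurableSpace E] {n : ℕ} (y : Fin n → E) :
    distinctConfig y Set.univ ≤ n := by
  classical
  rw [distinctConfig, Measure.finsetSum_apply]
  simp only [measure_univ, Finset.sum_const, nsmul_eq_mul, mul_one]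
  exact_mod_cast Finset.card_image_le.trans (by simp)

variable [MeasurableSpace E] [MeasurableEq E]

lemma measurableSet_isFirst {n : ℕ} (i : Fin n) : MeasurableSet {y : Fin n → E | IsFirst y i} := by
  simp only [IsFirst, Set.ofPred_forall]
  exact MeasurableSet.iInter fun j => MeasurableSet.iInter fun _ =>
    (measurableSet_eq_fun (measurable_pi_apply j) (measurable_pi_apply i)).compl

lemma measurable_multiplicity {n : ℕ} (i : Fin n) :
    Measurable fun y : Fin n → E => multiplicity y (y i) := by
  classical
  simp only [multiplicity, Finset.card_filter]
  exact Finset.measurable_fun_sum _ fun j _ => Measurable.ite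
    (measurableSet_eq_fun (measurable_pi_apply j) (measurable_pi_apply i)) measurable_const
    measurable_const

lemma measurable_distinctConfig (n : ℕ) :
    Measurable (distinctConfig : (Fin n → E) → Measure E) := by
  classical
  have : (distinctConfig : (Fin n → E) → Measure E) =
      fun y => ∑ i, if IsFirst y i then Measure.dirac (y i) else 0 := by
    ext1 y
    rw [distinctConfig, sum_distinctValues]
  rw [this]
  exact measurable_finsetSum_measure _ fun i _ => Measurable.ite (measurableSet_isFirst i)
    (measurable_dirac_comp (measurable_pi_apply i)) measurable_const

/-- Products over the distinct values of a sample are jointly measurable. -/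
lemma measurable_prod_distinctValues {α : Type*} [MeasurableSpace α] {n : ℕ}
    {w : α → E → ℕ → ℝ≥0∞} (hw : ∀ m, Measurable fun p : α × E => w p.1 p.2 m) :
    Measurable fun p : (Fin n → E) × α =>
      ∏ z ∈ distinctValues p.1, w p.2 z (multiplicity p.1 z) := by
  classical
  have hw' : Measurable fun p : (α × E) × ℕ => w p.1.1 p.1.2 p.2 :=
    measurable_from_prod_countable_left hw
  simp_rw [prod_distinctValues]
  refine Finset.measurable_fun_prod _ fun i _ => Measurable.ite
    (measurable_fst (measurableSet_isFirst i)) ?_ measurable_const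
  exact hw'.comp ((measurable_snd.prodMk ((measurable_pi_apply i).comp measurable_fst)).prodMk
    ((measurable_multiplicity i).comp measurable_fst))

end Distinct

/-! ### The Mecke formula for samples with ties -/

section Mecke

lemma measurable_finCons {E : Type*} [MeasurableSpace E] (n : ℕ) :
    Measurable fun p : (Fin n → E) × E => (Fin.cons p.2 p.1 : Fin (n + 1) → E) := by
  refine measurable_pi_lambda _ fun i => ?_
  refine Fin.cases ?_ (fun j => ?_) i
  · simpa using measurable_snd
  · simpa [Function.comp_def] using (measurable_pi_apply j).comp measurable_fst

lemma lintegral_powKernel_succ {E : Type*} [MeasurableSpace E] {n : ℕ} (ν : Measure E)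
    {G : (Fin (n + 1) → E) → ℝ≥0∞}
    (hG : Measurable G) : ∫⁻ y, G y ∂(powKernel (n + 1) ν) =
      ∫⁻ y, ∫⁻ x, G (Fin.cons x y) ∂(trunc ν) ∂(powKernel n ν) := by
  simp only [powKernel_apply]
  have h := (measurePreserving_piFinSuccAbove (fun _ : Fin (n + 1) => trunc ν) 0).symm
  rw [← h.lintegral_comp hG, lintegral_prod_symm
    (fun a => G ((MeasurableEquiv.piFinSuccAbove (fun _ => E) 0).symm a))
    (hG.comp h.measurable).aemeasurable]
  refine lintegral_congr fun y => lintegral_congr fun x => ?_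
  simp [MeasurableEquiv.piFinSuccAbove, Fin.insertNthEquiv]

variable {E : Type*} [MeasurableSpace E] [MeasurableEq E]

/-- The kernel `y ↦ ω + ∑_{x ∈ y*} δₓ`. -/
def extendKernel (ω : Measure E) (n : ℕ) : Kernel (Fin n → E) E :=
  Kernel.const _ ω + ⟨distinctConfig, measurable_distinctConfig n⟩

lemma extendKernel_apply (ω : Measure E) (n : ℕ) (y : Fin n → E) :
    extendKernel ω n y = ω + distinctConfig y := by
  simp [extendKernel]

instance (ω : Measure E) [IsFiniteMeasure ω] (n : ℕ) : IsFiniteKernel (extendKernel ω n) := by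
  refine ⟨⟨ω Set.univ + n, by simp [measure_lt_top], fun y => ?_⟩⟩
  rw [extendKernel_apply, Measure.add_apply]
  gcongr
  exact distinctConfig_univ_le y

/-- The `n`-th moment measure of the Poisson process with mean measure `ω`. -/
def meckeMeasure (ω : Measure E) : (n : ℕ) → Measure (Fin n → E)
  | 0 => Measure.dirac fun i => i.elim0
  | n + 1 => (meckeMeasure ω n ⊗ₘ extendKernel ω n).map
      fun p => (Fin.cons p.2 p.1 : Fin (n + 1) → E)

instance (ω : Measure E) [IsFiniteMeasure ω] (n : ℕ) : IsFiniteMeasure (meckeMeasure ω n) := by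
  induction n with
  | zero => unfold meckeMeasure; infer_instance
  | succ n ih => unfold meckeMeasure; infer_instance

lemma lintegral_meckeMeasure_succ (ω : Measure E) [IsFiniteMeasure ω] {n : ℕ}
    {G : (Fin (n + 1) → E) → ℝ≥0∞} (hG : Measurable G) :
    ∫⁻ y, G y ∂(meckeMeasure ω (n + 1)) =
      ∫⁻ y, ∫⁻ x, G (Fin.cons x y) ∂(ω + distinctConfig y) ∂(meckeMeasure ω n) := by
  rw [meckeMeasure, lintegral_map hG (measurable_finCons n),
    Measure.lintegral_compProd (f := fun p => G (Fin.cons p.2 p.1))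
      (hG.comp (measurable_finCons n))]
  simp_rw [extendKernel_apply]

/-- The Mecke formula for samples of `n` points, with ties, from a Poisson process. -/
theorem lintegral_janossy_powKernel (ω : Measure E) [IsFiniteMeasure ω] [NullSingletonClass ω]
    (n : ℕ) {F : (Fin n → E) → Measure E → ℝ≥0∞}
    (hF : Measurable fun p : (Fin n → E) × Measure E => F p.1 p.2) :
    ∫⁻ ν, ∫⁻ y, F y ν ∂(powKernel n ν) ∂(janossy ω) =
      ∫⁻ y, ∫⁻ ν, F y (ν + distinctConfig y) ∂(janossy ω) ∂(meckeMeasure ω n) := by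
  induction n with
  | zero =>
    have h1 : ∀ ν : Measure E, powKernel 0 ν = Measure.dirac fun i => i.elim0 := fun ν => by
      rw [powKernel_apply, Measure.pi_of_empty (x := fun i : Fin 0 => i.elim0)]
    have h2 : distinctConfig (fun i : Fin 0 => (i.elim0 : E)) = 0 := by
      simp [distinctConfig, distinctValues]
    simp_rw [h1, meckeMeasure]
    have hm : Measurable fun p : (Fin 0 → E) × Measure E => F p.1 (p.2 + distinctConfig p.1) :=
      hF.comp (measurable_fst.prodMk (measurable_snd.add
        ((measurable_distinctConfig 0).comp measurable_fst)))
    rw [lintegral_dirac' _ hm.lintegral_prod_right']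
    simp only [h2, add_zero]
    exact lintegral_congr fun ν => lintegral_dirac' _
      (hF.comp (by fun_prop : Measurable fun y : Fin 0 → E => (y, ν)))
  | succ n ih =>
    have hFν : ∀ ν, Measurable fun y => F y ν := fun ν =>
      hF.comp (by fun_prop : Measurable fun y : Fin (n + 1) → E => (y, ν))
    have hG : Measurable fun p : (Fin n → E) × E × Measure E => F (Fin.cons p.2.1 p.1) p.2.2 :=
      hF.comp (((measurable_finCons n).comp
        (by fun_prop : Measurable fun p : (Fin n → E) × E × Measure E => (p.1, p.2.1))).prodMk
        (by fun_prop))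
    have hH : Measurable fun p : (Fin (n + 1) → E) × Measure E =>
        F p.1 (p.2 + distinctConfig p.1) := hF.comp (measurable_fst.prodMk (measurable_snd.add
          ((measurable_distinctConfig _).comp measurable_fst)))
    simp_rw [lintegral_powKernel_succ _ (hFν _)]
    rw [ih (measurable_lintegral_trunc (F := fun y x ν => F (Fin.cons x y) ν) hG),
      lintegral_meckeMeasure_succ ω
      (Measurable.lintegral_prod_right' (f := fun p : (Fin (n + 1) → E) × Measure E =>
        F p.1 (p.2 + distinctConfig p.1)) hH)]
    refine lintegral_congr fun y => ?_
    set ξ := distinctConfig y with hξ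
    have hGy : Measurable fun p : E × Measure E => F (Fin.cons p.1 y) (p.2 + ξ) :=
      hG.comp (measurable_const.prodMk (measurable_fst.prodMk
        (measurable_snd.add measurable_const)))
    have hGy' : ∀ ν, Measurable fun x : E => F (Fin.cons x y) (ν + ξ) := fun ν =>
      hGy.comp (by fun_prop : Measurable fun x : E => (x, ν))
    have h1 : ∀ᵐ ν ∂(janossy ω), ∫⁻ x, F (Fin.cons x y) (ν + ξ) ∂(trunc (ν + ξ)) =
        ∫⁻ x, F (Fin.cons x y) (ν + ξ) ∂(trunc ν) + ∫⁻ x, F (Fin.cons x y) (ν + ξ) ∂ξ := by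
      filter_upwards [ae_janossy_isFiniteMeasure ω] with ν hν
      rw [trunc_eq, trunc_eq, lintegral_add_measure]
    have h2 : Measurable fun ν : Measure E => ∫⁻ x, F (Fin.cons x y) (ν + ξ) ∂(trunc ν) :=
      (measurable_lintegral_trunc (α := Unit) (F := fun _ x ν => F (Fin.cons x y) (ν + ξ))
        (hGy.comp measurable_snd)).comp (by fun_prop : Measurable fun ν : Measure E => ((), ν))
    rw [lintegral_congr_ae h1, lintegral_add_left h2, lintegral_janossy_mecke ω
      (F := fun x ν => F (Fin.cons x y) (ν + ξ)) hGy, lintegral_add_measure]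
    congr 1
    · refine lintegral_congr_ae ?_
      have hnull : ∀ᵐ x ∂ω, x ∉ distinctValues y := by
        have : ω (distinctValues y : Set E) = 0 := (distinctValues y).measure_zero ω
        exact measure_eq_zero_iff_ae_notMem.1 this
      filter_upwards [hnull] with x hx
      simp_rw [distinctConfig_cons_of_notMem hx, ← hξ, add_assoc]
    · rw [lintegral_lintegral_swap]
      · refine lintegral_congr_ae ?_
        have : ∀ᵐ x ∂ξ, x ∈ distinctValues y := by
          rw [ae_iff, hξ, distinctConfig, Measure.finsetSum_apply]
          have : MeasurableSet {a | a ∉ distinctValues y} :=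
            (distinctValues y).measurableSet.compl
          refine Finset.sum_eq_zero fun z hz => ?_
          rw [Measure.dirac_apply' _ this]
          simp [hz]
        filter_upwards [this] with x hx
        simp_rw [distinctConfig_cons_of_mem hx, ← hξ]
      · exact (hGy.comp measurable_swap).aemeasurable

end Mecke

/-! ### Laplace transforms of the mark law -/

section Marks

/-- The tilted moment `∫ sᵐ exp(-t s) H(ds)`. -/
def kap (H : Measure ℝ≥0) (m : ℕ) (t : ℝ≥0) : ℝ≥0∞ :=
  ∫⁻ s : ℝ≥0, expNeg ((t : ℝ≥0∞) * s) * (s : ℝ≥0∞) ^ m ∂H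

lemma measurable_kap_integrand (m : ℕ) :
    Measurable fun p : ℝ≥0 × ℝ≥0 => expNeg ((p.1 : ℝ≥0∞) * p.2) * (p.2 : ℝ≥0∞) ^ m :=
  by fun_prop

lemma measurable_kap_integrand_right (m : ℕ) (t : ℝ≥0) :
    Measurable fun s : ℝ≥0 => expNeg ((t : ℝ≥0∞) * s) * (s : ℝ≥0∞) ^ m :=
  by fun_prop

@[fun_prop]
lemma measurable_kap (H : Measure ℝ≥0) [SFinite H] (m : ℕ) : Measurable (kap H m) :=
  (measurable_kap_integrand m).lintegral_prod_right'

variable (H : Measure ℝ≥0)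

lemma kap_zero_le_one [IsProbabilityMeasure H] (t : ℝ≥0) : kap H 0 t ≤ 1 := by
  unfold kap
  simp only [pow_zero, mul_one]
  exact (lintegral_mono fun _ => expNeg_le_one _).trans (by simp)

lemma kap_zero_ne_top [IsProbabilityMeasure H] (t : ℝ≥0) : kap H 0 t ≠ ∞ :=
  ((kap_zero_le_one H t).trans_lt ENNReal.one_lt_top).ne

lemma kap_ne_zero [IsProbabilityMeasure H] {m : ℕ} (h : m = 0 ∨ H {0} = 0) (t : ℝ≥0) : kap H m t ≠ 0 := by
  unfold kap
  rw [Ne, lintegral_eq_zero_iff (measurable_kap_integrand_right m t)]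
  intro h0
  have hpos : ∀ᵐ s ∂H, s ≠ 0 ∨ m = 0 := by
    rcases h with h | h
    · simp [h]
    · filter_upwards [measure_eq_zero_iff_ae_notMem.1 h] with s hs
      exact Or.inl (by simpa using hs)
  obtain ⟨s, h1, h2⟩ := (h0.and hpos).exists
  have h3 : expNeg ((t : ℝ≥0∞) * s) * (s : ℝ≥0∞) ^ m = 0 := h1
  rcases mul_eq_zero.1 h3 with h | h
  · exact (expNeg_pos (ENNReal.mul_ne_top ENNReal.coe_ne_top ENNReal.coe_ne_top)).ne' h
  · rw [pow_eq_zero_iff'] at h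
    rcases h2 with h2 | h2
    · exact h2 (by simpa using h.1)
    · exact h.2 h2

lemma kap_zero_ne_zero [IsProbabilityMeasure H] (t : ℝ≥0) : kap H 0 t ≠ 0 := kap_ne_zero H (Or.inl rfl) t

lemma kap_ne_top [IsProbabilityMeasure H] {t : ℝ≥0} (ht : t ≠ 0) (m : ℕ) : kap H m t ≠ ∞ := by
  have hb : ∀ s : ℝ≥0, expNeg ((t : ℝ≥0∞) * s) * (s : ℝ≥0∞) ^ m ≤
      ENNReal.ofReal (m.factorial / (t : ℝ) ^ m) := by
    intro s
    rw [← ENNReal.coe_mul, expNeg_coe, ← ENNReal.ofReal_coe_nnreal (p := s),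
      ← ENNReal.ofReal_pow s.coe_nonneg, ← ENNReal.ofReal_mul (Real.exp_nonneg _)]
    refine ENNReal.ofReal_le_ofReal ?_
    have ht' : (0 : ℝ) < t := by positivity
    have := Real.pow_div_factorial_le_exp ((t : ℝ) * s) (by positivity) m
    rw [le_div_iff₀ (by positivity), NNReal.coe_mul, Real.exp_neg, mul_assoc,
      inv_mul_le_iff₀ (Real.exp_pos _)]
    rw [div_le_iff₀ (by positivity), mul_pow] at this
    linarith
  refine ne_top_of_le_ne_top (b := ENNReal.ofReal (m.factorial / (t : ℝ) ^ m))
    ENNReal.ofReal_ne_top ?_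
  exact (lintegral_mono hb).trans (by simp)

lemma kap_anti {m : ℕ} {t t' : ℝ≥0} (h : t ≤ t') : kap H m t' ≤ kap H m t := by
  refine lintegral_mono fun s => ?_
  gcongr ?_ * _
  rw [← ENNReal.coe_mul, ← ENNReal.coe_mul, expNeg_coe, expNeg_coe]
  refine ENNReal.ofReal_le_ofReal (Real.exp_le_exp.2 (neg_le_neg ?_))
  exact_mod_cast mul_le_mul_left h s

/-- The exponent `-log ψ(t)`. -/
def nlog (t : ℝ≥0) : ℝ≥0∞ := ENNReal.ofReal (-Real.log (kap H 0 t).toReal)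

@[fun_prop]
lemma measurable_nlog [IsProbabilityMeasure H] : Measurable (nlog H) :=
  ((measurable_kap H 0).ennreal_toReal.log.neg).ennreal_ofReal

lemma expNeg_nlog [IsProbabilityMeasure H] (t : ℝ≥0) : expNeg (nlog H t) = kap H 0 t := by
  have h0 : 0 < (kap H 0 t).toReal :=
    ENNReal.toReal_pos (kap_zero_ne_zero H t) (kap_zero_ne_top H t)
  have h1 : (kap H 0 t).toReal ≤ 1 := by
    have := ENNReal.toReal_mono ENNReal.one_ne_top (kap_zero_le_one H t)
    simpa using this
  rw [nlog, expNeg_ofReal (by simpa using Real.log_nonpos h0.le h1), neg_neg, Real.exp_log h0,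
    ENNReal.ofReal_toReal (kap_zero_ne_top H t)]

lemma nlog_mono [IsProbabilityMeasure H] {t t' : ℝ≥0} (h : t ≤ t') : nlog H t ≤ nlog H t' := by
  refine ENNReal.ofReal_le_ofReal (neg_le_neg (Real.log_le_log ?_ ?_))
  · exact ENNReal.toReal_pos (kap_zero_ne_zero H t') (kap_zero_ne_top H t')
  · exact ENNReal.toReal_mono (kap_zero_ne_top H t) (kap_anti H h)

variable {E : Type*} [MeasurableSpace E]

/-- The functional `ν ↦ exp(∫ log ψ(h(x)) ν(dx))`. -/
def gen (h : E → ℝ≥0) (ν : Measure E) : ℝ≥0∞ := expNeg (∫⁻ x, nlog H (h x) ∂ν)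

lemma measurable_gen [IsProbabilityMeasure H] {h : E → ℝ≥0} (hh : Measurable h) : Measurable (gen H h) :=
  measurable_expNeg.comp (Measure.measurable_lintegral ((measurable_nlog H).comp hh))

lemma gen_add (h : E → ℝ≥0) (ν ξ : Measure E) : gen H h (ν + ξ) = gen H h ν * gen H h ξ := by
  rw [gen, lintegral_add_measure, expNeg_add]; rfl

lemma gen_le_one (h : E → ℝ≥0) (ν : Measure E) : gen H h ν ≤ 1 := expNeg_le_one _

lemma expNeg_anti {x y : ℝ≥0∞} (h : x ≤ y) : expNeg y ≤ expNeg x := by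
  obtain ⟨z, rfl⟩ := exists_add_of_le h
  rw [expNeg_add]
  exact mul_le_of_le_one_right zero_le (expNeg_le_one z)

lemma gen_anti [IsProbabilityMeasure H] {h h' : E → ℝ≥0} (hle : ∀ x, h x ≤ h' x) (ν : Measure E) :
    gen H h' ν ≤ gen H h ν :=
  expNeg_anti (lintegral_mono fun x => nlog_mono H (hle x))

lemma gen_distinctConfig [IsProbabilityMeasure H] {h : E → ℝ≥0} (hh : Measurable h) {n : ℕ} (y : Fin n → E) :
    gen H h (distinctConfig y) = ∏ z ∈ distinctValues y, kap H 0 (h z) := by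
  rw [gen, lintegral_distinctConfig (h := fun x => nlog H (h x)) _ (by fun_prop), expNeg_sum]
  simp_rw [expNeg_nlog]

lemma gen_pointSum [IsProbabilityMeasure H] {h : E → ℝ≥0} (hh : Measurable h) {m : ℕ} (x : Fin m → E) :
    gen H h (pointSum x) = ∏ i, kap H 0 (h (x i)) := by
  rw [gen, lintegral_pointSum (h := fun x => nlog H (h x)) _ (by fun_prop), expNeg_sum]
  simp_rw [expNeg_nlog]

end Marks

/-! ### Random measures with independent jumps -/

section RandomMeasure

variable {E : Type*} [MeasurableSpace E]

lemma measurable_jumpMeasure :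
    Measurable (jumpMeasure : Measure (E × ℝ≥0) → Measure E) := by
  refine Measure.measurable_of_measurable_coe _ fun A hA => ?_
  have : ∀ ψ : Measure (E × ℝ≥0), jumpMeasure ψ A =
      ∫⁻ p, (Prod.fst ⁻¹' A).indicator (fun p : E × ℝ≥0 => (p.2 : ℝ≥0∞)) p ∂ψ := by
    intro ψ
    rw [jumpMeasure, Measure.map_apply measurable_fst hA,
      withDensity_apply _ (measurable_fst hA), lintegral_indicator (measurable_fst hA)]
  simp_rw [this]
  exact Measure.measurable_lintegral
    ((measurable_snd.coe_nnreal_ennreal).indicator (measurable_fst hA))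

lemma measurable_markedConfig :
    Measurable fun q : (ℕ × (ℕ → E)) × (ℕ → ℝ≥0) =>
      config q.1.1 (fun j => (q.1.2 j, q.2 j)) :=
  Measurable.comp (g := fun q : ℕ × (ℕ → E × ℝ≥0) => config q.1 q.2)
    (f := fun q : (ℕ × (ℕ → E)) × (ℕ → ℝ≥0) => (q.1.1, fun j => (q.1.2 j, q.2 j)))
    measurable_config (by fun_prop)

lemma lintegral_jumpMeasure_config (m : ℕ) (x : ℕ → E) (s : ℕ → ℝ≥0) {h : E → ℝ≥0∞}
    (hh : Measurable h) : ∫⁻ z, h z ∂(jumpMeasure (config m fun j => (x j, s j))) =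
      ∑ l : Fin m, (s l : ℝ≥0∞) * h (x l) := by
  rw [jumpMeasure, lintegral_map hh measurable_fst, lintegral_withDensity_eq_lintegral_mul _
    measurable_snd.coe_nnreal_ennreal (g := fun p => h p.1) (by fun_prop), lintegral_config]
  · simp [Finset.sum_range]
  · exact measurable_snd.coe_nnreal_ennreal.mul (g := fun p => h p.1) (by fun_prop)

lemma jumpMeasure_config_apply (m : ℕ) (x : ℕ → E) (s : ℕ → ℝ≥0) {C : Set E}
    (hC : MeasurableSet C) : jumpMeasure (config m fun j => (x j, s j)) C =
      ∑ l : Fin m, (s l : ℝ≥0∞) * C.indicator (1 : E → ℝ≥0∞) (x l) := by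
  rw [← lintegral_indicator_one hC, lintegral_jumpMeasure_config _ _ _
    (measurable_one.indicator hC)]

instance (m : ℕ) (x : ℕ → E) (s : ℕ → ℝ≥0) :
    IsFiniteMeasure (jumpMeasure (config m fun j => (x j, s j))) := by
  refine ⟨?_⟩
  rw [jumpMeasure_config_apply _ _ _ MeasurableSet.univ]
  exact ENNReal.sum_lt_top.2 fun l _ => by simp [ENNReal.coe_lt_top]

lemma lintegral_infinitePi_prod (H : Measure ℝ≥0) [IsProbabilityMeasure H] {m : ℕ}
    {φ : Fin m → ℝ≥0 → ℝ≥0∞} (hφ : ∀ l, Measurable (φ l)) :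
    ∫⁻ s, ∏ l : Fin m, φ l (s l) ∂(Measure.infinitePi fun _ : ℕ => H) =
      ∏ l : Fin m, ∫⁻ s, φ l s ∂H := by
  set X : ℕ → ℝ≥0 → ℝ≥0∞ := fun j => if h : j < m then φ ⟨j, h⟩ else 0 with hX
  have mX : ∀ j, Measurable (X j) := by
    intro j
    by_cases h : j < m
    · simpa [hX, h] using hφ _
    · simpa [hX, h] using measurable_zero
  have hXl : ∀ l : Fin m, X l = φ l := fun l => by simp [hX]
  have := lintegral_prod_eq_prod_lintegral_of_indepFun (Finset.range m) _
    (iIndepFun_infinitePi (P := fun _ : ℕ => H) mX) (fun j => (mX j).comp (measurable_pi_apply j))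
  simp only [Finset.prod_range, hXl] at this
  rw [this]
  refine Finset.prod_congr rfl fun l _ => ?_
  exact (measurePreserving_eval_infinitePi (fun _ : ℕ => H) (l : ℕ)).lintegral_comp (hφ l)

open Classical in
lemma lintegral_marks (H : Measure ℝ≥0) [IsProbabilityMeasure H] (m : ℕ) (x : ℕ → E) {n : ℕ}
    {C : Fin n → Set E} (hC : ∀ i, MeasurableSet (C i)) {h : E → ℝ≥0} (hh : Measurable h) :
    ∫⁻ s, expNeg (∫⁻ z, h z ∂(jumpMeasure (config m fun j => (x j, s j)))) *
        ∏ i, jumpMeasure (config m fun j => (x j, s j)) (C i)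
        ∂(Measure.infinitePi fun _ : ℕ => H) =
      ∑ j : Fin n → Fin m, (∏ i, (C i).indicator 1 (x (j i))) *
        ∏ l : Fin m, kap H (Finset.univ.filter fun i => j i = l).card (h (x l)) := by
  have key : ∀ s : ℕ → ℝ≥0,
      expNeg (∫⁻ z, h z ∂(jumpMeasure (config m fun j => (x j, s j)))) *
        ∏ i, jumpMeasure (config m fun j => (x j, s j)) (C i) =
      ∑ j : Fin n → Fin m, (∏ i, (C i).indicator 1 (x (j i))) *
        ∏ l : Fin m, (expNeg ((h (x l) : ℝ≥0∞) * s l) *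
          (s l : ℝ≥0∞) ^ (Finset.univ.filter fun i => j i = l).card) := by
    intro s
    rw [lintegral_jumpMeasure_config _ _ _ hh.coe_nnreal_ennreal]
    simp_rw [jumpMeasure_config_apply _ _ _ (hC _), Finset.prod_univ_sum, Fintype.piFinset_univ,
      expNeg_sum, Finset.mul_sum]
    refine Finset.sum_congr rfl fun j _ => ?_
    rw [Finset.prod_mul_distrib, Finset.prod_mul_distrib]
    have : ∏ l : Fin m, (s l : ℝ≥0∞) ^ (Finset.univ.filter fun i => j i = l).card =
        ∏ i, (s (j i) : ℝ≥0∞) := by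
      rw [← Finset.prod_fiberwise Finset.univ j fun i => (s (j i) : ℝ≥0∞)]
      refine Finset.prod_congr rfl fun l _ => ?_
      rw [Finset.prod_congr rfl (g := fun _ => (s l : ℝ≥0∞)), Finset.prod_const]
      intro i hi
      rw [(Finset.mem_filter.1 hi).2]
    rw [this]
    simp_rw [mul_comm (s _ : ℝ≥0∞) (h _ : ℝ≥0∞)]
    ring
  have hm : ∀ (j : Fin n → Fin m) (l : Fin m), Measurable fun s : ℝ≥0 =>
      expNeg ((h (x l) : ℝ≥0∞) * s) *
        (s : ℝ≥0∞) ^ (Finset.univ.filter fun i => j i = l).card := fun j l =>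
    measurable_kap_integrand_right _ _
  have hm' : ∀ j : Fin n → Fin m, Measurable fun s : ℕ → ℝ≥0 => ∏ l : Fin m,
      (expNeg ((h (x l) : ℝ≥0∞) * s l) *
        (s l : ℝ≥0∞) ^ (Finset.univ.filter fun i => j i = l).card) := fun j =>
    Finset.measurable_fun_prod _ fun l _ => (hm j l).comp (measurable_pi_apply _)
  simp_rw [key]
  rw [lintegral_finsetSum _ fun j _ => (hm' j).const_mul _]
  refine Finset.sum_congr rfl fun j _ => ?_
  rw [lintegral_const_mul _ (hm' j), lintegral_infinitePi_prod H (hm j)]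
  rfl

/-- The product `∏_{x ∈ y*} ∫ s^{nₓ} exp(-h(x) s) H(ds)`. -/
def kapProd (H : Measure ℝ≥0) (h : E → ℝ≥0) {n : ℕ} (y : Fin n → E) : ℝ≥0∞ :=
  ∏ z ∈ distinctValues y, kap H (multiplicity y z) (h z)

/-- The product of the ratios `∫ s^{nₓ} exp(-h(x) s) H(ds) / ψ(h(x))` over `x ∈ y*`. -/
def kapRatio (H : Measure ℝ≥0) (h : E → ℝ≥0) {n : ℕ} (y : Fin n → E) : ℝ≥0∞ :=
  ∏ z ∈ distinctValues y, kap H (multiplicity y z) (h z) / kap H 0 (h z)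

lemma measurable_kapProd [MeasurableEq E] {α : Type*} [MeasurableSpace α] (H : Measure ℝ≥0)
    [SFinite H] {h : α → E → ℝ≥0} (hh : Measurable fun p : α × E => h p.1 p.2) (n : ℕ) :
    Measurable fun p : (Fin n → E) × α => kapProd H (h p.2) p.1 :=
  measurable_prod_distinctValues (w := fun a z m => kap H m (h a z)) fun m =>
    (measurable_kap H m).comp hh

lemma measurable_kapRatio [MeasurableEq E] (H : Measure ℝ≥0)
    [SFinite H] {h : E → ℝ≥0} (hh : Measurable h) (n : ℕ) :
    Measurable fun y : Fin n → E => kapRatio H h y :=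
  Measurable.comp (f := fun y : Fin n → E => (y, ()))
    (measurable_prod_distinctValues (α := Unit) (w := fun _ z m => kap H m (h z) / kap H 0 (h z))
      fun m => by fun_prop) (by fun_prop)

lemma kapRatio_mul_gen (H : Measure ℝ≥0) [IsProbabilityMeasure H] {h : E → ℝ≥0}
    (hh : Measurable h) {n : ℕ} (y : Fin n → E) :
    kapRatio H h y * gen H h (distinctConfig y) = kapProd H h y := by
  rw [gen_distinctConfig H hh, kapRatio, ← Finset.prod_mul_distrib, kapProd]
  exact Finset.prod_congr rfl fun z _ =>
    ENNReal.div_mul_cancel (kap_zero_ne_zero H _) (kap_zero_ne_top H _)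

lemma pi_pointSum_eq_sum (n : ℕ) {m : ℕ} (x : Fin m → E) :
    (Measure.pi fun _ : Fin n => pointSum x) =
      ∑ j : Fin n → Fin m, Measure.dirac fun i => x (j i) := by
  classical
  refine Measure.pi_eq fun s hs => ?_
  simp_rw [pointSum, Measure.finsetSum_apply, Finset.prod_univ_sum, Fintype.piFinset_univ]
  refine Finset.sum_congr rfl fun j _ => ?_
  rw [Measure.dirac_apply' _ (MeasurableSet.univ_pi hs)]
  simp_rw [Measure.dirac_apply' _ (hs _)]
  by_cases h : (fun i => x (j i)) ∈ Set.univ.pi s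
  · rw [Set.indicator_of_mem h]
    simp only [Set.mem_pi, Set.mem_univ, true_imp_iff] at h
    simp [h]
  · rw [Set.indicator_of_notMem h]
    simp only [Set.mem_pi, Set.mem_univ, true_imp_iff, not_forall] at h
    obtain ⟨i, hi⟩ := h
    exact (Finset.prod_eq_zero (Finset.mem_univ i) (by simp [hi])).symm

lemma prod_kap_eq (H : Measure ℝ≥0) [IsProbabilityMeasure H] {h : E → ℝ≥0}
    (hh : Measurable h) {m n : ℕ} {x : Fin m → E} (hx : Function.Injective x) (j : Fin n → Fin m) :
    ∏ l : Fin m, kap H (Finset.univ.filter fun i => j i = l).card (h (x l)) =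
      kapRatio H h (fun i => x (j i)) * gen H h (pointSum x) := by
  classical
  have h1 : ∀ l : Fin m, kap H (Finset.univ.filter fun i => j i = l).card (h (x l)) =
      kap H (Finset.univ.filter fun i => j i = l).card (h (x l)) / kap H 0 (h (x l)) *
        kap H 0 (h (x l)) := fun l =>
    (ENNReal.div_mul_cancel (kap_zero_ne_zero H _) (kap_zero_ne_top H _)).symm
  rw [Finset.prod_congr rfl fun l _ => h1 l, Finset.prod_mul_distrib, gen_pointSum H hh]
  congr 1
  have h2 : distinctValues (fun i => x (j i)) = (Finset.univ.image j).image x := by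
    ext z; simp [mem_distinctValues]
  rw [kapRatio, h2, Finset.prod_image fun _ _ _ _ hab => hx hab]
  symm
  refine (Finset.prod_subset (Finset.subset_univ _) fun l _ hl => ?_).trans ?_
  · have h3 : multiplicity (fun i => x (j i)) (x l) = 0 := by
      rw [multiplicity, Finset.card_eq_zero, Finset.filter_eq_empty_iff]
      intro i _ hi
      exact hl (Finset.mem_image.2 ⟨i, Finset.mem_univ i, hx hi⟩)
    rw [h3, ENNReal.div_self (kap_zero_ne_zero H _) (kap_zero_ne_top H _)]
  · refine Finset.prod_congr rfl fun l _ => ?_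
    have h3 : multiplicity (fun i => x (j i)) (x l) =
        (Finset.univ.filter fun i => j i = l).card := by
      rw [multiplicity]
      congr 1
      ext i
      simp only [Finset.mem_filter, Finset.mem_univ, true_and]
      exact hx.eq_iff
    rw [h3]

lemma lintegral_marks_of_injective [MeasurableEq E] (H : Measure ℝ≥0) [IsProbabilityMeasure H]
    (m : ℕ) (x : ℕ → E) (hx : Function.Injective fun l : Fin m => x l) {n : ℕ}
    {C : Fin n → Set E} (hC : ∀ i, MeasurableSet (C i)) {h : E → ℝ≥0} (hh : Measurable h) :
    ∫⁻ s, expNeg (∫⁻ z, h z ∂(jumpMeasure (config m fun j => (x j, s j)))) *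
        ∏ i, jumpMeasure (config m fun j => (x j, s j)) (C i)
        ∂(Measure.infinitePi fun _ : ℕ => H) =
      (∫⁻ y in Set.univ.pi C, kapRatio H h y ∂(powKernel n (config m x))) *
        gen H h (config m x) := by
  classical
  have hCm : MeasurableSet (Set.univ.pi C) := MeasurableSet.univ_pi hC
  rw [lintegral_marks H m x hC hh, powKernel_apply, trunc_eq, config_eq_pointSum,
    pi_pointSum_eq_sum, ← lintegral_indicator hCm, lintegral_finsetSum_measure, Finset.sum_mul]
  refine Finset.sum_congr rfl fun j _ => ?_
  rw [lintegral_dirac' _ ((measurable_kapRatio H hh n).indicator hCm),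
    prod_kap_eq H hh hx j, ← mul_assoc]
  congr 1
  by_cases hj : (fun i => x (j i)) ∈ Set.univ.pi C
  · rw [Set.indicator_of_mem hj]
    simp only [Set.mem_pi, Set.mem_univ, true_imp_iff] at hj
    simp [hj]
  · rw [Set.indicator_of_notMem hj]
    simp only [Set.mem_pi, Set.mem_univ, true_imp_iff, not_forall] at hj
    obtain ⟨i, hi⟩ := hj
    rw [Finset.prod_eq_zero (Finset.mem_univ i) (by simp [hi]), zero_mul]

lemma IsRM.isProbabilityMeasure {P : Measure (Measure E)} {H : Measure ℝ≥0}
    [IsProbabilityMeasure H] {Q : Measure (Measure E)} (hQ : IsRM P H Q) :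
    IsProbabilityMeasure Q := by
  obtain ⟨_, ⟨ρ, hρ, -, rfl⟩, rfl⟩ := hQ
  have := Measure.isProbabilityMeasure_map (μ := ρ.prod (Measure.infinitePi fun _ : ℕ => H))
    measurable_markedConfig.aemeasurable
  exact Measure.isProbabilityMeasure_map measurable_jumpMeasure.aemeasurable

lemma IsRM.ae_isFiniteMeasure {P : Measure (Measure E)} {H : Measure ℝ≥0}
    {Q : Measure (Measure E)} (hQ : IsRM P H Q) : ∀ᵐ μ ∂Q, IsFiniteMeasure μ := by
  obtain ⟨_, ⟨ρ, hρ, -, rfl⟩, rfl⟩ := hQ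
  rw [ae_map_iff measurable_jumpMeasure.aemeasurable measurableSet_isFiniteMeasure,
    ae_map_iff measurable_markedConfig.aemeasurable
      (p := fun ψ => IsFiniteMeasure (jumpMeasure ψ))
      (measurable_jumpMeasure measurableSet_isFiniteMeasure)]
  exact Eventually.of_forall fun q => by infer_instance

lemma injective_of_config_measure_singleton_le_one [MeasurableSingletonClass E] {m : ℕ} {x : ℕ → E}
    (h : ∀ z, config m x {z} ≤ 1) : Function.Injective fun l : Fin m => x l := by
  classical
  intro i j hij
  by_contra hne
  have h1 := h (x i)
  rw [config_eq_pointSum, pointSum, Measure.finsetSum_apply] at h1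
  have h2 : ∑ l ∈ ({i, j} : Finset (Fin m)), Measure.dirac (x l) {x i} ≤ 1 :=
    (Finset.sum_le_sum_of_subset (Finset.subset_univ _)).trans h1
  rw [Finset.sum_pair hne] at h2
  have hij' : x j = x i := hij.symm
  rw [hij'] at h2
  norm_num at h2

/-- The joint Laplace functional and moments of the random measure `RM(P, H)`. -/
theorem IsRM.lintegral_expNeg_mul_prod [TopologicalSpace E] [MeasurableEq E]
    [MeasurableSingletonClass E]
    {P : Measure (Measure E)} (hP : ∀ᵐ ν ∂P, IsSimplePointMeasure ν) {H : Measure ℝ≥0}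
    [IsProbabilityMeasure H] {Q : Measure (Measure E)} (hQ : IsRM P H Q) {n : ℕ}
    {C : Fin n → Set E} (hC : ∀ i, MeasurableSet (C i)) {h : E → ℝ≥0} (hh : Measurable h) :
    ∫⁻ μ, expNeg (∫⁻ z, h z ∂μ) * ∏ i, μ (C i) ∂Q =
      ∫⁻ ν, (∫⁻ y in Set.univ.pi C, kapRatio H h y ∂(powKernel n ν)) * gen H h ν ∂P := by
  obtain ⟨_, ⟨ρ, hρ, rfl, rfl⟩, rfl⟩ := hQ
  have hm : Measurable fun μ : Measure E => expNeg (∫⁻ z, h z ∂μ) * ∏ i, μ (C i) :=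
    (measurable_expNeg_lintegral hh).mul
      (Finset.measurable_fun_prod _ fun i _ => Measure.measurable_coe (hC i))
  have hCm : MeasurableSet (Set.univ.pi C) := MeasurableSet.univ_pi hC
  have hR : Measurable fun ν : Measure E =>
      (∫⁻ y in Set.univ.pi C, kapRatio H h y ∂(powKernel n ν)) * gen H h ν :=
    ((measurable_kapRatio H hh n).setLIntegral_kernel hCm).mul (measurable_gen H hh)
  have hm2 : Measurable fun ψ : Measure (E × ℝ≥0) =>
      expNeg (∫⁻ z, h z ∂(jumpMeasure ψ)) * ∏ i, jumpMeasure ψ (C i) :=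
    hm.comp measurable_jumpMeasure
  have hm3 : Measurable fun q : (ℕ × (ℕ → E)) × (ℕ → ℝ≥0) =>
      expNeg (∫⁻ z, h z ∂(jumpMeasure (config q.1.1 fun j => (q.1.2 j, q.2 j)))) *
        ∏ i, jumpMeasure (config q.1.1 fun j => (q.1.2 j, q.2 j)) (C i) :=
    hm2.comp measurable_markedConfig
  rw [lintegral_map hm measurable_jumpMeasure, lintegral_map hm2 measurable_markedConfig,
    lintegral_map hR measurable_config,
    lintegral_prod _ hm3.aemeasurable]
  refine lintegral_congr_ae ?_
  filter_upwards [ae_of_ae_map measurable_config.aemeasurable hP] with q hq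
  exact lintegral_marks_of_injective H q.1 q.2 (injective_of_config_measure_singleton_le_one
    fun z => hq.measure_singleton_le_one z) hC hh

theorem IsRM.lap_eq [TopologicalSpace E] [MeasurableEq E] [MeasurableSingletonClass E]
    {P : Measure (Measure E)} (hP : ∀ᵐ ν ∂P, IsSimplePointMeasure ν) {H : Measure ℝ≥0}
    [IsProbabilityMeasure H] {Q : Measure (Measure E)} (hQ : IsRM P H Q) {h : E → ℝ≥0}
    (hh : Measurable h) : lap Q h = ∫⁻ ν, gen H h ν ∂P := by
  have := hQ.lintegral_expNeg_mul_prod hP (n := 0) (C := fun _ => Set.univ) (by simp) hh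
  simpa [lap, kapRatio, distinctValues, powKernel_apply] using this

end RandomMeasure

/-! ### Gibbs processes -/

section Gibbs

variable {E : Type*} [MeasurableSpace E]

/-- The integral `E[f(N + ξ) exp(∫ log ψ(h(x)) N(dx))]` over the Poisson process. -/
def zed (ω : Measure E) (f : Measure E → ℝ≥0) (H : Measure ℝ≥0) (h : E → ℝ≥0) (ξ : Measure E) :
    ℝ≥0∞ :=
  ∫⁻ ν, (f (ν + ξ) : ℝ≥0∞) * gen H h ν ∂(janossy ω)

/-- The integral `E[f(N + ξ)]` over the Poisson process. -/
def palmDensity (ω : Measure E) (f : Measure E → ℝ≥0) (ξ : Measure E) : ℝ≥0∞ :=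
  ∫⁻ ν, (f (ν + ξ) : ℝ≥0∞) ∂(janossy ω)

variable {ω : Measure E} {f : Measure E → ℝ≥0}

lemma measurable_add_config (hf : Measurable f) (ξ : Measure E) :
    Measurable fun ν : Measure E => (f (ν + ξ) : ℝ≥0∞) :=
  (hf.comp (measurable_id.add measurable_const)).coe_nnreal_ennreal

lemma measurable_zed_integrand (hf : Measurable f) (H : Measure ℝ≥0) [IsProbabilityMeasure H]
    {h : E → ℝ≥0} (hh : Measurable h) (ξ : Measure E) :
    Measurable fun ν : Measure E => (f (ν + ξ) : ℝ≥0∞) * gen H h ν :=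
  (measurable_add_config hf ξ).mul (measurable_gen H hh)

lemma measurable_gibbs [MeasurableEq E] (hf : Measurable f) (n : ℕ) :
    Measurable fun p : (Fin n → E) × Measure E => (f (p.2 + distinctConfig p.1) : ℝ≥0∞) :=
  (hf.comp (measurable_snd.add
    ((measurable_distinctConfig n).comp measurable_fst))).coe_nnreal_ennreal

lemma measurable_palmDensity [IsFiniteMeasure ω] [MeasurableEq E] (hf : Measurable f) (n : ℕ) :
    Measurable fun y : Fin n → E => palmDensity ω f (distinctConfig y) :=
  (measurable_gibbs hf n).lintegral_prod_right'

lemma measurable_zed [IsFiniteMeasure ω] [MeasurableEq E] {α : Type*} [MeasurableSpace α] (hf : Measurable f)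
    (H : Measure ℝ≥0) [IsProbabilityMeasure H] {h : α → E → ℝ≥0}
    (hh : Measurable fun p : α × E => h p.1 p.2) (n : ℕ) :
    Measurable fun p : (Fin n → E) × α => zed ω f H (h p.2) (distinctConfig p.1) := by
  have h1 : ∀ p : (Fin n → E) × α, zed ω f H (h p.2) (distinctConfig p.1) =
      ∫⁻ ν, (f (ν + distinctConfig p.1) : ℝ≥0∞) *
        expNeg (∫⁻ x, nlog H (h p.2 x) ∂(trunc ν)) ∂(janossy ω) := by
    intro p
    refine lintegral_congr_ae ?_
    filter_upwards [ae_janossy_isFiniteMeasure ω] with ν hν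
    rw [trunc_eq, gen]
  simp_rw [h1]
  have h2 : Measurable fun p : α × Measure E => ∫⁻ x, nlog H (h p.1 x) ∂(trunc p.2) :=
    measurable_lintegral_trunc (F := fun a x _ => nlog H (h a x))
      ((measurable_nlog H).comp (hh.comp
        (by fun_prop : Measurable fun p : α × E × Measure E => (p.1, p.2.1))))
  have h3 : Measurable fun p : ((Fin n → E) × α) × Measure E =>
      ∫⁻ x, nlog H (h p.1.2 x) ∂(trunc p.2) :=
    Measurable.comp (f := fun p : ((Fin n → E) × α) × Measure E => (p.1.2, p.2)) h2 (by fun_prop)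
  have h4 : Measurable fun p : ((Fin n → E) × α) × Measure E =>
      (f (p.2 + distinctConfig p.1.1) : ℝ≥0∞) :=
    Measurable.comp (f := fun p : ((Fin n → E) × α) × Measure E => (p.1.1, p.2))
      (measurable_gibbs hf n) (by fun_prop)
  exact Measurable.lintegral_prod_right'
    (f := fun p : ((Fin n → E) × α) × Measure E => (f (p.2 + distinctConfig p.1.1) : ℝ≥0∞) *
        expNeg (∫⁻ x, nlog H (h p.1.2 x) ∂(trunc p.2))) (h4.mul (measurable_expNeg.comp h3))

lemma zed_anti (H : Measure ℝ≥0) [IsProbabilityMeasure H] {h h' : E → ℝ≥0}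
    (hle : ∀ x, h x ≤ h' x) (ξ : Measure E) : zed ω f H h' ξ ≤ zed ω f H h ξ :=
  lintegral_mono fun ν => by gcongr; exact gen_anti H hle ν

lemma zed_le_palmDensity (H : Measure ℝ≥0) (h : E → ℝ≥0) (ξ : Measure E) :
    zed ω f H h ξ ≤ palmDensity ω f ξ :=
  lintegral_mono fun ν => mul_le_of_le_one_right zero_le (gen_le_one H h ν)

lemma zed_ne_zero (hf : Measurable f) (H : Measure ℝ≥0) [IsProbabilityMeasure H] {h : E → ℝ≥0}
    (hh : Measurable h) {ξ : Measure E} (hp : palmDensity ω f ξ ≠ 0) : zed ω f H h ξ ≠ 0 := by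
  contrapose! hp
  rw [zed, lintegral_eq_zero_iff (measurable_zed_integrand hf H hh ξ)] at hp
  rw [palmDensity, lintegral_eq_zero_iff (measurable_add_config hf ξ)]
  have hg : ∀ᵐ ν ∂(janossy ω), gen H h ν ≠ 0 := by
    refine ae_janossy_of_forall_pointSum ω
      ((measurable_gen H hh) (measurableSet_singleton 0)).compl fun m x => ?_
    rw [gen_pointSum H hh]
    exact Finset.prod_ne_zero_iff.2 fun i _ => kap_zero_ne_zero H _
  filter_upwards [hp, hg] with ν h1 h2
  exact (mul_eq_zero.1 h1).resolve_right h2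

/-- The Mecke formula for samples with ties from a Gibbs process. -/
lemma lintegral_gibbs_powKernel [IsFiniteMeasure ω] [NullSingletonClass ω] [MeasurableEq E] (hf : Measurable f) (n : ℕ)
    {F : (Fin n → E) → Measure E → ℝ≥0∞}
    (hF : Measurable fun p : (Fin n → E) × Measure E => F p.1 p.2) :
    ∫⁻ ν, ∫⁻ y, F y ν ∂(powKernel n ν) ∂((janossy ω).withDensity fun ν => (f ν : ℝ≥0∞)) =
      ∫⁻ y, ∫⁻ ν, (f (ν + distinctConfig y) : ℝ≥0∞) * F y (ν + distinctConfig y) ∂(janossy ω)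
        ∂(meckeMeasure ω n) := by
  have hm : Measurable fun ν : Measure E => ∫⁻ y, F y ν ∂(powKernel n ν) :=
    (hF.comp measurable_swap).lintegral_kernel_prod_right'
  rw [lintegral_withDensity_eq_lintegral_mul _ hf.coe_nnreal_ennreal hm]
  have hFν : ∀ ν, Measurable fun y => F y ν := fun ν =>
    hF.comp (by fun_prop : Measurable fun y : Fin n → E => (y, ν))
  simp only [Pi.mul_apply]
  simp_rw [← lintegral_const_mul _ (hFν _)]
  exact lintegral_janossy_powKernel ω n (F := fun y ν => (f ν : ℝ≥0∞) * F y ν)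
    ((hf.comp measurable_snd).coe_nnreal_ennreal.mul hF)

theorem IsRM.lintegral_expNeg_mul_prod_gibbs [TopologicalSpace E] [MeasurableEq E]
    [MeasurableSingletonClass E] [IsFiniteMeasure ω] [NullSingletonClass ω] (hf : Measurable f)
    (hP : ∀ᵐ ν ∂((janossy ω).withDensity fun ν => (f ν : ℝ≥0∞)), IsSimplePointMeasure ν)
    {H : Measure ℝ≥0} [IsProbabilityMeasure H] {Q : Measure (Measure E)}
    (hQ : IsRM ((janossy ω).withDensity fun ν => (f ν : ℝ≥0∞)) H Q) {n : ℕ}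
    {C : Fin n → Set E} (hC : ∀ i, MeasurableSet (C i)) {h : E → ℝ≥0} (hh : Measurable h) :
    ∫⁻ μ, expNeg (∫⁻ z, h z ∂μ) * ∏ i, μ (C i) ∂Q =
      ∫⁻ y in Set.univ.pi C, kapProd H h y * zed ω f H h (distinctConfig y)
        ∂(meckeMeasure ω n) := by
  have hCm : MeasurableSet (Set.univ.pi C) := MeasurableSet.univ_pi hC
  have hW : Measurable fun y : Fin n → E => (Set.univ.pi C).indicator (kapRatio H h) y :=
    (measurable_kapRatio H hh n).indicator hCm
  rw [hQ.lintegral_expNeg_mul_prod hP hC hh]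
  simp_rw [← lintegral_indicator hCm]
  simp_rw [← lintegral_mul_const _ hW]
  rw [lintegral_gibbs_powKernel hf n
    (F := fun y ν => (Set.univ.pi C).indicator (kapRatio H h) y * gen H h ν)
    ((hW.comp measurable_fst).mul ((measurable_gen H hh).comp measurable_snd))]
  refine lintegral_congr fun y => ?_
  by_cases hy : y ∈ Set.univ.pi C
  · simp only [Set.indicator_of_mem hy]
    rw [zed, ← lintegral_const_mul _ (measurable_zed_integrand hf H hh _)]
    refine lintegral_congr fun ν => ?_
    rw [gen_add, ← kapRatio_mul_gen H hh y]
    ring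
  · simp [Set.indicator_of_notMem hy]

/-! ### Random measures driven by the posterior Gibbs process -/

lemma exists_isRM [Nonempty E] {g : Measure E → ℝ≥0∞} (hg : Measurable g)
    [IsProbabilityMeasure ((janossy ω).withDensity g)] (H : Measure ℝ≥0) :
    ∃ Q, IsRM ((janossy ω).withDensity g) H Q := by
  obtain ⟨ρ, h1, h2⟩ := exists_isMarking_enumeration ω hg
  exact ⟨_, _, ⟨ρ, h1, h2, rfl⟩, rfl⟩

section Psi

variable (H : Measure ℝ≥0)

lemma psi_eq (u : ℝ≥0) : psi H u = (kap H 0 u).toReal := by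
  unfold psi kap
  rw [← integral_toReal (measurable_kap_integrand_right 0 u).aemeasurable]
  · refine integral_congr_ae (Eventually.of_forall fun s => ?_)
    simp only [pow_zero, mul_one]
    rw [← ENNReal.coe_mul, expNeg_coe, ENNReal.toReal_ofReal (Real.exp_nonneg _), NNReal.coe_mul]
  · exact Eventually.of_forall fun s => by simpa using (expNeg_ne_top _).lt_top

lemma measurable_postWeight (hf : Measurable f) (u : ℝ) (ξ : Measure E) :
    Measurable (postWeight f H u ξ) := by
  unfold postWeight
  simp only [integral_const, smul_eq_mul, measureReal_def]
  refine Measurable.mul ?_ (hf.comp (measurable_id.add measurable_const))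
  exact ((Measure.measurable_coe MeasurableSet.univ).ennreal_toReal.mul_const _).exp.real_toNNReal

lemma IsPostRM.ae_isFiniteMeasure [TopologicalSpace E] {u : ℝ} {ξ : Measure E} {Q : Measure (Measure E)}
    (hQ : IsPostRM (janossy ω) f H u ξ Q) : ∀ᵐ μ ∂Q, IsFiniteMeasure μ := by
  obtain ⟨-, -, P', -, hR⟩ := hQ
  exact hR.ae_isFiniteMeasure

variable [IsProbabilityMeasure H]

lemma psi_pos (u : ℝ≥0) : 0 < psi H u := by
  rw [psi_eq]
  exact ENNReal.toReal_pos (kap_zero_ne_zero H u) (kap_zero_ne_top H u)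

lemma psi_le_one (u : ℝ≥0) : psi H u ≤ 1 := by
  rw [psi_eq]
  simpa using ENNReal.toReal_mono ENNReal.one_ne_top (kap_zero_le_one H u)

lemma ofReal_exp_integral_log_psi (u : ℝ≥0) (ν : Measure E) [IsFiniteMeasure ν] :
    ENNReal.ofReal (Real.exp (∫ _x, Real.log (psi H u) ∂ν)) = gen H (fun _ => u) ν := by
  rw [gen, lintegral_const, integral_const, smul_eq_mul, nlog, ← psi_eq,
    expNeg_of_ne_top (ENNReal.mul_ne_top ENNReal.ofReal_ne_top (measure_ne_top _ _)),
    ENNReal.toReal_mul, ENNReal.toReal_ofReal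
      (by simpa using Real.log_nonpos (psi_pos H u).le (psi_le_one H u)), measureReal_def]
  congr 2
  ring

lemma postWeight_eq (u : ℝ≥0) (ξ ν : Measure E) [IsFiniteMeasure ν] :
    (postWeight f H u ξ ν : ℝ≥0∞) = f (ν + ξ) * gen H (fun _ => u) ν := by
  rw [postWeight, ENNReal.coe_mul, mul_comm, ← ofReal_exp_integral_log_psi]
  rfl

lemma postConst_eq (u : ℝ≥0) (ξ : Measure E) :
    postConst (janossy ω) f H u ξ = zed ω f H (fun _ => u) ξ := by
  refine lintegral_congr_ae ?_
  filter_upwards [ae_janossy_isFiniteMeasure ω] with ν hν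
  rw [postWeight_eq]

instance isProbabilityMeasure_tiltedMark (u : ℝ≥0) : IsProbabilityMeasure (tiltedMark H u) := by
  refine isProbabilityMeasure_tilted ?_
  refine Integrable.of_bound (C := 1) ?_ (Eventually.of_forall fun s => ?_)
  · exact (by fun_prop : Measurable fun s : ℝ≥0 =>
      Real.exp (-((u : ℝ) * (s : ℝ)))).aestronglyMeasurable
  · rw [Real.norm_of_nonneg (Real.exp_nonneg _)]
    exact Real.exp_le_one_iff.2 (by simp; positivity)

lemma kap_tiltedMark (u t : ℝ≥0) : kap (tiltedMark H u) 0 t = kap H 0 (t + u) / kap H 0 u := by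
  have h0 : ∀ s : ℝ≥0, ENNReal.ofReal (Real.exp (-((u : ℝ) * (s : ℝ))) /
      ∫ x : ℝ≥0, Real.exp (-((u : ℝ) * (x : ℝ))) ∂H) = expNeg (u * s) * (kap H 0 u)⁻¹ := by
    intro s
    change ENNReal.ofReal (_ / psi H u) = _
    rw [ENNReal.ofReal_div_of_pos (psi_pos H u), psi_eq,
      ENNReal.ofReal_toReal (kap_zero_ne_top H u), ← ENNReal.coe_mul, expNeg_coe, NNReal.coe_mul,
      div_eq_mul_inv]
  unfold tiltedMark Measure.tilted
  simp_rw [h0]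
  rw [kap, lintegral_withDensity_eq_lintegral_mul _ (by fun_prop)
    (measurable_kap_integrand_right 0 t), div_eq_mul_inv, kap.eq_1 H 0 (t + u),
    ← lintegral_mul_const _ (measurable_kap_integrand_right 0 _)]
  refine lintegral_congr fun s => ?_
  simp only [Pi.mul_apply, pow_zero, mul_one, ENNReal.coe_add, add_mul, expNeg_add]
  ring

lemma nlog_tiltedMark (u t : ℝ≥0) : nlog (tiltedMark H u) t + nlog H u = nlog H (t + u) := by
  have hp : ∀ t, 0 < (kap H 0 t).toReal := fun t =>
    ENNReal.toReal_pos (kap_zero_ne_zero H t) (kap_zero_ne_top H t)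
  have h1 : (kap H 0 (t + u)).toReal ≤ (kap H 0 u).toReal :=
    ENNReal.toReal_mono (kap_zero_ne_top H _) (kap_anti H le_add_self)
  have h2 : (kap H 0 u).toReal ≤ 1 := by
    simpa using ENNReal.toReal_mono ENNReal.one_ne_top (kap_zero_le_one H u)
  rw [nlog, kap_tiltedMark, nlog, ← ENNReal.ofReal_add, nlog, ENNReal.toReal_div,
    Real.log_div (hp _).ne' (hp _).ne']
  · congr 1; ring
  · rw [ENNReal.toReal_div, Left.nonneg_neg_iff]
    exact Real.log_nonpos (by positivity) (div_le_one_of_le₀ h1 (hp u).le)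
  · rw [Left.nonneg_neg_iff]
    exact Real.log_nonpos (hp u).le h2

lemma gen_tiltedMark (u : ℝ≥0) (h : E → ℝ≥0) (ν : Measure E) :
    gen (tiltedMark H u) h ν * gen H (fun _ => u) ν = gen H (fun x => h x + u) ν := by
  rw [gen, gen, ← expNeg_add, ← lintegral_add_right _ measurable_const, gen]
  simp_rw [nlog_tiltedMark]

lemma postDensity_eq (u : ℝ≥0) {ξ : Measure E}
    (h0 : zed ω f H (fun _ => u) ξ ≠ 0) (htop : zed ω f H (fun _ => u) ξ ≠ ∞)
    (ν : Measure E) [IsFiniteMeasure ν] :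
    (postDensity (janossy ω) f H u ξ ν : ℝ≥0∞) =
      f (ν + ξ) * gen H (fun _ => u) ν / zed ω f H (fun _ => u) ξ := by
  rw [postDensity, postConst_eq, ENNReal.coe_div, postWeight_eq, ENNReal.coe_toNNReal htop]
  rw [Ne, ENNReal.toNNReal_eq_zero_iff]
  simp [h0, htop]

lemma withDensity_postDensity (u : ℝ≥0) {ξ : Measure E}
    (h0 : zed ω f H (fun _ => u) ξ ≠ 0) (htop : zed ω f H (fun _ => u) ξ ≠ ∞) :
    (janossy ω).withDensity (fun ν => (postDensity (janossy ω) f H u ξ ν : ℝ≥0∞)) =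
      (janossy ω).withDensity
        fun ν => f (ν + ξ) * gen H (fun _ => u) ν / zed ω f H (fun _ => u) ξ := by
  refine withDensity_congr_ae ?_
  filter_upwards [ae_janossy_isFiniteMeasure ω] with ν hν
  rw [postDensity_eq H u h0 htop]

lemma lintegral_gen_postDensity (hf : Measurable f) (u : ℝ≥0) {ξ : Measure E}
    (h0 : zed ω f H (fun _ => u) ξ ≠ 0) (htop : zed ω f H (fun _ => u) ξ ≠ ∞) {h : E → ℝ≥0}
    (hh : Measurable h) :
    ∫⁻ ν, gen (tiltedMark H u) h ν
      ∂((janossy ω).withDensity (fun ν => (postDensity (janossy ω) f H u ξ ν : ℝ≥0∞))) =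
      zed ω f H (fun x => h x + u) ξ / zed ω f H (fun _ => u) ξ := by
  have hm : Measurable fun ν : Measure E =>
      f (ν + ξ) * gen H (fun _ => u) ν / zed ω f H (fun _ => u) ξ :=
    (measurable_zed_integrand hf H measurable_const ξ).div_const _
  rw [withDensity_postDensity H u h0 htop, lintegral_withDensity_eq_lintegral_mul _
    hm (measurable_gen _ hh), div_eq_mul_inv, zed.eq_1 _ _ _ (fun x => h x + u),
    ← lintegral_mul_const _ (measurable_zed_integrand hf H (hh.add_const u) ξ)]
  refine lintegral_congr fun ν => ?_
  simp only [Pi.mul_apply]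
  rw [← gen_tiltedMark H u h]
  simp only [div_eq_mul_inv]
  ring

variable [TopologicalSpace E]

lemma isGibbs_postDensity
    (hs : ∀ᵐ ν ∂(janossy ω), IsSimplePointMeasure ν) (hf : Measurable f) (u : ℝ≥0) {ξ : Measure E}
    (h0 : zed ω f H (fun _ => u) ξ ≠ 0) (htop : zed ω f H (fun _ => u) ξ ≠ ∞) :
    IsGibbs (janossy ω) (postDensity (janossy ω) f H u ξ)
      ((janossy ω).withDensity (fun ν => (postDensity (janossy ω) f H u ξ ν : ℝ≥0∞))) := by
  have hm : Measurable (postDensity (janossy ω) f H u ξ) :=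
    (measurable_postWeight H hf u ξ).div_const _
  refine ⟨hm, ⟨⟨?_⟩, (withDensity_absolutelyContinuous _ _).ae_le hs⟩, rfl⟩
  rw [withDensity_postDensity H u h0 htop, withDensity_apply _ MeasurableSet.univ,
    Measure.restrict_univ]
  simp only [div_eq_mul_inv]
  rw [lintegral_mul_const _ (measurable_zed_integrand hf H measurable_const ξ)]
  exact ENNReal.mul_inv_cancel h0 htop

lemma exists_isPostRM [Nonempty E]
    (hs : ∀ᵐ ν ∂(janossy ω), IsSimplePointMeasure ν) (hf : Measurable f) (u : ℝ≥0) {ξ : Measure E}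
    (h0 : zed ω f H (fun _ => u) ξ ≠ 0) (htop : zed ω f H (fun _ => u) ξ ≠ ∞) :
    ∃ Q, IsPostRM (janossy ω) f H u ξ Q := by
  have hG := isGibbs_postDensity H hs hf u h0 htop
  have := hG.isPointProcess.isProbabilityMeasure
  obtain ⟨Q, hQ⟩ := exists_isRM (ω := ω) hG.measurable_density.coe_nnreal_ennreal (tiltedMark H u)
  exact ⟨Q, by rwa [postConst_eq], by rwa [postConst_eq], _, hG, hQ⟩

lemma IsPostRM.isProbabilityMeasure {u : ℝ≥0} {ξ : Measure E} {Q : Measure (Measure E)}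
    (hQ : IsPostRM (janossy ω) f H u ξ Q) : IsProbabilityMeasure Q := by
  obtain ⟨-, -, P', -, hR⟩ := hQ
  exact hR.isProbabilityMeasure

lemma IsPostRM.lap_eq [MeasurableEq E] [MeasurableSingletonClass E] (hf : Measurable f) {u : ℝ≥0}
    {ξ : Measure E} {Q : Measure (Measure E)} (hQ : IsPostRM (janossy ω) f H u ξ Q) {h : E → ℝ≥0}
    (hh : Measurable h) :
    lap Q h = zed ω f H (fun x => h x + u) ξ / zed ω f H (fun _ => u) ξ := by
  obtain ⟨h0, htop, P', hG, hR⟩ := hQ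
  rw [postConst_eq] at h0 htop
  rw [hR.lap_eq hG.isPointProcess.ae_isSimple hh, hG.eq_withDensity,
    lintegral_gen_postDensity H hf u h0 htop hh]

end Psi

end Gibbs

/-! ### Reduced Palm distributions of Gibbs processes -/

section Palm

variable {E : Type*} [MeasurableSpace E] {ω : Measure E} {f : Measure E → ℝ≥0}

lemma expNeg_mul_pow_le (x : ℝ≥0∞) (m : ℕ) : expNeg x * x ^ m ≤ m.factorial := by
  by_cases hx : x = ∞
  · simp [hx]
  lift x to ℝ≥0 using hx
  rw [expNeg_coe, ← ENNReal.ofReal_coe_nnreal (p := x), ← ENNReal.ofReal_pow x.coe_nonneg,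
    ← ENNReal.ofReal_mul (Real.exp_nonneg _), ← ENNReal.ofReal_natCast]
  refine ENNReal.ofReal_le_ofReal ?_
  have := Real.pow_div_factorial_le_exp x x.coe_nonneg m
  rw [div_le_iff₀ (by positivity)] at this
  rw [Real.exp_neg, inv_mul_le_iff₀ (Real.exp_pos _)]
  exact this

lemma measurableSet_injective [MeasurableEq E] (k : ℕ) :
    MeasurableSet {y : Fin k → E | Function.Injective y} := by
  have : {y : Fin k → E | Function.Injective y} =
      ⋂ i, ⋂ j, {y | y i = y j → i = j} := by
    ext y; simp [Function.Injective]
  rw [this]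
  refine MeasurableSet.iInter fun i => MeasurableSet.iInter fun j => ?_
  by_cases hij : i = j
  · simp [hij]
  · simp only [hij, imp_false]
    exact (measurableSet_eq_fun (measurable_pi_apply i) (measurable_pi_apply j)).compl

lemma pi_eq_powKernel (k : ℕ) (ν : Measure E) [IsFiniteMeasure ν] :
    (Measure.pi fun _ : Fin k => ν) = powKernel k ν := by
  rw [powKernel_apply, trunc_eq]

lemma measurable_add_measure (ξ : Measure E) : Measurable fun ν : Measure E => ν + ξ :=
  measurable_id.add measurable_const

variable [MeasurableEq E] [IsFiniteMeasure ω] [NullSingletonClass ω]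

lemma momentMeasure_gibbs (hf : Measurable f) (k : ℕ) :
    momentMeasure ((janossy ω).withDensity fun ν => (f ν : ℝ≥0∞)) k =
      (meckeMeasure ω k).withDensity fun y => palmDensity ω f (distinctConfig y) := by
  have hfin : ∀ᵐ ν ∂((janossy ω).withDensity fun ν => (f ν : ℝ≥0∞)), IsFiniteMeasure ν :=
    (withDensity_absolutelyContinuous _ _).ae_le (ae_janossy_isFiniteMeasure ω)
  have h1 : momentMeasure ((janossy ω).withDensity fun ν => (f ν : ℝ≥0∞)) k =
      ((janossy ω).withDensity fun ν => (f ν : ℝ≥0∞)).bind (powKernel k) := by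
    refine Measure.bind_congr_right ?_
    filter_upwards [hfin] with ν hν
    exact pi_eq_powKernel k ν
  ext B hB
  rw [h1, Measure.bind_apply hB (powKernel k).measurable.aemeasurable, withDensity_apply _ hB,
    ← lintegral_indicator hB]
  have h2 := lintegral_gibbs_powKernel (ω := ω) hf k (F := fun y _ => B.indicator 1 y)
    ((measurable_one.indicator hB).comp measurable_fst)
  simp only [lintegral_indicator_one hB] at h2
  rw [h2]
  refine lintegral_congr fun y => ?_
  by_cases hy : y ∈ B <;> simp [hy, palmDensity]

/-- The defining identity of reduced Palm distributions, for functions of the configuration. -/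
lemma IsReducedPalm.ae_lintegral_eq (hf : Measurable f) {k : ℕ}
    {R : Kernel (Fin k → E) (Measure E)}
    (hR : IsReducedPalm ((janossy ω).withDensity fun ν => (f ν : ℝ≥0∞)) k R)
    {φ : Measure E → ℝ≥0∞} (hφ : Measurable φ) :
    ∀ᵐ y ∂(meckeMeasure ω k), Function.Injective y →
      palmDensity ω f (distinctConfig y) * ∫⁻ ν, φ (ν + distinctConfig y) ∂(R y) =
        ∫⁻ ν, (f (ν + distinctConfig y) : ℝ≥0∞) * φ (ν + distinctConfig y) ∂(janossy ω) := by
  obtain ⟨hRm, hR⟩ := hR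
  set P := (janossy ω).withDensity fun ν => (f ν : ℝ≥0∞) with hP
  have hfin : ∀ᵐ ν ∂P, IsFiniteMeasure ν :=
    (withDensity_absolutelyContinuous _ _).ae_le (ae_janossy_isFiniteMeasure ω)
  have hadd : Measurable fun p : (Fin k → E) × Measure E => p.2 + distinctConfig p.1 :=
    measurable_snd.add ((measurable_distinctConfig k).comp measurable_fst)
  have hS : Measurable fun y : Fin k → E => (R y).map fun ν => ν + distinctConfig y := by
    refine Measure.measurable_of_measurable_coe _ fun L hL => ?_
    have : ∀ y : Fin k → E, (R y).map (fun ν => ν + distinctConfig y) L =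
        R y (Prod.mk y ⁻¹' ((fun p : (Fin k → E) × Measure E => p.2 + distinctConfig p.1) ⁻¹' L)) :=
      fun y => Measure.map_apply (measurable_add_measure _) hL
    simp_rw [this]
    exact Kernel.measurable_kernel_prodMk_left (hadd hL)
  have key : ∀ B : Set (Fin k → E), MeasurableSet B → (∀ y ∈ B, Function.Injective y) →
      ∫⁻ ν, powKernel k ν B * φ ν ∂P =
        ∫⁻ y in B, ∫⁻ ν, φ (ν + distinctConfig y) ∂(R y) ∂(momentMeasure P k) := by
    intro B hB hBinj
    have hμ : P.withDensity (fun ν => powKernel k ν B) =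
        ((momentMeasure P k).restrict B).bind
          (fun y => (R y).map fun ν => ν + distinctConfig y) := by
      ext L hL
      rw [withDensity_apply _ hL, Measure.bind_apply hL hS.aemeasurable]
      have h1 := hR B L hB hL hBinj
      rw [campbell] at h1
      have h2 : ∫⁻ ν in L, powKernel k ν B ∂P =
          ∫⁻ ν in L, (Measure.pi fun _ : Fin k => ν) B ∂P := by
        refine lintegral_congr_ae (ae_restrict_of_ae ?_)
        filter_upwards [hfin] with ν hν
        rw [pi_eq_powKernel]
      rw [h2, h1]
      refine setLIntegral_congr_fun hB fun y hy => ?_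
      rw [Measure.map_apply (measurable_add_measure _) hL,
        distinctConfig_of_injective (hBinj y hy)]
      rfl
    have h3 := congrArg (fun μ => ∫⁻ ν, φ ν ∂μ) hμ
    beta_reduce at h3
    rw [lintegral_withDensity_eq_lintegral_mul _ ((powKernel k).measurable_coe hB) hφ,
      Measure.lintegral_bind hS.aemeasurable hφ.aemeasurable] at h3
    simp only [Pi.mul_apply] at h3
    rw [h3]
    exact lintegral_congr fun y => lintegral_map hφ (measurable_add_measure _)
  have hm1 : Measurable fun y : Fin k → E => ∫⁻ ν, φ (ν + distinctConfig y) ∂(R y) :=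
    (hφ.comp hadd).lintegral_kernel_prod_right'
  have hm2 : Measurable fun p : (Fin k → E) × Measure E =>
      (f (p.2 + distinctConfig p.1) : ℝ≥0∞) * φ (p.2 + distinctConfig p.1) :=
    (measurable_gibbs hf k).mul (hφ.comp hadd)
  have hp := measurable_palmDensity (ω := ω) hf k
  have hI := measurableSet_injective (E := E) k
  refine (ae_restrict_iff' hI).1 ?_
  refine ae_eq_of_forall_setLIntegral_eq_of_sigmaFinite (hp.mul hm1)
    hm2.lintegral_prod_right' fun s hs _ => ?_
  rw [Measure.restrict_restrict hs]
  have hB : MeasurableSet (s ∩ {y | Function.Injective y}) := hs.inter hI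
  have h4 := key _ hB fun y hy => hy.2
  rw [momentMeasure_gibbs hf, restrict_withDensity hB,
    lintegral_withDensity_eq_lintegral_mul _ hp hm1] at h4
  refine h4.symm.trans ?_
  have h5 := lintegral_gibbs_powKernel (ω := ω) hf k
    (F := fun y ν => (s ∩ {y | Function.Injective y}).indicator 1 y * φ ν)
    (((measurable_one.indicator hB).comp measurable_fst).mul (hφ.comp measurable_snd))
  simp_rw [lintegral_mul_const _ (measurable_one.indicator hB : Measurable
    ((s ∩ {y | Function.Injective y}).indicator (1 : (Fin k → E) → ℝ≥0∞))),
    lintegral_indicator_one hB] at h5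
  rw [h5, ← lintegral_indicator hB]
  refine lintegral_congr fun y => ?_
  by_cases hy : y ∈ s ∩ {y | Function.Injective y}
  · simp only [Set.indicator_of_mem hy, Pi.one_apply, one_mul]
  · simp only [Set.indicator_of_notMem hy, zero_mul, mul_zero, lintegral_zero]

/-- The reduced Palm distributions of a Gibbs process are Gibbs. -/
theorem IsReducedPalm.ae_eq_withDensity [MeasurableSpace.CountablyGenerated E]
    (hf : Measurable f) [IsProbabilityMeasure ((janossy ω).withDensity fun ν => (f ν : ℝ≥0∞))]
    {k : ℕ} {R : Kernel (Fin k → E) (Measure E)}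
    (hR : IsReducedPalm ((janossy ω).withDensity fun ν => (f ν : ℝ≥0∞)) k R) :
    ∀ᵐ y ∂(momentMeasure ((janossy ω).withDensity fun ν => (f ν : ℝ≥0∞)) k),
      Function.Injective y → palmDensity ω f (pointSum y) ≠ 0 ∧ palmDensity ω f (pointSum y) ≠ ∞ ∧
        R y = (janossy ω).withDensity
          fun ν => (f (ν + pointSum y) : ℝ≥0∞) / palmDensity ω f (pointSum y) := by
  have hRm := hR.1
  rw [momentMeasure_gibbs hf, ae_withDensity_iff (measurable_palmDensity hf k)]
  have hinf : Measurable fun ν : Measure E =>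
      {ν : Measure E | IsFiniteMeasure ν}ᶜ.indicator (1 : Measure E → ℝ≥0∞) ν :=
    measurable_one.indicator measurableSet_isFiniteMeasure.compl
  have hexp : Measurable fun ν : Measure E => expNeg (ν Set.univ) :=
    measurable_expNeg.comp (Measure.measurable_coe MeasurableSet.univ)
  have htest : ∀ t : ℕ →₀ ℕ, Measurable fun ν : Measure E => expNeg (∫⁻ x, testFun t x ∂ν) :=
    fun t => measurable_expNeg_lintegral (measurable_testFun t)
  have hfinite : ∀ᵐ y ∂(meckeMeasure ω k), ∫⁻ ν, (f (ν + distinctConfig y) : ℝ≥0∞) *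
      expNeg ((ν + distinctConfig y) Set.univ) ∂(janossy ω) ≠ ∞ := by
    have h1 := lintegral_gibbs_powKernel (ω := ω) hf k (F := fun _ ν => expNeg (ν Set.univ))
      (hexp.comp measurable_snd)
    have h2 : ∫⁻ ν, ∫⁻ _y : Fin k → E, expNeg (ν Set.univ) ∂(powKernel k ν)
        ∂((janossy ω).withDensity fun ν => (f ν : ℝ≥0∞)) ≠ ∞ := by
      refine ne_top_of_le_ne_top (b := (k.factorial : ℝ≥0∞)) (by simp) ?_
      refine (lintegral_mono_ae (g := fun _ => (k.factorial : ℝ≥0∞)) ?_).trans (by simp)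
      filter_upwards [(withDensity_absolutelyContinuous _ _).ae_le
        (ae_janossy_isFiniteMeasure ω)] with ν hν
      rw [lintegral_const, powKernel_apply, Measure.pi_univ, trunc_eq]
      simpa using expNeg_mul_pow_le (ν Set.univ) k
    rw [h1] at h2
    have h3 : Measurable fun p : (Fin k → E) × Measure E => (f (p.2 + distinctConfig p.1) : ℝ≥0∞) *
      expNeg ((p.2 + distinctConfig p.1) Set.univ) :=
      (measurable_gibbs hf k).mul (hexp.comp (measurable_snd.add
        ((measurable_distinctConfig k).comp measurable_fst)))
    filter_upwards [ae_lt_top h3.lintegral_prod_right' h2] with y hy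
    exact hy.ne
  filter_upwards [hR.ae_lintegral_eq hf hinf, hR.ae_lintegral_eq hf hexp, hfinite,
    ae_all_iff.2 fun t => hR.ae_lintegral_eq hf (htest t)] with y h1 h2 h3 h4 hp0 hinj
  specialize h1 hinj
  specialize h2 hinj
  rw [← distinctConfig_of_injective hinj]
  set ξ := distinctConfig y with hξ
  have hRfin : ∀ᵐ ν ∂(R y), IsFiniteMeasure ν := by
    have h5 : ∫⁻ ν, (f (ν + ξ) : ℝ≥0∞) *
        {ν : Measure E | IsFiniteMeasure ν}ᶜ.indicator 1 (ν + ξ) ∂(janossy ω) = 0 := by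
      rw [lintegral_eq_zero_iff]
      · filter_upwards [ae_janossy_isFiniteMeasure ω] with ν hν
        have : ν + ξ ∈ {ν : Measure E | IsFiniteMeasure ν} := by
          change IsFiniteMeasure (ν + ξ); infer_instance
        simp [this]
      · exact (measurable_add_config hf ξ).mul (hinf.comp (measurable_add_measure _))
    rw [h5] at h1
    have h6 := (mul_eq_zero.1 h1).resolve_left hp0
    have h7 : Measurable fun ν : Measure E =>
        {ν : Measure E | IsFiniteMeasure ν}ᶜ.indicator (1 : Measure E → ℝ≥0∞) (ν + ξ) :=
      hinf.comp (measurable_add_measure ξ)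
    rw [lintegral_eq_zero_iff h7] at h6
    filter_upwards [h6] with ν hν
    by_contra h7
    have h8 : ν + ξ ∈ {ν : Measure E | IsFiniteMeasure ν}ᶜ := by
      intro h9
      have h9' : IsFiniteMeasure (ν + ξ) := h9
      exact h7 (isFiniteMeasure_of_le (ν + ξ) (Measure.le_add_right le_rfl))
    simp [Set.indicator_of_mem h8] at hν
  have hptop : palmDensity ω f ξ ≠ ∞ := by
    intro htop
    rw [htop] at h2
    have h5 : ∫⁻ ν, expNeg ((ν + ξ) Set.univ) ∂(R y) ≠ 0 := by
      have h7 : Measurable fun ν : Measure E => expNeg ((ν + ξ) Set.univ) :=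
        hexp.comp (measurable_add_measure ξ)
      rw [Ne, lintegral_eq_zero_iff h7]
      intro h6
      obtain ⟨ν, h7, h8⟩ := (h6.and hRfin).exists
      exact (expNeg_pos (measure_ne_top (ν + ξ) Set.univ)).ne' h7
    rw [ENNReal.top_mul h5] at h2
    exact h3 h2.symm
  refine ⟨hp0, hptop, ?_⟩
  have hm := measurable_add_config hf ξ
  have hdens : IsProbabilityMeasure
      ((janossy ω).withDensity fun ν => (f (ν + ξ) : ℝ≥0∞) / palmDensity ω f ξ) := by
    refine ⟨?_⟩
    rw [withDensity_apply _ MeasurableSet.univ, Measure.restrict_univ]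
    simp only [div_eq_mul_inv]
    rw [lintegral_mul_const _ hm]
    exact ENNReal.mul_inv_cancel hp0 hptop
  refine ext_of_lap_eq hRfin ((withDensity_absolutelyContinuous _ _).ae_le
    (ae_janossy_isFiniteMeasure ω)) fun t => ?_
  have h5 := h4 t hinj
  have h6 : expNeg (∫⁻ x, testFun t x ∂ξ) ≠ 0 := by
    refine (expNeg_pos ?_).ne'
    rw [lintegral_testFun]
    exact ENNReal.sum_ne_top.2 fun i _ => ENNReal.mul_ne_top (by simp) (measure_ne_top _ _)
  simp_rw [lintegral_add_measure, expNeg_add, ← mul_assoc] at h5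
  have h7 : Measurable fun ν : Measure E =>
      (f (ν + ξ) : ℝ≥0∞) * expNeg (∫⁻ x, testFun t x ∂ν) := hm.mul (htest t)
  rw [lintegral_mul_const _ (htest t), lintegral_mul_const _ h7, ← mul_assoc,
    ENNReal.mul_left_inj h6 (expNeg_ne_top _)] at h5
  rw [lap, lap, lintegral_withDensity_eq_lintegral_mul _ (hm.div_const _) (htest t)]
  rw [← ENNReal.mul_right_inj hp0 hptop, h5,
    ← lintegral_const_mul _ ((hm.div_const _).mul (htest t))]
  refine lintegral_congr fun ν => ?_
  simp only [Pi.mul_apply]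
  rw [← mul_assoc, ENNReal.mul_div_cancel hp0 hptop]

end Palm

/-! ### The posterior Laplace functional -/

section Posterior

variable {E : Type*} [MeasurableSpace E]

lemma laplaceFunctional_eq {Q : Measure (Measure E)} (hQ : ∀ᵐ μ ∂Q, IsFiniteMeasure μ) {g : E → ℝ}
    (hg : Measurable g) (h0 : ∀ x, 0 ≤ g x) (hb : ∃ c, ∀ x, g x ≤ c) :
    laplaceFunctional Q g = (lap Q fun x => (g x).toNNReal).toReal := by
  obtain ⟨c, hc⟩ := hb
  rw [lap, laplaceFunctional, ← integral_toReal
    (measurable_expNeg_lintegral hg.real_toNNReal).aemeasurable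
    (Eventually.of_forall fun _ => (expNeg_ne_top _).lt_top)]
  refine integral_congr_ae ?_
  filter_upwards [hQ] with μ hμ
  have hfin : ∫⁻ x, ((g x).toNNReal : ℝ≥0∞) ∂μ ≠ ∞ := by
    refine ne_top_of_le_ne_top (b := ENNReal.ofReal c * μ Set.univ)
      (ENNReal.mul_ne_top ENNReal.ofReal_ne_top (measure_ne_top _ _)) ?_
    refine (lintegral_mono (g := fun _ => ENNReal.ofReal c) fun x => ?_).trans (by simp)
    exact ENNReal.ofReal_le_ofReal (hc x)
  rw [toReal_expNeg hfin, integral_eq_lintegral_of_nonneg_ae (Eventually.of_forall h0)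
    hg.aestronglyMeasurable]
  rfl

lemma testFun_le [MeasurableSpace.CountablyGenerated E] (t : ℕ →₀ ℕ) (x : E) :
    testFun t x ≤ ∑ i ∈ t.support, (t i : ℝ≥0) := by
  refine Finset.sum_le_sum fun i _ => ?_
  by_cases h : x ∈ genSeq E i <;> simp [h]

variable {ω : Measure E} {f : Measure E → ℝ≥0}

lemma IsRM.lap_eq_zed_div [TopologicalSpace E] [MeasurableEq E] [MeasurableSingletonClass E]
    (hs : ∀ᵐ ν ∂(janossy ω), IsSimplePointMeasure ν) (hf : Measurable f) {H : Measure ℝ≥0}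
    [IsProbabilityMeasure H] {ξ : Measure E} {c : ℝ≥0∞} {Q : Measure (Measure E)}
    (hQ : IsRM ((janossy ω).withDensity fun ν => (f (ν + ξ) : ℝ≥0∞) / c) H Q) {h : E → ℝ≥0}
    (hh : Measurable h) : lap Q h = zed ω f H h ξ / c := by
  rw [hQ.lap_eq ((withDensity_absolutelyContinuous _ _).ae_le hs) hh,
    lintegral_withDensity_eq_lintegral_mul _ ((measurable_add_config hf ξ).div_const _)
      (measurable_gen H hh), div_eq_mul_inv, zed,
    ← lintegral_mul_const _ (measurable_zed_integrand hf H hh ξ)]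
  refine lintegral_congr fun ν => ?_
  simp only [Pi.mul_apply, div_eq_mul_inv]
  ring

/-- The random finite measure whose Laplace functional is that of the reduced Palm version of `μ̃`,
shifted by `u` and normalised, is the random measure driven by the posterior Gibbs process. -/
theorem posterior_laplaceFunctional [TopologicalSpace E] [MeasurableEq E]
    [MeasurableSpace.CountablyGenerated E] [MeasurableSingletonClass E] [IsFiniteMeasure ω]
    [NullSingletonClass ω]
    (hs : ∀ᵐ ν ∂(janossy ω), IsSimplePointMeasure ν) (hf : Measurable f)
    [IsProbabilityMeasure ((janossy ω).withDensity fun ν => (f ν : ℝ≥0∞))]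
    (H : Measure ℝ≥0) [IsProbabilityMeasure H] {k : ℕ} (hk : 0 < k)
    {R : Kernel (Fin k → E) (Measure E)}
    (hR : IsReducedPalm ((janossy ω).withDensity fun ν => (f ν : ℝ≥0∞)) k R) :
    ∀ᵐ y ∂(momentMeasure ((janossy ω).withDensity fun ν => (f ν : ℝ≥0∞)) k),
      Function.Injective y → ∀ u : ℝ, 0 < u →
        (∃ Qr, IsRM (R y) H Qr) ∧
        (∃ Qη, IsPostRM (janossy ω) f H u (pointSum y) Qη) ∧
        ∀ Qr Qη : Measure (Measure E), IsRM (R y) H Qr →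
          IsPostRM (janossy ω) f H u (pointSum y) Qη →
          ∀ Q' : Measure (Measure E), IsProbabilityMeasure Q' →
            (∀ᵐ μ ∂Q', IsFiniteMeasure μ) →
            ((∀ g : E → ℝ, Measurable g → (∀ x, 0 ≤ g x) → (∃ c, ∀ x, g x ≤ c) →
                laplaceFunctional Q' g =
                  laplaceFunctional Qr (fun x => g x + u) / laplaceFunctional Qr (fun _ => u)) ↔
              Q' = Qη) := by
  filter_upwards [hR.ae_eq_withDensity hf] with y hy hinj u hu
  obtain ⟨hp0, hptop, hRy⟩ := hy hinj
  have hRprob := hR.1.isProbabilityMeasure y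
  lift u to ℝ≥0 using hu.le
  set ξ := pointSum y
  have hne : Nonempty E := ⟨y ⟨0, hk⟩⟩
  have hz0 : ∀ h : E → ℝ≥0, Measurable h → zed ω f H h ξ ≠ 0 := fun h hh =>
    zed_ne_zero hf H hh hp0
  have hztop : ∀ h : E → ℝ≥0, zed ω f H h ξ ≠ ∞ := fun h =>
    ne_top_of_le_ne_top hptop (zed_le_palmDensity H h ξ)
  refine ⟨?_, exists_isPostRM H hs hf u (hz0 _ measurable_const) (hztop _), ?_⟩
  · rw [hRy] at hRprob ⊢
    exact exists_isRM ((measurable_add_config hf ξ).div_const _) H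
  intro Qr Qη hQr hQη Q' hQ' hQ'fin
  have hQηp := hQη.isProbabilityMeasure
  have hratio : ∀ g : E → ℝ, Measurable g → (∀ x, 0 ≤ g x) → (∃ c, ∀ x, g x ≤ c) →
      laplaceFunctional Qr (fun x => g x + u) / laplaceFunctional Qr (fun _ => u) =
        (lap Qη fun x => (g x).toNNReal).toReal := by
    intro g hg h0 ⟨c, hc⟩
    have hfin := hQr.ae_isFiniteMeasure
    rw [laplaceFunctional_eq hfin (hg.add_const _) (fun x => add_nonneg (h0 x) u.coe_nonneg)
        ⟨c + u, fun x => by simpa using hc x⟩,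
      laplaceFunctional_eq hfin measurable_const (fun _ => u.coe_nonneg) ⟨u, fun _ => le_rfl⟩,
      hQη.lap_eq H hf hg.real_toNNReal]
    rw [hRy] at hQr
    have h1 : (fun x => (g x + (u : ℝ)).toNNReal) = fun x => (g x).toNNReal + u := by
      ext1 x
      rw [Real.toNNReal_add (h0 x) u.coe_nonneg, Real.toNNReal_coe]
    simp only [h1, Real.toNNReal_coe]
    rw [hQr.lap_eq_zed_div hs hf (hg.real_toNNReal.add_const u),
      hQr.lap_eq_zed_div hs hf measurable_const]
    simp only [ENNReal.toReal_div]
    exact div_div_div_cancel_right₀ (ENNReal.toReal_ne_zero.2 ⟨hp0, hptop⟩) _ _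
  refine ⟨fun h => ext_of_lap_eq hQ'fin hQη.ae_isFiniteMeasure fun t => ?_, ?_⟩
  · have hm : Measurable fun x : E => (testFun t x : ℝ) := (measurable_testFun t).coe_nnreal_real
    have hb : ∃ c, ∀ x : E, (testFun t x : ℝ) ≤ c :=
      ⟨(∑ i ∈ t.support, (t i : ℝ≥0) : ℝ≥0), fun x => NNReal.coe_le_coe.2 (testFun_le t x)⟩
    have h1 := h _ hm (fun x => NNReal.coe_nonneg _) hb
    rw [hratio _ hm (fun x => NNReal.coe_nonneg _) hb,
      laplaceFunctional_eq hQ'fin hm (fun x => NNReal.coe_nonneg _) hb] at h1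
    simp only [Real.toNNReal_coe] at h1
    exact (ENNReal.toReal_eq_toReal_iff' (lap_ne_top _ _) (lap_ne_top _ _)).1 h1
  · rintro rfl g hg h0 hb
    rw [hratio g hg h0 hb, laplaceFunctional_eq hQ'fin hg h0 hb]

end Posterior

/-! ### The law of the posterior jumps -/

section PosteriorLaw

variable {E : Type*} [MeasurableSpace E]

lemma lintegral_pi_prod {ι : Type*} [Fintype ι] {X : Type*} [MeasurableSpace X]
    (P : ι → Measure X) [∀ i, IsProbabilityMeasure (P i)] {φ : ι → X → ℝ≥0∞}
    (hφ : ∀ i, Measurable (φ i)) :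
    ∫⁻ s, ∏ i, φ i (s i) ∂(Measure.pi P) = ∏ i, ∫⁻ s, φ i s ∂(P i) := by
  rw [← Measure.infinitePi_eq_pi, lintegral_prod_eq_prod_lintegral_of_indepFun Finset.univ _
    (iIndepFun_infinitePi (P := P) hφ) (fun i => (hφ i).comp (measurable_pi_apply i))]
  exact Finset.prod_congr rfl fun i _ =>
    (measurePreserving_eval_infinitePi P i).lintegral_comp (hφ i)

variable (H : Measure ℝ≥0)

lemma jumpLaw_eq (u : ℝ≥0) (m : ℕ) : jumpLaw H u m = (kap H m u)⁻¹ •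
    H.withDensity fun s : ℝ≥0 => expNeg ((u : ℝ≥0∞) * s) * (s : ℝ≥0∞) ^ m := by
  have h : ∀ s : ℝ≥0, ENNReal.ofReal (Real.exp (-((u : ℝ) * (s : ℝ))) * (s : ℝ) ^ m) =
      expNeg ((u : ℝ≥0∞) * s) * (s : ℝ≥0∞) ^ m := by
    intro s
    rw [ENNReal.ofReal_mul (Real.exp_nonneg _), ENNReal.ofReal_pow s.coe_nonneg,
      ENNReal.ofReal_coe_nnreal, ← ENNReal.coe_mul, expNeg_coe, NNReal.coe_mul]
  unfold jumpLaw
  simp_rw [h]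
  rfl

lemma lintegral_expNeg_jumpLaw (u t : ℝ≥0) (m : ℕ) :
    ∫⁻ s : ℝ≥0, expNeg ((s : ℝ≥0∞) * t) ∂(jumpLaw H u m) = kap H m (t + u) / kap H m u := by
  rw [jumpLaw_eq, lintegral_smul_measure, lintegral_withDensity_eq_lintegral_mul _
    (measurable_kap_integrand_right m u) (by fun_prop), smul_eq_mul, ENNReal.div_eq_inv_mul,
    kap.eq_1 H m (t + u)]
  congr 1
  refine lintegral_congr fun s => ?_
  simp only [Pi.mul_apply, ENNReal.coe_add, add_mul, expNeg_add]
  rw [mul_comm (t : ℝ≥0∞) s]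
  ring

variable [IsProbabilityMeasure H]

lemma kapProd_ne_zero {E : Type*} (hH : H {0} = 0) (h : E → ℝ≥0) {n : ℕ} (y : Fin n → E) :
    kapProd H h y ≠ 0 :=
  Finset.prod_ne_zero_iff.2 fun _ _ => kap_ne_zero H (Or.inr hH) _

lemma kapProd_ne_top {E : Type*} {u : ℝ≥0} (hu : u ≠ 0) {n : ℕ} (y : Fin n → E) :
    kapProd H (fun _ => u) y ≠ ∞ :=
  ENNReal.prod_ne_top fun _ _ => kap_ne_top H hu _

lemma isProbabilityMeasure_jumpLaw (hH : H {0} = 0) {u : ℝ≥0} (hu : u ≠ 0) (m : ℕ) :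
    IsProbabilityMeasure (jumpLaw H u m) := by
  refine ⟨?_⟩
  have := lintegral_expNeg_jumpLaw H u 0 m
  simp only [ENNReal.coe_zero, mul_zero, expNeg_zero, lintegral_one, zero_add] at this
  rw [this, ENNReal.div_self (kap_ne_zero H (Or.inr hH) u) (kap_ne_top H hu m)]

lemma measurable_posterior_map {n : ℕ} (y : Fin n → E) :
    Measurable fun p : ({x // x ∈ distinctValues y} → ℝ≥0) × Measure E =>
      (∑ x : {x // x ∈ distinctValues y}, (p.1 x : ℝ≥0∞) • Measure.dirac (x : E)) + p.2 := by
  refine Measurable.add (measurable_finsetSum_measure _ fun x _ => ?_) measurable_snd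
  exact Measurable.smul_measure (f := fun p : ({x // x ∈ distinctValues y} → ℝ≥0) × Measure E =>
    (p.1 x : ℝ≥0∞)) (by fun_prop) _

lemma isProbabilityMeasure_posteriorLaw (hH : H {0} = 0) {u : ℝ≥0} (hu : u ≠ 0) {n : ℕ}
    (y : Fin n → E) (Q : Measure (Measure E)) [IsProbabilityMeasure Q] :
    IsProbabilityMeasure (posteriorLaw H y u Q) := by
  have := isProbabilityMeasure_jumpLaw H hH hu
  exact Measure.isProbabilityMeasure_map (measurable_posterior_map y).aemeasurable

lemma ae_posteriorLaw_isFiniteMeasure (hH : H {0} = 0) {u : ℝ≥0} (hu : u ≠ 0) {n : ℕ}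
    (y : Fin n → E) {Q : Measure (Measure E)} [IsProbabilityMeasure Q]
    (hQ : ∀ᵐ μ ∂Q, IsFiniteMeasure μ) : ∀ᵐ μ ∂(posteriorLaw H y u Q), IsFiniteMeasure μ := by
  have := isProbabilityMeasure_jumpLaw H hH hu
  rw [posteriorLaw, ae_map_iff (measurable_posterior_map y).aemeasurable
    measurableSet_isFiniteMeasure]
  have h2 : ∀ᵐ p ∂((Measure.pi fun x : {x // x ∈ distinctValues y} =>
      jumpLaw H u (multiplicity y x)).prod Q), IsFiniteMeasure p.2 :=
    Measure.quasiMeasurePreserving_snd.ae hQ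
  filter_upwards [h2] with p hp
  have h3 : ∀ x : {x // x ∈ distinctValues y},
      IsFiniteMeasure ((p.1 x : ℝ≥0∞) • Measure.dirac (x : E)) := fun x =>
    Measure.smul_finite _ ENNReal.coe_ne_top
  have h4 : IsFiniteMeasure (∑ x : {x // x ∈ distinctValues y},
      (p.1 x : ℝ≥0∞) • Measure.dirac (x : E)) := by
    refine ⟨?_⟩
    rw [Measure.finsetSum_apply]
    exact ENNReal.sum_lt_top.2 fun x _ => measure_lt_top _ _
  infer_instance

lemma lap_posteriorLaw (hH : H {0} = 0) {u : ℝ≥0} (hu : u ≠ 0) {n : ℕ} (y : Fin n → E)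
    (Q : Measure (Measure E)) [IsProbabilityMeasure Q] {h : E → ℝ≥0} (hh : Measurable h) :
    lap (posteriorLaw H y u Q) h =
      kapProd H (fun x => h x + u) y / kapProd H (fun _ => u) y * lap Q h := by
  have := isProbabilityMeasure_jumpLaw H hH hu
  rw [lap, posteriorLaw, lintegral_map (measurable_expNeg_lintegral hh)
    (measurable_posterior_map y)]
  have h1 : ∀ p : ({x // x ∈ distinctValues y} → ℝ≥0) × Measure E,
      expNeg (∫⁻ z, h z ∂((∑ x : {x // x ∈ distinctValues y},
        (p.1 x : ℝ≥0∞) • Measure.dirac (x : E)) + p.2)) =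
      (∏ x : {x // x ∈ distinctValues y}, expNeg ((p.1 x : ℝ≥0∞) * h x)) *
        expNeg (∫⁻ z, h z ∂p.2) := by
    intro p
    rw [lintegral_add_measure, expNeg_add, lintegral_finsetSum_measure, expNeg_sum]
    simp_rw [lintegral_smul_measure, lintegral_dirac' _ hh.coe_nnreal_ennreal, smul_eq_mul]
  have hm : ∀ x : {x // x ∈ distinctValues y}, Measurable fun s : ℝ≥0 =>
      expNeg ((s : ℝ≥0∞) * h x) := fun x => by fun_prop
  simp_rw [h1]
  rw [lintegral_prod_mul (f := fun s : {x // x ∈ distinctValues y} → ℝ≥0 =>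
      ∏ x : {x // x ∈ distinctValues y}, expNeg ((s x : ℝ≥0∞) * h x))
    (Finset.measurable_fun_prod _ fun x _ => (hm x).comp (measurable_pi_apply x)).aemeasurable
    (measurable_expNeg_lintegral hh).aemeasurable, lintegral_pi_prod _ hm]
  simp_rw [lintegral_expNeg_jumpLaw]
  rw [kapProd, kapProd, ← ENNReal.prod_div_distrib
    (fun z _ w _ _ => Or.inr (kap_ne_top H hu _)),
    ← Finset.prod_coe_sort (distinctValues y)]
  rfl

end PosteriorLaw

/-! ### The sampling model -/

section Model

variable {E : Type*} [MeasurableSpace E]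

lemma ext_pi_prod {n : ℕ} {F : Type*} [MeasurableSpace F] {μ ν : Measure ((Fin n → E) × F)}
    [IsFiniteMeasure μ] (h : ∀ (C : Fin n → Set E) (B : Set F),
      (∀ i, MeasurableSet (C i)) → MeasurableSet B →
        μ (Set.univ.pi C ×ˢ B) = ν (Set.univ.pi C ×ˢ B)) : μ = ν := by
  refine Measure.ext_prod fun {A B} hA hB => ?_
  have hr : ∀ (ρ : Measure ((Fin n → E) × F)) {A : Set (Fin n → E)}, MeasurableSet A →
      (ρ.restrict (Set.univ ×ˢ B)).fst A = ρ (A ×ˢ B) := by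
    intro ρ A hA
    rw [Measure.fst_apply hA, Measure.restrict_apply (measurable_fst hA)]
    congr 1
    ext p; simp
  rw [← hr μ hA, ← hr ν hA]
  congr 1
  refine ext_of_generate_finite _ generateFrom_pi.symm isPiSystem_pi ?_ ?_
  · rintro _ ⟨C, hC, rfl⟩
    have hC' : ∀ i, MeasurableSet (C i) := fun i => hC i (Set.mem_univ i)
    rw [hr _ (MeasurableSet.univ_pi hC'), hr _ (MeasurableSet.univ_pi hC')]
    exact h C B hC' hB
  · rw [hr _ MeasurableSet.univ, hr _ MeasurableSet.univ, ← Set.pi_univ Set.univ]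
    exact h _ B (fun _ => MeasurableSet.univ) hB

/-- The factor `u^{n-1} / Γ(n)` of the Gamma density. -/
def gammaFactor (n : ℕ) (v : ℝ) : ℝ≥0∞ :=
  if 0 < v then ENNReal.ofReal (v ^ ((n : ℝ) - 1) / Real.Gamma n) else 0

lemma measurable_gammaFactor (n : ℕ) : Measurable (gammaFactor n) :=
  Measurable.ite measurableSet_Ioi (by fun_prop) measurable_const

lemma gammaFactor_ne_zero {n : ℕ} (hn : 0 < n) {v : ℝ} (hv : 0 < v) : gammaFactor n v ≠ 0 := by
  rw [gammaFactor, if_pos hv]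
  have h1 : 0 < Real.Gamma n := Real.Gamma_pos_of_pos (by exact_mod_cast hn)
  have h2 : 0 < v ^ ((n : ℝ) - 1) := Real.rpow_pos_of_pos hv _
  exact (ENNReal.ofReal_pos.2 (by positivity)).ne'

lemma gammaFactor_ne_top (n : ℕ) (v : ℝ) : gammaFactor n v ≠ ∞ := by
  rw [gammaFactor]
  split_ifs <;> simp

/-- The weight of `C₁ × … × Cₙ × B` for the law of the sample, given the random measure `μ`. -/
def sampleWeight {n : ℕ} (C : Fin n → Set E) (B : Set ℝ) (μ : Measure E) : ℝ≥0∞ :=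
  (∏ i, (μ (C i) / μ Set.univ)) * gammaMeasure (n : ℝ) (μ Set.univ).toReal B

/-- The weight of `C₁ × … × Cₙ × {v}`, as a density in `v`. -/
def sampleDensity {n : ℕ} (C : Fin n → Set E) (μ : Measure E) (v : ℝ) : ℝ≥0∞ :=
  gammaFactor n v * (expNeg (v.toNNReal * μ Set.univ) * ∏ i, μ (C i))

lemma measurable_sampleDensity {n : ℕ} {C : Fin n → Set E} (hC : ∀ i, MeasurableSet (C i)) :
    Measurable fun p : Measure E × ℝ => sampleDensity C p.1 p.2 := by
  have h1 : Measurable fun p : Measure E × ℝ => p.1 Set.univ :=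
    (Measure.measurable_coe MeasurableSet.univ).comp measurable_fst
  refine ((measurable_gammaFactor n).comp measurable_snd).mul (Measurable.mul ?_ ?_)
  · exact measurable_expNeg.comp
      ((measurable_snd.real_toNNReal.coe_nnreal_ennreal).mul h1)
  · exact Finset.measurable_fun_prod _ fun i _ => (Measure.measurable_coe (hC i)).comp measurable_fst

lemma sampleWeight_eq {n : ℕ} (hn : 0 < n) (C : Fin n → Set E) {B : Set ℝ} (hB : MeasurableSet B)
    (μ : Measure E) [IsFiniteMeasure μ] :
    sampleWeight C B μ = ∫⁻ v in B, sampleDensity C μ v := by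
  by_cases h0 : μ Set.univ = 0
  · have hC0 : ∀ i, μ (C i) = 0 := fun i => measure_mono_null (Set.subset_univ _) h0
    have hz : ∏ i : Fin n, μ (C i) = 0 := Finset.prod_eq_zero (Finset.mem_univ ⟨0, hn⟩) (hC0 _)
    have hz' : ∏ i : Fin n, (μ (C i) / μ Set.univ) = 0 :=
      Finset.prod_eq_zero (Finset.mem_univ ⟨0, hn⟩) (by simp [hC0])
    simp [sampleWeight, sampleDensity, hz, hz']
  set T := (μ Set.univ).toReal with hT
  have hTpos : 0 < T := ENNReal.toReal_pos h0 (measure_ne_top _ _)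
  have hTe : μ Set.univ = ENNReal.ofReal T := (ENNReal.ofReal_toReal (measure_ne_top _ _)).symm
  have hΓ : 0 < Real.Gamma n := Real.Gamma_pos_of_pos (by exact_mod_cast hn)
  have hpdf : ∀ᵐ v : ℝ, gammaPDF n T v =
      (μ Set.univ) ^ n * (gammaFactor n v * expNeg (v.toNNReal * μ Set.univ)) := by
    have hne : ∀ᵐ v : ℝ, v ≠ 0 := by simp [ae_iff]
    filter_upwards [hne] with v hv
    rcases lt_or_gt_of_ne hv with hv | hv
    · rw [gammaPDF_of_neg hv, gammaFactor, if_neg (not_lt.2 hv.le)]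
      simp
    · have hve : (v.toNNReal : ℝ≥0∞) = ENNReal.ofReal v := rfl
      rw [gammaPDF_of_nonneg hv.le, gammaFactor, if_pos hv, hTe, hve, ← ENNReal.ofReal_mul hv.le,
        expNeg_ofReal (by positivity), ← ENNReal.ofReal_pow hTpos.le,
        ← ENNReal.ofReal_mul (by positivity), ← ENNReal.ofReal_mul (by positivity),
        Real.rpow_natCast]
      congr 1
      rw [mul_comm v T]
      ring
  have hm : Measurable fun v : ℝ => gammaFactor n v * expNeg (v.toNNReal * μ Set.univ) :=
    (measurable_gammaFactor n).mul (by fun_prop)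
  rw [sampleWeight, gammaMeasure, withDensity_apply _ hB,
    lintegral_congr_ae (ae_restrict_of_ae hpdf), lintegral_const_mul _ hm, ← mul_assoc]
  have h1 : (∏ i, (μ (C i) / μ Set.univ)) * (μ Set.univ) ^ n = ∏ i, μ (C i) := by
    conv_lhs => rw [← Fin.prod_const n (μ Set.univ)]
    rw [← Finset.prod_mul_distrib]
    exact Finset.prod_congr rfl fun i _ => ENNReal.div_mul_cancel h0 (measure_ne_top _ _)
  rw [h1, ← lintegral_const_mul _ hm]
  refine lintegral_congr fun v => ?_
  rw [sampleDensity]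
  ring

variable {ω : Measure E} {f : Measure E → ℝ≥0}

/-- The density of the sample `(y, v)`, for the random measure tilted by `exp(-∫ h dμ)`. -/
def tiltedDensity (ω : Measure E) (f : Measure E → ℝ≥0) (H : Measure ℝ≥0) {n : ℕ} (h : E → ℝ≥0)
    (p : (Fin n → E) × ℝ) : ℝ≥0∞ :=
  gammaFactor n p.2 * (kapProd H (fun x => h x + p.2.toNNReal) p.1 *
    zed ω f H (fun x => h x + p.2.toNNReal) (distinctConfig p.1))

lemma measurable_kapProd_tilted [MeasurableEq E] (H : Measure ℝ≥0) [IsProbabilityMeasure H] {n : ℕ}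
    {h : E → ℝ≥0} (hh : Measurable h) :
    Measurable fun p : (Fin n → E) × ℝ => kapProd H (fun x => h x + p.2.toNNReal) p.1 := by
  have h1 : Measurable fun p : ℝ × E => h p.2 + p.1.toNNReal :=
    (hh.comp measurable_snd).add measurable_fst.real_toNNReal
  exact measurable_kapProd H (h := fun (v : ℝ) x => h x + v.toNNReal) h1 n

lemma measurable_zed_tilted [MeasurableEq E] [IsFiniteMeasure ω] (hf : Measurable f)
    (H : Measure ℝ≥0) [IsProbabilityMeasure H] {n : ℕ} {h : E → ℝ≥0} (hh : Measurable h) :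
    Measurable fun p : (Fin n → E) × ℝ =>
      zed ω f H (fun x => h x + p.2.toNNReal) (distinctConfig p.1) := by
  have h1 : Measurable fun p : ℝ × E => h p.2 + p.1.toNNReal :=
    (hh.comp measurable_snd).add measurable_fst.real_toNNReal
  exact measurable_zed hf H (h := fun (v : ℝ) x => h x + v.toNNReal) h1 n

lemma measurable_tiltedDensity [MeasurableEq E] [IsFiniteMeasure ω] (hf : Measurable f)
    (H : Measure ℝ≥0) [IsProbabilityMeasure H] {n : ℕ} {h : E → ℝ≥0} (hh : Measurable h) :
    Measurable (tiltedDensity ω f H h : (Fin n → E) × ℝ → ℝ≥0∞) :=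
  ((measurable_gammaFactor n).comp measurable_snd).mul
    ((measurable_kapProd_tilted H hh).mul (measurable_zed_tilted hf H hh))

/-- The Laplace functional of the random measure, on the event that the sample is in
`C₁ × … × Cₙ × B`. -/
lemma lintegral_sampleWeight_mul_expNeg [TopologicalSpace E] [MeasurableEq E]
    [MeasurableSingletonClass E] [IsFiniteMeasure ω] [NullSingletonClass ω]
    (hs : ∀ᵐ ν ∂(janossy ω), IsSimplePointMeasure ν) (hf : Measurable f)
    {H : Measure ℝ≥0} [IsProbabilityMeasure H] {Pμ : Measure (Measure E)}
    (hμ : IsRM ((janossy ω).withDensity fun ν => (f ν : ℝ≥0∞)) H Pμ) {n : ℕ} (hn : 0 < n)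
    {C : Fin n → Set E} (hC : ∀ i, MeasurableSet (C i)) {B : Set ℝ} (hB : MeasurableSet B)
    {h : E → ℝ≥0} (hh : Measurable h) :
    ∫⁻ μ, sampleWeight C B μ * expNeg (∫⁻ x, h x ∂μ) ∂Pμ =
      ∫⁻ p in Set.univ.pi C ×ˢ B, tiltedDensity ω f H h p ∂((meckeMeasure ω n).prod volume) := by
  have hP := hμ.isProbabilityMeasure
  have hS := measurable_sampleDensity hC
  have hSμ : ∀ μ : Measure E, Measurable fun v => sampleDensity C μ v := fun μ =>
    hS.comp (by fun_prop : Measurable fun v : ℝ => (μ, v))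
  have hexp := measurable_expNeg_lintegral hh
  have h1 : ∫⁻ μ, sampleWeight C B μ * expNeg (∫⁻ x, h x ∂μ) ∂Pμ =
      ∫⁻ μ, (∫⁻ v in B, sampleDensity C μ v * expNeg (∫⁻ x, h x ∂μ)) ∂Pμ := by
    refine lintegral_congr_ae ?_
    filter_upwards [hμ.ae_isFiniteMeasure] with μ hμ
    rw [sampleWeight_eq hn C hB, lintegral_mul_const _ (hSμ μ)]
  rw [h1, lintegral_lintegral_swap (hS.mul (hexp.comp measurable_fst)).aemeasurable,
    setLIntegral_prod_symm _ (measurable_tiltedDensity hf H hh).aemeasurable]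
  refine lintegral_congr fun v => ?_
  have h2 : ∀ μ : Measure E, sampleDensity C μ v * expNeg (∫⁻ x, h x ∂μ) =
      gammaFactor n v * (expNeg (∫⁻ x, ((h x + v.toNNReal : ℝ≥0) : ℝ≥0∞) ∂μ) *
        ∏ i, μ (C i)) := by
    intro μ
    simp only [ENNReal.coe_add]
    rw [lintegral_add_right _ measurable_const, lintegral_const, expNeg_add, sampleDensity]
    ring
  have hhv : Measurable fun x => h x + v.toNNReal := hh.add_const _
  have h3 : Measurable fun μ : Measure E =>
      expNeg (∫⁻ x, ((h x + v.toNNReal : ℝ≥0) : ℝ≥0∞) ∂μ) * ∏ i, μ (C i) :=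
    (measurable_expNeg_lintegral hhv).mul
      (Finset.measurable_fun_prod _ fun i _ => Measure.measurable_coe (hC i))
  have h4 := hμ.lintegral_expNeg_mul_prod_gibbs hf
    ((withDensity_absolutelyContinuous _ _).ae_le hs) hC hhv
  simp_rw [h2]
  rw [lintegral_const_mul _ h3, h4, ← lintegral_const_mul' _ _ (gammaFactor_ne_top n v)]
  rfl

end Model

/-! ### Disintegration of the sampling model -/

section Disintegration

variable {E : Type*} [MeasurableSpace E] {ω : Measure E} {f : Measure E → ℝ≥0} {n : ℕ}

/-- The sample `p.1` and the value `p.2` of the Gamma variable for which the normalising constant is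
positive and finite. -/
def IsRegular (ω : Measure E) (f : Measure E → ℝ≥0) (H : Measure ℝ≥0) (p : (Fin n → E) × ℝ) :
    Prop :=
  0 < p.2 ∧ zed ω f H (fun _ => p.2.toNNReal) (distinctConfig p.1) ≠ 0 ∧
    zed ω f H (fun _ => p.2.toNNReal) (distinctConfig p.1) ≠ ∞

lemma tiltedDensity_zero (H : Measure ℝ≥0) (p : (Fin n → E) × ℝ) : tiltedDensity ω f H (fun _ => 0) p =
    gammaFactor n p.2 * (kapProd H (fun _ => p.2.toNNReal) p.1 *
      zed ω f H (fun _ => p.2.toNNReal) (distinctConfig p.1)) := by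
  simp only [tiltedDensity, zero_add]

variable (H : Measure ℝ≥0) [IsProbabilityMeasure H]

lemma measurableSet_isRegular [MeasurableEq E] [IsFiniteMeasure ω] (hf : Measurable f) :
    MeasurableSet {p : (Fin n → E) × ℝ | IsRegular ω f H p} := by
  have h1 : Measurable fun p : (Fin n → E) × ℝ =>
      zed ω f H (fun _ => p.2.toNNReal) (distinctConfig p.1) := by
    simpa only [zero_add] using measurable_zed_tilted (ω := ω) hf H (n := n)
      (h := fun _ => 0) measurable_const
  exact (measurableSet_lt measurable_const measurable_snd).inter
    ((h1 (measurableSet_singleton 0)).compl.inter (h1 (measurableSet_singleton ∞)).compl)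

variable [TopologicalSpace E] [MeasurableEq E] [MeasurableSingletonClass E]

lemma IsPostRM.lap_posteriorLaw (hf : Measurable f) (hH : H {0} = 0) {y : Fin n → E} {u : ℝ≥0}
    (hu : u ≠ 0) {Q : Measure (Measure E)}
    (hQ : IsPostRM (janossy ω) f H u (distinctConfig y) Q) {h : E → ℝ≥0} (hh : Measurable h) :
    lap (posteriorLaw H y u Q) h =
      kapProd H (fun x => h x + u) y / kapProd H (fun _ => u) y *
        (zed ω f H (fun x => h x + u) (distinctConfig y) /
          zed ω f H (fun _ => u) (distinctConfig y)) := by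
  have := hQ.isProbabilityMeasure
  rw [NRM.lap_posteriorLaw H hH hu y Q hh, hQ.lap_eq H hf hh]

/-- The posterior laws form a kernel. -/
theorem exists_posteriorKernel [MeasurableSpace.CountablyGenerated E] [IsFiniteMeasure ω]
    (hs : ∀ᵐ ν ∂(janossy ω), IsSimplePointMeasure ν) (hf : Measurable f) (hH : H {0} = 0)
    (hn : 0 < n) :
    ∃ K : Kernel ((Fin n → E) × ℝ) (Measure E), IsMarkovKernel K ∧
      (∀ p, ∀ᵐ μ ∂(K p), IsFiniteMeasure μ) ∧
      ∀ p, IsRegular ω f H p → ∃ Qη, IsPostRM (janossy ω) f H p.2 (distinctConfig p.1) Qη ∧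
        K p = posteriorLaw H p.1 p.2 Qη := by
  classical
  have hex : ∀ p : (Fin n → E) × ℝ, IsRegular ω f H p →
      ∃ Qη, IsPostRM (janossy ω) f H p.2.toNNReal (distinctConfig p.1) Qη := by
    intro p hp
    have : Nonempty E := ⟨p.1 ⟨0, hn⟩⟩
    exact exists_isPostRM H hs hf _ hp.2.1 hp.2.2
  choose Q hQ using hex
  have hpos : ∀ p : (Fin n → E) × ℝ, IsRegular ω f H p → p.2.toNNReal ≠ 0 := fun p hp =>
    (Real.toNNReal_pos.2 hp.1).ne'
  set κ : (Fin n → E) × ℝ → Measure (Measure E) := fun p =>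
    if hp : IsRegular ω f H p then posteriorLaw H p.1 p.2.toNNReal (Q p hp)
    else Measure.dirac 0 with hκ
  have hprob : ∀ p, IsProbabilityMeasure (κ p) := by
    intro p
    by_cases hp : IsRegular ω f H p
    · have := (hQ p hp).isProbabilityMeasure
      simp only [hκ, dif_pos hp]
      exact isProbabilityMeasure_posteriorLaw H hH (hpos p hp) p.1 _
    · simp only [hκ, dif_neg hp]
      infer_instance
  have hfin : ∀ p, ∀ᵐ μ ∂(κ p), IsFiniteMeasure μ := by
    intro p
    by_cases hp : IsRegular ω f H p
    · have := (hQ p hp).isProbabilityMeasure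
      simp only [hκ, dif_pos hp]
      exact ae_posteriorLaw_isFiniteMeasure H hH (hpos p hp) p.1 (hQ p hp).ae_isFiniteMeasure
    · simp only [hκ, dif_neg hp]
      rw [ae_dirac_iff measurableSet_isFiniteMeasure]
      infer_instance
  have hlap : ∀ t, Measurable fun p => lap (κ p) (testFun t) := by
    intro t
    have ht := measurable_testFun (E := E) t
    have h0 : Measurable fun _ : E => (0 : ℝ≥0) := measurable_const
    have k1 := measurable_kapProd_tilted H (n := n) ht
    have k0 := measurable_kapProd_tilted H (n := n) h0
    have z1 := measurable_zed_tilted (ω := ω) hf H (n := n) ht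
    have z0 := measurable_zed_tilted (ω := ω) hf H (n := n) h0
    have heq : (fun p : (Fin n → E) × ℝ => lap (κ p) (testFun t)) =
      fun p : (Fin n → E) × ℝ => if IsRegular ω f H p then
        kapProd H (fun x : E => testFun t x + p.2.toNNReal) p.1 /
          kapProd H (fun _ : E => 0 + p.2.toNNReal) p.1 *
        (zed ω f H (fun x : E => testFun t x + p.2.toNNReal) (distinctConfig p.1) /
          zed ω f H (fun _ : E => 0 + p.2.toNNReal) (distinctConfig p.1))
        else lap (Measure.dirac (0 : Measure E)) (testFun t) := by
      ext1 p
      by_cases hp : IsRegular ω f H p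
      · simp only [hκ, dif_pos hp, if_pos hp, zero_add]
        exact (hQ p hp).lap_posteriorLaw H hf hH (hpos p hp) ht
      · simp only [hκ, dif_neg hp, if_neg hp]
    rw [heq]
    exact Measurable.ite (measurableSet_isRegular H hf) ((k1.div k0).mul (z1.div z0))
      measurable_const
  refine ⟨⟨κ, measurable_of_measurable_lap hfin hlap⟩, ⟨hprob⟩, hfin, fun p hp => ⟨Q p hp, ?_⟩⟩
  have hc : ((p.2.toNNReal : ℝ≥0) : ℝ) = p.2 := Real.coe_toNNReal _ hp.1.le
  have h1 := hQ p hp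
  rw [hc] at h1
  refine ⟨h1, ?_⟩
  change κ p = _
  simp only [hκ, dif_pos hp, hc]

lemma tiltedDensity_zero_mul_lap (hf : Measurable f) (hH : H {0} = 0)
    {K : Measure (Measure E)} {p : (Fin n → E) × ℝ}
    (hK : IsRegular ω f H p → ∃ Qη, IsPostRM (janossy ω) f H p.2 (distinctConfig p.1) Qη ∧
        K = posteriorLaw H p.1 p.2 Qη)
    (hp : 0 < p.2 → zed ω f H (fun _ => p.2.toNNReal) (distinctConfig p.1) ≠ ∞)
    {h : E → ℝ≥0} (hh : Measurable h) :
    tiltedDensity ω f H (fun _ => 0) p * lap K h = tiltedDensity ω f H h p := by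
  rw [tiltedDensity_zero, tiltedDensity]
  by_cases hv : 0 < p.2
  swap
  · simp [gammaFactor, hv]
  have hu : p.2.toNNReal ≠ 0 := (Real.toNNReal_pos.2 hv).ne'
  by_cases hz : zed ω f H (fun _ => p.2.toNNReal) (distinctConfig p.1) = 0
  · have hz' : zed ω f H (fun x => h x + p.2.toNNReal) (distinctConfig p.1) = 0 :=
      le_zero_iff.1 ((zed_anti H (fun x => le_add_self) _).trans hz.le)
    simp [hz, hz']
  obtain ⟨Q, hQ, rfl⟩ := hK ⟨hv, hz, hp hv⟩
  rw [← Real.coe_toNNReal _ hv.le] at hQ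
  have hl := hQ.lap_posteriorLaw H hf hH hu hh
  rw [Real.coe_toNNReal _ hv.le] at hl
  rw [hl]
  set k := kapProd H (fun _ => p.2.toNNReal) p.1
  set z := zed ω f H (fun _ => p.2.toNNReal) (distinctConfig p.1)
  have hk0 : k ≠ 0 := kapProd_ne_zero H hH _ _
  have hkt : k ≠ ∞ := kapProd_ne_top H hu _
  rw [mul_assoc]
  congr 1
  calc _ = (k * (kapProd H (fun x => h x + p.2.toNNReal) p.1 / k)) *
        (z * (zed ω f H (fun x => h x + p.2.toNNReal) (distinctConfig p.1) / z)) := by ring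
    _ = _ := by rw [ENNReal.mul_div_cancel hk0 hkt, ENNReal.mul_div_cancel hz (hp hv)]

end Disintegration

section Model

variable {E : Type*} [MeasurableSpace E] {n : ℕ} {Pμ : Measure (Measure E)}
  {J : Measure (((Fin n → E) × ℝ) × Measure E)}

lemma sampleWeight_le_one (hn : 0 < n) (C : Fin n → Set E) (B : Set ℝ) (μ : Measure E) :
    sampleWeight C B μ ≤ 1 := by
  have h1 : ∏ i, (μ (C i) / μ Set.univ) ≤ 1 := Finset.prod_le_one' fun i _ =>
    (ENNReal.div_le_div_right (measure_mono (Set.subset_univ _)) _).trans ENNReal.div_self_le_one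
  by_cases hT : 0 < (μ Set.univ).toReal
  · have := isProbabilityMeasure_gammaMeasure (a := n) (by exact_mod_cast hn) hT
    exact mul_le_one' h1 prob_le_one
  · have h2 : ∏ i, (μ (C i) / μ Set.univ) = 0 := by
      refine Finset.prod_eq_zero (Finset.mem_univ ⟨0, hn⟩) ?_
      rcases (ENNReal.toReal_eq_zero_iff _).1
        (le_antisymm (not_lt.1 hT) ENNReal.toReal_nonneg) with h | h
      · rw [measure_mono_null (Set.subset_univ _) h, ENNReal.zero_div]
      · rw [h, ENNReal.div_top]
    simp [sampleWeight, h2]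

lemma IsModelLaw.apply (hJ : IsModelLaw n Pμ J) {C : Fin n → Set E} (hC : ∀ i, MeasurableSet (C i))
    {B : Set ℝ} (hB : MeasurableSet B) {L : Set (Measure E)} (hL : MeasurableSet L) :
    J ((Set.univ.pi C ×ˢ B) ×ˢ L) = ∫⁻ μ in L, sampleWeight C B μ ∂Pμ :=
  hJ C B L hC hB hL

lemma IsModelLaw.isFiniteMeasure (hn : 0 < n) [IsFiniteMeasure Pμ] (hJ : IsModelLaw n Pμ J) :
    IsFiniteMeasure J := by
  refine ⟨?_⟩
  have h := hJ.apply (fun _ => MeasurableSet.univ) MeasurableSet.univ MeasurableSet.univ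
  rw [Set.pi_univ, Set.univ_prod_univ, Set.univ_prod_univ, Measure.restrict_univ] at h
  rw [h]
  refine (lintegral_mono fun μ => sampleWeight_le_one hn _ _ μ).trans_lt ?_
  simp

lemma ext_pi_prod_prod {X F : Type*} [MeasurableSpace X] [MeasurableSpace F]
    {μ ν : Measure (((Fin n → E) × F) × X)} [IsFiniteMeasure μ]
    (h : ∀ (C : Fin n → Set E) (B : Set F) (L : Set X), (∀ i, MeasurableSet (C i)) →
      MeasurableSet B → MeasurableSet L →
        μ ((Set.univ.pi C ×ˢ B) ×ˢ L) = ν ((Set.univ.pi C ×ˢ B) ×ˢ L)) : μ = ν := by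
  refine Measure.ext_prod fun {A L} hA hL => ?_
  have hr : ∀ (ρ : Measure (((Fin n → E) × F) × X)) {A : Set ((Fin n → E) × F)},
      MeasurableSet A → (ρ.restrict (Set.univ ×ˢ L)).fst A = ρ (A ×ˢ L) := by
    intro ρ A hA
    rw [Measure.fst_apply hA, Measure.restrict_apply (measurable_fst hA)]
    congr 1
    ext p; simp
  rw [← hr μ hA, ← hr ν hA]
  congr 1
  refine ext_pi_prod fun C B hC hB => ?_
  have hS : MeasurableSet (Set.univ.pi C ×ˢ B) := (MeasurableSet.univ_pi hC).prod hB
  rw [hr _ hS, hr _ hS, h C B L hC hB hL]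

variable {ω : Measure E} {f : Measure E → ℝ≥0} [TopologicalSpace E] [MeasurableEq E]
  [MeasurableSingletonClass E] [IsFiniteMeasure ω] [NullSingletonClass ω] {H : Measure ℝ≥0}
  [IsProbabilityMeasure H]

/-- The law of the sample. -/
lemma IsModelLaw.fst_eq (hn : 0 < n) (hJ : IsModelLaw n Pμ J) (hf : Measurable f)
    (hs : ∀ᵐ ν ∂(janossy ω), IsSimplePointMeasure ν)
    (hμ : IsRM ((janossy ω).withDensity fun ν => (f ν : ℝ≥0∞)) H Pμ) :
    J.fst = ((meckeMeasure ω n).prod volume).withDensity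
      (tiltedDensity ω f H fun _ => 0) := by
  have hP := hμ.isProbabilityMeasure
  have hJfin := hJ.isFiniteMeasure hn
  refine ext_pi_prod fun C B hC hB => ?_
  have hS : MeasurableSet (Set.univ.pi C ×ˢ B) := (MeasurableSet.univ_pi hC).prod hB
  rw [withDensity_apply _ hS, ← lintegral_sampleWeight_mul_expNeg hs hf hμ hn hC hB
    measurable_const, Measure.fst_apply hS, ← Set.prod_univ, hJ.apply hC hB MeasurableSet.univ]
  simp

lemma IsModelLaw.ae_isRegular (hn : 0 < n) (hJ : IsModelLaw n Pμ J) (hf : Measurable f)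
    (hH : H {0} = 0) (hs : ∀ᵐ ν ∂(janossy ω), IsSimplePointMeasure ν)
    (hμ : IsRM ((janossy ω).withDensity fun ν => (f ν : ℝ≥0∞)) H Pμ) :
    (∀ᵐ p : (Fin n → E) × ℝ ∂((meckeMeasure ω n).prod volume), 0 < p.2 →
      zed ω f H (fun _ => p.2.toNNReal) (distinctConfig p.1) ≠ ∞) ∧
    ∀ᵐ p ∂J.fst, IsRegular ω f H p := by
  have hP := hμ.isProbabilityMeasure
  have hJfin := hJ.isFiniteMeasure hn
  have hfst := hJ.fst_eq hn hf hs hμ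
  have hD : Measurable (tiltedDensity ω f H (fun _ => 0) : (Fin n → E) × ℝ → ℝ≥0∞) :=
    measurable_tiltedDensity hf H measurable_const
  have h1 : ∀ᵐ p : (Fin n → E) × ℝ ∂((meckeMeasure ω n).prod volume), 0 < p.2 →
      zed ω f H (fun _ => p.2.toNNReal) (distinctConfig p.1) ≠ ∞ := by
    have hlt : ∀ᵐ p : (Fin n → E) × ℝ ∂((meckeMeasure ω n).prod volume),
        tiltedDensity ω f H (fun _ => 0) p < ∞ := by
      refine ae_lt_top hD ?_
      rw [← setLIntegral_univ, ← withDensity_apply _ MeasurableSet.univ, ← hfst]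
      exact measure_ne_top _ _
    filter_upwards [hlt] with p hp hv hz
    rw [tiltedDensity_zero, hz, ENNReal.mul_top (kapProd_ne_zero H hH _ _),
      ENNReal.mul_top (gammaFactor_ne_zero hn hv)] at hp
    exact hp.ne rfl
  refine ⟨h1, ?_⟩
  rw [hfst, ae_withDensity_iff hD]
  filter_upwards [h1] with p hp hne
  rw [tiltedDensity_zero] at hne
  have hv : 0 < p.2 := by
    by_contra hv
    exact hne (by simp [gammaFactor, hv])
  exact ⟨hv, fun hz => hne (by simp [hz]), hp hv⟩

/-- The conditional law of the random measure, given the sample and the Gamma variable. -/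
theorem IsModelLaw.eq_compProd [MeasurableSpace.CountablyGenerated E] (hn : 0 < n)
    (hJ : IsModelLaw n Pμ J) (hf : Measurable f) (hH : H {0} = 0)
    (hs : ∀ᵐ ν ∂(janossy ω), IsSimplePointMeasure ν)
    (hμ : IsRM ((janossy ω).withDensity fun ν => (f ν : ℝ≥0∞)) H Pμ)
    {K : Kernel ((Fin n → E) × ℝ) (Measure E)} [IsMarkovKernel K]
    (hKfin : ∀ p, ∀ᵐ μ ∂(K p), IsFiniteMeasure μ)
    (hK : ∀ p, IsRegular ω f H p → ∃ Qη, IsPostRM (janossy ω) f H p.2 (distinctConfig p.1) Qη ∧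
        K p = posteriorLaw H p.1 p.2 Qη) :
    J = J.fst ⊗ₘ K := by
  have hP := hμ.isProbabilityMeasure
  have hJfin := hJ.isFiniteMeasure hn
  refine ext_pi_prod_prod fun C B L hC hB hL => ?_
  have hS : MeasurableSet (Set.univ.pi C ×ˢ B) := (MeasurableSet.univ_pi hC).prod hB
  set S := Set.univ.pi C ×ˢ B
  have h1 : J (S ×ˢ L) = (Pμ.withDensity (sampleWeight C B)) L := by
    rw [hJ.apply hC hB hL, withDensity_apply _ hL]
  have h2 : (J.fst ⊗ₘ K) (S ×ˢ L) = ((J.fst.restrict S).bind K) L := by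
    rw [Measure.compProd_apply_prod hS hL, Measure.bind_apply hL K.aemeasurable]
  rw [h1, h2]
  have hwm : AEMeasurable (sampleWeight C B) Pμ := by
    refine ⟨fun μ => ∫⁻ v in B, sampleDensity C μ v,
      (measurable_sampleDensity hC).lintegral_prod_right', ?_⟩
    filter_upwards [hμ.ae_isFiniteMeasure] with μ hμ
    exact sampleWeight_eq hn C hB μ
  have hfin : IsFiniteMeasure (Pμ.withDensity (sampleWeight C B)) := by
    refine isFiniteMeasure_withDensity (ne_top_of_le_ne_top ENNReal.one_ne_top ?_)
    exact (lintegral_mono fun μ => sampleWeight_le_one hn C B μ).trans (by simp)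
  congr 1
  refine ext_of_lap_eq ((withDensity_absolutelyContinuous _ _).ae_le hμ.ae_isFiniteMeasure)
    ?_ fun t => ?_
  · have hm : MeasurableSet {μ : Measure E | ¬ IsFiniteMeasure μ} :=
      measurableSet_isFiniteMeasure.compl
    rw [ae_iff, Measure.bind_apply hm K.aemeasurable]
    simp_rw [ae_iff.1 (hKfin _), lintegral_zero]
  have ht := measurable_testFun (E := E) t
  have hexp := measurable_expNeg_lintegral ht
  rw [lap, lintegral_withDensity_eq_lintegral_mul₀ hwm hexp.aemeasurable]
  simp only [Pi.mul_apply]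
  rw [lintegral_sampleWeight_mul_expNeg hs hf hμ hn hC hB ht, lap,
    Measure.lintegral_bind K.aemeasurable hexp.aemeasurable, hJ.fst_eq hn hf hs hμ,
    restrict_withDensity hS, lintegral_withDensity_eq_lintegral_mul _
      (measurable_tiltedDensity hf H measurable_const) (hexp.lintegral_kernel)]
  refine lintegral_congr_ae (ae_restrict_of_ae ?_)
  filter_upwards [(hJ.ae_isRegular hn hf hH hs hμ).1] with p hp
  exact (tiltedDensity_zero_mul_lap H hf hH (hK p) hp ht).symm

end Model

end

end NRM

theorem mainTheorem9 {E : Type*} [TopologicalSpace E] [PolishSpace E] [MeasurableSpace E]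
    [BorelSpace E] (ω : Measure E) [IsLocallyFiniteMeasure ω]
    (PN : Measure (Measure E)) (hN : NRM.IsPoissonProcess ω PN)
    (f : Measure E → ℝ≥0) (PΦ : Measure (Measure E)) (hΦ : NRM.IsGibbs PN f PΦ)
    (hfin : ∀ᵐ ν ∂PΦ, IsFiniteMeasure ν)
    (H : Measure ℝ≥0) [IsProbabilityMeasure H] (hH : H {0} = 0) :
    -- the law of `μ̃'` with the Laplace functional of the posterior theorem is that of `η̃`
    (∀ (k : ℕ) (R : Kernel (Fin k → E) (Measure E)), 0 < k → NRM.IsReducedPalm PΦ k R →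
      ∀ᵐ y ∂(NRM.momentMeasure PΦ k), Function.Injective y → ∀ u : ℝ, 0 < u →
        (∃ Qr, NRM.IsRM (R y) H Qr) ∧
        (∃ Qη, NRM.IsPostRM PN f H u (NRM.pointSum y) Qη) ∧
        ∀ Qr Qη : Measure (Measure E), NRM.IsRM (R y) H Qr →
          NRM.IsPostRM PN f H u (NRM.pointSum y) Qη →
          ∀ Q' : Measure (Measure E), IsProbabilityMeasure Q' →
            (∀ᵐ μ ∂Q', IsFiniteMeasure μ) →
            ((∀ g : E → ℝ, Measurable g → (∀ x, 0 ≤ g x) → (∃ c, ∀ x, g x ≤ c) →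
                NRM.laplaceFunctional Q' g =
                  NRM.laplaceFunctional Qr (fun x => g x + u) /
                    NRM.laplaceFunctional Qr (fun _ => u)) ↔
              Q' = Qη)) ∧
    -- conditionally on the sample and on `U`, `μ̃` is distributed as `∑ⱼ S*ⱼ δ_{y*ⱼ} + η̃`
    (∀ (n : ℕ) (Pμ : Measure (Measure E)) (J : Measure (((Fin n → E) × ℝ) × Measure E)),
      0 < n → NRM.IsRM PΦ H Pμ → NRM.IsModelLaw n Pμ J →
      ∃ K : Kernel ((Fin n → E) × ℝ) (Measure E), IsMarkovKernel K ∧ J = J.fst ⊗ₘ K ∧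
        ∀ᵐ p ∂J.fst, 0 < p.2 ∧
          ∃ Qη, NRM.IsPostRM PN f H p.2 (NRM.distinctConfig p.1) Qη ∧
            K p = NRM.posteriorLaw H p.1 p.2 Qη) := by
  have hcg : MeasurableSpace.CountablyGenerated E := inferInstance
  have hω : IsFiniteMeasure ω := hN.isFiniteMeasure_of_isGibbs hΦ hfin
  have hnull := hN.nullSingletonClass
  have hs := hN.isPointProcess.ae_isSimple
  have hf := hΦ.measurable_density
  have hprob := hΦ.isPointProcess.isProbabilityMeasure
  obtain rfl := hΦ.eq_withDensity
  obtain rfl := hN.eq_janossy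
  refine ⟨fun k R hk hR => NRM.posterior_laplaceFunctional hs hf H hk hR,
    fun n Pμ J hn hμ hJ => ?_⟩
  obtain ⟨K, hK, hKfin, hKreg⟩ := NRM.exists_posteriorKernel H (n := n) hs hf hH hn
  refine ⟨K, hK, hJ.eq_compProd hn hf hH hs hμ hKfin hKreg, ?_⟩
  filter_upwards [(hJ.ae_isRegular hn hf hH hs hμ).2] with p hp
  exact ⟨hp.1, hKreg p hp⟩
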